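/- Let $d_1,d_2\ge 1$ and let $\Theta^*\in\mathbb R^{d_1\times d_2}$ have all row sums equal to $0$ and rank at most $r$. Put $d=(d_1+d_2)/2$ and let $\alpha=\max_{i,j_1,j_2}|\Theta^*_{i j_1}-\Theta^*_{i j_2}|$ be its dynamic range. Sampling model. Independently for every user $i\in\{1,\dots,d_1\}$, $k$ items $j_{i,1},\dots,j_{i,k}$ are drawn independently and uniformly, with replacement, from $\{1,\dots,d_2\}$. Given these, the user ranks the $k$ alternatives (copies of the same item count as distinct alternatives of equal weight) according to the MultiNomial Logit model: if $v_{i,\ell}$ denotes the item ranked at the $\ell$-th place and $S_{i,\ell}$ the multiset of the alternatives not yet ranked before the $\ell$-th choice, so that $S_{i,\ell}=\{v_{i,\ell},\dots,v_{i,k}\}$ as a multiset, then a ranking has probability $\prod_{\ell=1}^k e^{\Theta^*_{i,v_{i,\ell}}}/\sum_{j\in S_{i,\ell}}e^{\Theta^*_{i,j}}$. Estimator. Let $\Omega_\alpha$ be the set of $A\in\mathbb R^{d_1\times d_2}$ with $|A_{ij}|\le\alpha$ for all $i,j$ and $\sum_j A_{ij}=0$ for all $i$, let $$\mathcal L(\Theta)=-\frac1{k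 d_1}\sum_{i=1}^{d_1}\sum_{\ell=1}^k\Big(\Theta_{i,v_{i,\ell}}-\log\sum_{j\in S_{i,\ell}}e^{\Theta_{i,j}}\Big),$$ and let $\widehat\Theta\in\arg\min_{\Theta\in\Omega_\alpha}\mathcal L(\Theta)+\lambda\|\Theta\|_{*}$, where $\|\cdot\|_{*}$ is the nuclear norm (the sum of the singular values). Assume $24\le k\le\min\{d_1^2,\,(d_1^2+d_2^2)/(2d_1)\}\log d$ and $\lambda\in[32\lambda_0,c_0\lambda_0]$, where $c_0>32$ is a constant and $$\lambda_0=e^{2\alpha}\sqrt{\frac{d_1\log d+d_2(\log d)^2}{k\,d_1^2\,d_2}}.$$ Then, with probability at least $1-2d^{-3}$, every such minimizer $\widehat\Theta$ satisfies $$\frac1{\sqrt{d_1d_2}}\|\widehat\Theta-\Theta^*\|_F\le 288\sqrt2\,e^{6\alpha}c_0\sqrt{\frac{r\,(d_1\log d+d_2(\log d)^2)}{k\,d_1}}.$$ -/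

import Mathlib

open MeasureTheory

noncomputable section

namespace KWise

/-! ### Norms of matrices -/

open scoped Matrix.Norms.Frobenius in
/-- The Frobenius norm. -/
def frobNorm {d₁ d₂ : ℕ} (A : Matrix (Fin d₁) (Fin d₂) ℝ) : ℝ := ‖A‖

/-- The nuclear norm: the sum of the `min d₁ d₂` singular values. -/
def nuclearNorm {d₁ d₂ : ℕ} (A : Matrix (Fin d₁) (Fin d₂) ℝ) : ℝ :=
  ∑ j ∈ Finset.range (min d₁ d₂), (Matrix.toEuclideanLin A).singularValues j

/-! ### The MultiNomial Logit (MNL) ranking model -/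

/-- The MNL probability of a ranking of `k` alternatives (given as `k` slots) of utilities `u`.
The ranking `σ` puts slot `σ ℓ` at the `ℓ`-th place (place `0` is the best), so the alternatives
still unranked before the `ℓ`-th choice are the slots `σ m` with `ℓ ≤ m`. -/
def mnlWeight {k : ℕ} (u : Fin k → ℝ) (σ : Equiv.Perm (Fin k)) : ℝ :=
  ∏ ℓ, Real.exp (u (σ ℓ)) / ∑ m ∈ Finset.Ici ℓ, Real.exp (u (σ m))

theorem mnlWeight_nonneg {k : ℕ} (u : Fin k → ℝ) (σ : Equiv.Perm (Fin k)) :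
    0 ≤ mnlWeight u σ :=
  Finset.prod_nonneg fun _ _ => div_nonneg (Real.exp_pos _).le
    (Finset.sum_nonneg fun _ _ => (Real.exp_pos _).le)

theorem mnlWeight_decompose {k : ℕ} (u : Fin (k + 1) → ℝ) (p : Fin (k + 1))
    (e : Equiv.Perm (Fin k)) :
    mnlWeight u (Equiv.Perm.decomposeFin.symm (p, e)) =
      Real.exp (u p) / (∑ m, Real.exp (u m)) *
        mnlWeight (fun x => u (Equiv.swap 0 p x.succ)) e := by
  have h0 : Finset.Ici (0 : Fin (k + 1)) = Finset.univ := by ext; simp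
  have hs : ∀ ℓ : Fin k, Finset.Ici ℓ.succ = (Finset.Ici ℓ).map (Fin.succEmb k) := by
    intro ℓ; ext x
    refine Fin.cases ?_ (fun y => ?_) x <;> simp
  unfold mnlWeight
  rw [Fin.prod_univ_succ]
  congr 1
  · rw [h0, Equiv.Perm.decomposeFin_symm_apply_zero]
    congr 1
    exact Equiv.sum_comp (Equiv.Perm.decomposeFin.symm (p, e)) fun m => Real.exp (u m)
  · refine Finset.prod_congr rfl fun ℓ _ => ?_
    rw [hs, Finset.sum_map]
    simp only [Fin.coe_succEmb, Equiv.Perm.decomposeFin_symm_apply_succ]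

theorem sum_mnlWeight : ∀ {k : ℕ} (u : Fin k → ℝ), ∑ σ, mnlWeight u σ = 1
  | 0, u => by simp [mnlWeight]
  | k + 1, u => by
    have hpos : 0 < ∑ m, Real.exp (u m) :=
      Finset.sum_pos (fun _ _ => Real.exp_pos _) Finset.univ_nonempty
    rw [← Equiv.sum_comp Equiv.Perm.decomposeFin.symm, Fintype.sum_prod_type]
    simp only [mnlWeight_decompose, ← Finset.mul_sum, sum_mnlWeight, mul_one]
    rw [← Finset.sum_div, div_self hpos.ne']

/-- The MNL distribution over rankings of `k` alternatives of utilities `u`. -/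
def mnlLaw {k : ℕ} (u : Fin k → ℝ) : PMF (Equiv.Perm (Fin k)) :=
  PMF.ofFintype (fun σ => ENNReal.ofReal (mnlWeight u σ)) <| by
    rw [← ENNReal.ofReal_sum_of_nonneg fun σ _ => mnlWeight_nonneg u σ, sum_mnlWeight,
      ENNReal.ofReal_one]

/-- What is seen of one user: the `k` presented items (possibly with repetitions) and her ranking
of the `k` slots. -/
abbrev UserData (d₂ k : ℕ) : Type := (Fin k → Fin d₂) × Equiv.Perm (Fin k)

/-- The item ranked at the `ℓ`-th place. -/
def UserData.choice {d₂ k : ℕ} (x : UserData d₂ k) (ℓ : Fin k) : Fin d₂ := x.1 (x.2 ℓ)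

/-- All subsets of the finite set of rankings are events. -/
instance instMeasurableSpacePermFin (k : ℕ) : MeasurableSpace (Equiv.Perm (Fin k)) := ⊤

/-- The law of the data of one user with utilities `θ`: the `k` items are independent and uniform
(that is, the list of items is uniform over all lists), and given the items the ranking follows the
MNL model, copies of an item counting as distinct alternatives of equal utility. -/
def userLaw {d₂ : ℕ} [NeZero d₂] (k : ℕ) (θ : Fin d₂ → ℝ) : PMF (UserData d₂ k) :=
  (PMF.uniformOfFintype (Fin k → Fin d₂)).bind fun items =>
    (mnlLaw fun ℓ => θ (items ℓ)).map fun σ => (items, σ)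

/-- The law of the data of all users, who are independent of each other. -/
def sampleLaw {d₁ d₂ : ℕ} [NeZero d₂] (k : ℕ) (Θ : Matrix (Fin d₁) (Fin d₂) ℝ) :
    Measure (Fin d₁ → UserData d₂ k) :=
  Measure.pi fun i => (userLaw k (Θ i)).toMeasure

/-! ### The estimator -/

/-- The normalized negative log likelihood. -/
def negLogLik {d₁ d₂ k : ℕ} (x : Fin d₁ → UserData d₂ k) (Θ : Matrix (Fin d₁) (Fin d₂) ℝ) : ℝ :=
  -(1 / ((k : ℝ) * d₁)) * ∑ i, ∑ ℓ, (Θ i ((x i).choice ℓ) -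
    Real.log (∑ m ∈ Finset.Ici ℓ, Real.exp (Θ i ((x i).choice m))))

/-- The dynamic range `max |Θ i j₁ - Θ i j₂|` over all `i`, `j₁`, `j₂`. -/
def dynamicRange {d₁ d₂ : ℕ} (Θ : Matrix (Fin d₁) (Fin d₂) ℝ) : ℝ :=
  ⨆ q : Fin d₁ × Fin d₂ × Fin d₂, |Θ q.1 q.2.1 - Θ q.1 q.2.2|

/-- The feasible set: entries bounded by `α`, rows summing to zero. -/
def feasible (d₁ d₂ : ℕ) (α : ℝ) : Set (Matrix (Fin d₁) (Fin d₂) ℝ) :=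
  {A | (∀ i j, |A i j| ≤ α) ∧ ∀ i, ∑ j, A i j = 0}

/-- `Θhat` solves the nuclear norm regularized maximum likelihood problem over the feasible set. -/
def IsEstimate {d₁ d₂ k : ℕ} (α lam : ℝ) (x : Fin d₁ → UserData d₂ k)
    (Θhat : Matrix (Fin d₁) (Fin d₂) ℝ) : Prop :=
  Θhat ∈ feasible d₁ d₂ α ∧
    IsMinOn (fun Θ => negLogLik x Θ + lam * nuclearNorm Θ) (feasible d₁ d₂ α) Θhat

/-- The average dimension `d = (d₁ + d₂) / 2`. -/
def avgDim (d₁ d₂ : ℕ) : ℝ := ((d₁ : ℝ) + d₂) / 2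

/-- The reference value `λ₀` of the regularization parameter. -/
def lambda0 (d₁ d₂ k : ℕ) (α : ℝ) : ℝ :=
  Real.exp (2 * α) * √((d₁ * Real.log (avgDim d₁ d₂) + d₂ * Real.log (avgDim d₁ d₂) ^ 2) /
    (k * (d₁ : ℝ) ^ 2 * d₂))

end KWise

end

/-! This is the analysis of a nuclear-norm penalized M-estimator. Put Δ = Θhat - Θ*. Suppose the
normalized score at Θ* has operator norm at most λ/2. Optimality of Θhat, duality of the operator
and nuclear norms, and decomposability (`nuclearNorm_decomposable`) then give two facts: the nuclear
norm of Δ is at most 6√r times its Frobenius norm, and the Bregman divergence of the likelihood at Δ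
is at most 2λ√r‖Δ‖_F. `frobNorm_le_of_events` needs a quadratic lower bound of the divergence only
on one slice ‖Δ‖_F = F₀, because a larger Δ can be scaled down to the slice: the lower bound is
quadratic in Δ, the penalty linear.

The curvature comes from `logSumExp_lower`. Each of the first L choices of a user contributes
e^{-2α}/(4k) times an energy, the sum of squared differences of Δ over fixed disjoint pairs of slots
that are still unranked after L choices. Those survivors are dependent. However, an MNL ranking is
the order in which independent exponential clocks ring, with rates proportional to the exponentials
of the utilities. If at least L clocks have rung by time t, the slots silent at time t lie among the
survivors, and slots are silent independently. `chainMean_le_thin` proves this comparison by a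
differential equation and `sum_prod_replacement` carries it to all users. With independent slots,
`restricted_strong_convexity_tail` bounds the lower tail of the energy uniformly over the slice,
through the Laplace transform: symmetrization, contraction from squares to linear terms, duality,
and the matrix Rademacher bound `sum_coshTrace_le`, which rests on a noncommutative Khintchine
inequality.

The score has independent rows, one for each user. A row is a sum of martingale differences over the
stages of the ranking; its second moment matrix is at most k/d₂ times the identity, and its norm is
sub-Gaussian (`sum_mnlWeight_mul_exp_le`). `score_tail` truncates the rows at squared norm R of
order k log d and applies the rank-one Laplace bound `sum_expTrace_sum_rank_one` to the Gram matrix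
at a level of order d₁/d₂ + log d. The product of the two orders is the source of d₁ log d + d₂ (log
d)².

If the claimed bound is at least 2α it holds trivially. Otherwise k ≥ 10⁹ e^{2α} log d, which makes
d₁ and log d large and absorbs every numerical constant. Each of the two bad events then has
probability at most d⁻³. -/

namespace KWise
open Matrix

/-! ### Spectral calculus: traces of powers, of exp and of cosh. -/

section Spectral
variable {n : Type*} [Fintype n] [DecidableEq n]

/-- Spectral theorem for real symmetric matrices, in terms of an orthogonal matrix. -/
theorem exists_orthogonal_diagonalization {X : Matrix n n ℝ} (hX : Xᵀ = X) :
    ∃ (U : Matrix n n ℝ) (ev : n → ℝ), Uᵀ * U = 1 ∧ U * Uᵀ = 1 ∧ X = U * diagonal ev * Uᵀ := by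
  have hH : X.IsHermitian := by
    rw [Matrix.IsHermitian, conjTranspose_eq_transpose_of_trivial, hX]
  have hU := Unitary.coe_star_mul_self hH.eigenvectorUnitary
  rw [star_eq_conjTranspose, conjTranspose_eq_transpose_of_trivial] at hU
  refine ⟨hH.eigenvectorUnitary, hH.eigenvalues, hU, mul_eq_one_comm.1 hU, ?_⟩
  · have := hH.spectral_theorem
    rw [Unitary.conjStarAlgAut_apply, star_eq_conjTranspose,
      conjTranspose_eq_transpose_of_trivial] at this
    exact this

theorem conj_diagonal_mul {U : Matrix n n ℝ} (hU : Uᵀ * U = 1) (a b : n → ℝ) :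
    (U * diagonal a * Uᵀ) * (U * diagonal b * Uᵀ) = U * diagonal (fun i => a i * b i) * Uᵀ := by
  calc (U * diagonal a * Uᵀ) * (U * diagonal b * Uᵀ)
      = U * diagonal a * (Uᵀ * U) * diagonal b * Uᵀ := by simp only [Matrix.mul_assoc]
    _ = _ := by rw [hU, Matrix.mul_one, Matrix.mul_assoc U, diagonal_mul_diagonal]

theorem conj_diagonal_pow {U : Matrix n n ℝ} (hU : Uᵀ * U = 1) (hU' : U * Uᵀ = 1) (a : n → ℝ)
    (p : ℕ) : (U * diagonal a * Uᵀ) ^ p = U * diagonal (fun i => a i ^ p) * Uᵀ := by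
  induction p with
  | zero => simp [hU']
  | succ p ih => rw [pow_succ, ih, conj_diagonal_mul hU]; simp [pow_succ]

theorem trace_conj_diagonal {U : Matrix n n ℝ} (hU : Uᵀ * U = 1) (a : n → ℝ) :
    (U * diagonal a * Uᵀ).trace = ∑ i, a i := by
  rw [Matrix.trace_mul_comm, ← Matrix.mul_assoc, hU, Matrix.one_mul, trace_diagonal]

theorem dotProduct_conj_diagonal (U : Matrix n n ℝ) (a : n → ℝ) (x y : n → ℝ) :
    x ⬝ᵥ (U * diagonal a * Uᵀ) *ᵥ y = ∑ i, a i * ((Uᵀ *ᵥ x) i * (Uᵀ *ᵥ y) i) := by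
  rw [← mulVec_mulVec, ← mulVec_mulVec, dotProduct_mulVec, ← mulVec_transpose, dotProduct]
  refine Finset.sum_congr rfl fun i _ => ?_
  rw [mulVec_diagonal]; ring

theorem dotProduct_orthogonal {U : Matrix n n ℝ} (hU' : U * Uᵀ = 1) (x y : n → ℝ) :
    (Uᵀ *ᵥ x) ⬝ᵥ (Uᵀ *ᵥ y) = x ⬝ᵥ y := by
  rw [dotProduct_mulVec, ← mulVec_transpose, transpose_transpose, mulVec_mulVec, hU', one_mulVec]

/-- `tr exp X`, as a power series. -/
noncomputable def expTrace (X : Matrix n n ℝ) : ℝ := ∑' p : ℕ, (X ^ p).trace / (p.factorial : ℝ)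

/-- `tr cosh X`, as a power series. -/
noncomputable def coshTrace (X : Matrix n n ℝ) : ℝ :=
  ∑' p : ℕ, (X ^ (2 * p)).trace / ((2 * p).factorial : ℝ)

theorem hasSum_exp (x : ℝ) : HasSum (fun p : ℕ => x ^ p / (p.factorial : ℝ)) (Real.exp x) := by
  rw [Real.exp_eq_exp_ℝ]; exact NormedSpace.expSeries_div_hasSum_exp x

theorem hasSum_expTrace_conj_diagonal {U : Matrix n n ℝ} (hU : Uᵀ * U = 1) (hU' : U * Uᵀ = 1)
    (a : n → ℝ) : HasSum (fun p : ℕ => ((U * diagonal a * Uᵀ) ^ p).trace / (p.factorial : ℝ))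
      (∑ i, Real.exp (a i)) := by
  simp only [conj_diagonal_pow hU hU', trace_conj_diagonal hU, Finset.sum_div]
  exact hasSum_sum fun i _ => hasSum_exp (a i)

theorem hasSum_coshTrace_conj_diagonal {U : Matrix n n ℝ} (hU : Uᵀ * U = 1) (hU' : U * Uᵀ = 1)
    (a : n → ℝ) :
    HasSum (fun p : ℕ => ((U * diagonal a * Uᵀ) ^ (2 * p)).trace / ((2 * p).factorial : ℝ))
      (∑ i, Real.cosh (a i)) := by
  simp only [conj_diagonal_pow hU hU', trace_conj_diagonal hU, Finset.sum_div]
  exact hasSum_sum fun i _ => Real.hasSum_cosh (a i)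

theorem hasSum_expTrace {X : Matrix n n ℝ} (hX : Xᵀ = X) :
    HasSum (fun p : ℕ => (X ^ p).trace / (p.factorial : ℝ)) (expTrace X) := by
  obtain ⟨U, ev, hU, hU', rfl⟩ := exists_orthogonal_diagonalization hX
  exact (hasSum_expTrace_conj_diagonal hU hU' ev).summable.hasSum

theorem hasSum_coshTrace {X : Matrix n n ℝ} (hX : Xᵀ = X) :
    HasSum (fun p : ℕ => (X ^ (2 * p)).trace / ((2 * p).factorial : ℝ)) (coshTrace X) := by
  obtain ⟨U, ev, hU, hU', rfl⟩ := exists_orthogonal_diagonalization hX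
  exact (hasSum_coshTrace_conj_diagonal hU hU' ev).summable.hasSum

theorem expTrace_zero : expTrace (0 : Matrix n n ℝ) = Fintype.card n := by
  have h := hasSum_expTrace_conj_diagonal (n := n) (U := 1) (by simp) (by simp) 0
  have h0 : (1 : Matrix n n ℝ) * diagonal 0 * 1ᵀ = 0 := by simp
  rw [h0] at h
  rw [expTrace, h.tsum_eq]; simp

/-- A symmetric matrix has a largest eigenvalue, which is controlled by the exponential trace. -/
theorem exists_top_eigenvalue [Nonempty n] {X : Matrix n n ℝ} (hX : Xᵀ = X) :
    ∃ μ : ℝ, (∀ z, z ⬝ᵥ X *ᵥ z ≤ μ * (z ⬝ᵥ z)) ∧ Real.exp μ ≤ expTrace X ∧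
      Real.exp μ ≤ 2 * coshTrace X := by
  obtain ⟨U, ev, hU, hU', rfl⟩ := exists_orthogonal_diagonalization hX
  obtain ⟨a, ha⟩ := Finite.exists_max ev
  refine ⟨ev a, fun z => ?_, ?_, ?_⟩
  · rw [dotProduct_conj_diagonal, ← dotProduct_orthogonal hU' z z, dotProduct, Finset.mul_sum]
    exact Finset.sum_le_sum fun i _ => mul_le_mul_of_nonneg_right (ha i) (mul_self_nonneg _)
  · rw [expTrace, (hasSum_expTrace_conj_diagonal hU hU' ev).tsum_eq]
    exact Finset.single_le_sum (f := fun i => Real.exp (ev i)) (fun i _ => (Real.exp_pos _).le)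
      (Finset.mem_univ a)
  · rw [coshTrace, (hasSum_coshTrace_conj_diagonal hU hU' ev).tsum_eq]
    have h1 : Real.cosh (ev a) ≤ ∑ i, Real.cosh (ev i) :=
      Finset.single_le_sum (f := fun i => Real.cosh (ev i)) (fun i _ => (Real.cosh_pos _).le)
        (Finset.mem_univ a)
    have h2 := Real.cosh_eq (ev a)
    have h3 := Real.exp_pos (-ev a)
    linarith

end Spectral
end KWise

/-! ### Exponential trace of sums of random rank-one matrices. -/

namespace KWise
open Matrix

theorem sum_fin_succ_pi {n : ℕ} {Ω M : Type*} [Fintype Ω] [AddCommMonoid M]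
    (F : (Fin (n + 1) → Ω) → M) :
    ∑ x, F x = ∑ a, ∑ y : Fin n → Ω, F (Fin.cons a y) := by
  rw [← Equiv.sum_comp (Fin.consEquiv fun _ => Ω), Fintype.sum_prod_type]
  rfl

/-- Chebyshev's association inequality with weights. -/
theorem weighted_chebyshev {ι : Type*} [Fintype ι] {w a b : ι → ℝ} (hw : ∀ i, 0 ≤ w i)
    (hab : ∀ i j, 0 ≤ (a i - a j) * (b i - b j)) :
    (∑ i, w i * a i) * (∑ i, w i * b i) ≤ (∑ i, w i) * ∑ i, w i * (a i * b i) := by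
  have h : 0 ≤ ∑ i, ∑ j, w i * w j * ((a i - a j) * (b i - b j)) :=
    Finset.sum_nonneg fun i _ => Finset.sum_nonneg fun j _ =>
      mul_nonneg (mul_nonneg (hw i) (hw j)) (hab i j)
  have e : ∑ i, ∑ j, w i * w j * ((a i - a j) * (b i - b j)) =
      (∑ i, w i * (a i * b i)) * (∑ j, w j) - (∑ i, w i * a i) * (∑ j, w j * b j)
      - (∑ i, w i * b i) * (∑ j, w j * a j) + (∑ i, w i) * (∑ j, w j * (a j * b j)) := by
    simp only [Finset.sum_mul_sum, ← Finset.sum_sub_distrib, ← Finset.sum_add_distrib]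
    exact Finset.sum_congr rfl fun i _ => Finset.sum_congr rfl fun j _ => by ring
  rw [e] at h
  nlinarith [mul_comm (∑ i, w i * (a i * b i)) (∑ j, w j),
    mul_comm (∑ i, w i * b i) (∑ j, w j * a j)]

section RankOne
variable {n : Type*} [Fintype n] [DecidableEq n]

theorem pow_mul_pow_comonotone {x y : ℝ} (hx : 0 ≤ x) (hy : 0 ≤ y) (t s : ℕ) :
    0 ≤ ((x + 1) ^ t - (y + 1) ^ t) * (x ^ s - y ^ s) := by
  rcases le_total x y with h | h
  · exact mul_nonneg_of_nonpos_of_nonpos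
      (sub_nonpos.2 (pow_le_pow_left₀ (by linarith) (by linarith) t))
      (sub_nonpos.2 (pow_le_pow_left₀ hx h s))
  · exact mul_nonneg (sub_nonneg.2 (pow_le_pow_left₀ (by linarith) (by linarith) t))
      (sub_nonneg.2 (pow_le_pow_left₀ hy h s))

/-- Splitting one factor `A + g gᵀ` off the power produces a product of two quadratic forms at `g`.
In the eigenbasis of `A` both are bounded by means of increasing functions of the eigenvalue under
weights of total mass at most 1, so Chebyshev's inequality merges them into one mean. In effect the
perturbation raises every eigenvalue by 1. -/
theorem dotProduct_pow_rank_one {U : Matrix n n ℝ} (hU : Uᵀ * U = 1) (hU' : U * Uᵀ = 1)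
    {ev : n → ℝ} (hev : ∀ i, 0 ≤ ev i) {g : n → ℝ} (hg : g ⬝ᵥ g ≤ 1) (t s : ℕ) :
    g ⬝ᵥ ((U * diagonal ev * Uᵀ + vecMulVec g g) ^ t * (U * diagonal ev * Uᵀ) ^ s) *ᵥ g ≤
      ∑ i, (Uᵀ *ᵥ g) i ^ 2 * ((ev i + 1) ^ t * ev i ^ s) := by
  have hA : ∀ s, g ⬝ᵥ (U * diagonal ev * Uᵀ) ^ s *ᵥ g = ∑ i, (Uᵀ *ᵥ g) i ^ 2 * ev i ^ s := by
    intro s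
    rw [conj_diagonal_pow hU hU', dotProduct_conj_diagonal]
    exact Finset.sum_congr rfl fun i _ => by ring
  have hg1 : ∑ i, (Uᵀ *ᵥ g) i ^ 2 ≤ 1 := by
    refine le_trans (le_of_eq ?_) hg
    rw [← dotProduct_orthogonal hU', dotProduct]
    exact Finset.sum_congr rfl fun i _ => by ring
  induction t generalizing s with
  | zero => simp [hA]
  | succ t ih =>
    have h0 := ih 0
    simp only [pow_zero, mul_one] at h0
    have hs0 : 0 ≤ ∑ i, (Uᵀ *ᵥ g) i ^ 2 * ev i ^ s :=
      Finset.sum_nonneg fun i _ => mul_nonneg (sq_nonneg _) (pow_nonneg (hev i) _)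
    have key : g ⬝ᵥ ((U * diagonal ev * Uᵀ + vecMulVec g g) ^ (t + 1) *
        (U * diagonal ev * Uᵀ) ^ s) *ᵥ g =
        g ⬝ᵥ ((U * diagonal ev * Uᵀ + vecMulVec g g) ^ t * (U * diagonal ev * Uᵀ) ^ (s + 1)) *ᵥ g +
        (g ⬝ᵥ (U * diagonal ev * Uᵀ + vecMulVec g g) ^ t *ᵥ g) *
          (g ⬝ᵥ (U * diagonal ev * Uᵀ) ^ s *ᵥ g) := by
      rw [pow_succ, Matrix.mul_assoc, Matrix.add_mul, ← pow_succ', Matrix.mul_add, add_mulVec,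
        dotProduct_add]
      congr 1
      rw [← mulVec_mulVec, ← mulVec_mulVec, vecMulVec_mulVec]
      simp [mulVec_smul, dotProduct_smul, mul_comm]
    rw [key, hA]
    have hch := weighted_chebyshev (w := fun i => (Uᵀ *ᵥ g) i ^ 2) (a := fun i => (ev i + 1) ^ t)
      (b := fun i => ev i ^ s) (fun i => sq_nonneg _)
      (fun i j => pow_mul_pow_comonotone (hev i) (hev j) t s)
    have hpos : 0 ≤ ∑ i, (Uᵀ *ᵥ g) i ^ 2 * ((ev i + 1) ^ t * ev i ^ s) :=
      Finset.sum_nonneg fun i _ => mul_nonneg (sq_nonneg _)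
        (mul_nonneg (pow_nonneg (by linarith [hev i]) _) (pow_nonneg (hev i) _))
    have e : ∑ i, (Uᵀ *ᵥ g) i ^ 2 * ((ev i + 1) ^ (t + 1) * ev i ^ s) =
        ∑ i, (Uᵀ *ᵥ g) i ^ 2 * ((ev i + 1) ^ t * ev i ^ (s + 1)) +
        ∑ i, (Uᵀ *ᵥ g) i ^ 2 * ((ev i + 1) ^ t * ev i ^ s) := by
      rw [← Finset.sum_add_distrib]
      exact Finset.sum_congr rfl fun i _ => by ring
    rw [e]
    have h1 := ih (s + 1)
    have h2 := mul_le_mul_of_nonneg_right h0 hs0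
    have h3 := mul_le_of_le_one_left hpos hg1
    linarith

/-- The bound is linear in the squared coordinates of `g` in the eigenbasis of `A`, so an average
over a random `g` needs only its second moments. This plays the part that trace inequalities for
matrix exponentials play in the usual proofs. -/
theorem trace_pow_rank_one {U : Matrix n n ℝ} (hU : Uᵀ * U = 1) (hU' : U * Uᵀ = 1)
    {ev : n → ℝ} (hev : ∀ i, 0 ≤ ev i) {g : n → ℝ} (hg : g ⬝ᵥ g ≤ 1) (t s : ℕ) :
    ((U * diagonal ev * Uᵀ + vecMulVec g g) ^ t * (U * diagonal ev * Uᵀ) ^ s).trace ≤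
      ∑ i, ev i ^ (t + s) +
        ∑ i, (Uᵀ *ᵥ g) i ^ 2 * (((ev i + 1) ^ t - ev i ^ t) * ev i ^ s) := by
  induction t generalizing s with
  | zero => simp [conj_diagonal_pow hU hU', trace_conj_diagonal hU]
  | succ t ih =>
    have key : ((U * diagonal ev * Uᵀ + vecMulVec g g) ^ (t + 1) *
        (U * diagonal ev * Uᵀ) ^ s).trace =
        ((U * diagonal ev * Uᵀ + vecMulVec g g) ^ t * (U * diagonal ev * Uᵀ) ^ (s + 1)).trace +
        g ⬝ᵥ ((U * diagonal ev * Uᵀ + vecMulVec g g) ^ t * (U * diagonal ev * Uᵀ) ^ s) *ᵥ g := by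
      have hsA : ((U * diagonal ev * Uᵀ) ^ s)ᵀ = (U * diagonal ev * Uᵀ) ^ s := by
        rw [conj_diagonal_pow hU hU']; simp [Matrix.mul_assoc]
      rw [pow_succ, Matrix.mul_assoc, Matrix.add_mul, ← pow_succ', Matrix.mul_add, trace_add]
      congr 1
      rw [vecMulVec_mul, mul_vecMulVec, trace_vecMulVec, ← mulVec_transpose, hsA, dotProduct_comm,
        ← mulVec_mulVec]
      set C := (U * diagonal ev * Uᵀ) ^ s
      have hsB : ((U * diagonal ev * Uᵀ + vecMulVec g g) ^ t)ᵀ =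
          (U * diagonal ev * Uᵀ + vecMulVec g g) ^ t := by
        rw [transpose_pow, transpose_add, transpose_vecMulVec]; simp [Matrix.mul_assoc]
      set D := (U * diagonal ev * Uᵀ + vecMulVec g g) ^ t
      rw [dotProduct_mulVec g D, ← mulVec_transpose, hsB, dotProduct_comm]
    rw [key]
    have h1 := ih (s + 1)
    have h2 := dotProduct_pow_rank_one hU hU' hev hg t s
    refine (add_le_add h1 h2).trans (le_of_eq ?_)
    rw [add_assoc, ← Finset.sum_add_distrib]
    congr 1
    · exact Finset.sum_congr rfl fun i _ => by congr 1; ring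
    · exact Finset.sum_congr rfl fun i _ => by ring

/-- A random positive rank-one perturbation increases the exponential trace by a bounded factor in
expectation. -/
theorem sum_expTrace_rank_one {Ω : Type*} [Fintype Ω] {w : Ω → ℝ} (hw : ∀ x, 0 ≤ w x)
    (hw1 : ∑ x, w x = 1) {g : Ω → n → ℝ} (hg : ∀ x, g x ⬝ᵥ g x ≤ 1) {σ : ℝ}
    (hσ : ∀ z, ∑ x, w x * (g x ⬝ᵥ z) ^ 2 ≤ σ * (z ⬝ᵥ z)) {A : Matrix n n ℝ} (hA : Aᵀ = A)
    (hA0 : ∀ z, 0 ≤ z ⬝ᵥ A *ᵥ z) :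
    ∑ x, w x * expTrace (A + vecMulVec (g x) (g x)) ≤
      (1 + σ * (Real.exp 1 - 1)) * expTrace A := by
  have hsym : ∀ x, (A + vecMulVec (g x) (g x))ᵀ = A + vecMulVec (g x) (g x) := fun x => by
    rw [transpose_add, transpose_vecMulVec, hA]
  have hL := hasSum_sum (s := Finset.univ) fun x _ => (hasSum_expTrace (hsym x)).mul_left (w x)
  obtain ⟨U, ev, hU, hU', rfl⟩ := exists_orthogonal_diagonalization hA
  have hcol : ∀ i, (Uᵀ *ᵥ fun j => U j i) = Pi.single i 1 := by
    intro i
    have : (fun j => U j i) = U *ᵥ Pi.single i 1 := by rw [mulVec_single_one]; rfl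
    rw [this, mulVec_mulVec, hU, one_mulVec]
  have hev : ∀ i, 0 ≤ ev i := by
    intro i
    have := hA0 (fun j => U j i)
    rw [dotProduct_conj_diagonal, hcol] at this
    simpa [Pi.single_apply] using this
  have hσi : ∀ i, ∑ x, w x * (Uᵀ *ᵥ g x) i ^ 2 ≤ σ := by
    intro i
    have h := hσ (fun j => U j i)
    rw [← dotProduct_orthogonal hU', hcol] at h
    simp only [dotProduct_single, Pi.single_eq_same, mul_one] at h
    refine le_trans (le_of_eq (Finset.sum_congr rfl fun x _ => ?_)) h
    rw [dotProduct_comm]; rfl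
  have hR : HasSum (fun p : ℕ => ∑ i, (ev i ^ p / p.factorial +
      σ * ((ev i + 1) ^ p / p.factorial - ev i ^ p / p.factorial)))
      (∑ i, (Real.exp (ev i) + σ * (Real.exp (ev i + 1) - Real.exp (ev i)))) :=
    hasSum_sum fun i _ => (hasSum_exp _).add (((hasSum_exp _).sub (hasSum_exp _)).mul_left σ)
  -- The two exponential series are compared term by term; only the power p of the perturbed matrix
  -- matters at each term.
  have hle := hasSum_le (fun p => ?_) hL hR
  · refine hle.trans (le_of_eq ?_)
    rw [expTrace, (hasSum_expTrace_conj_diagonal hU hU' ev).tsum_eq, Finset.mul_sum]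
    refine Finset.sum_congr rfl fun i _ => ?_
    rw [Real.exp_add]; ring
  · have hp : (0 : ℝ) < p.factorial := by positivity
    have h1 : ∀ x, w x * (((U * diagonal ev * Uᵀ + vecMulVec (g x) (g x)) ^ p).trace / p.factorial)
        ≤ w x * ((∑ i, ev i ^ p +
          ∑ i, (Uᵀ *ᵥ g x) i ^ 2 * ((ev i + 1) ^ p - ev i ^ p)) / p.factorial) := by
      intro x
      have := trace_pow_rank_one hU hU' hev (hg x) p 0
      simp only [pow_zero, add_zero, mul_one] at this
      exact mul_le_mul_of_nonneg_left (div_le_div_of_nonneg_right this hp.le) (hw x)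
    refine (Finset.sum_le_sum fun x _ => h1 x).trans ?_
    have h2 : ∑ x, w x * ((∑ i, ev i ^ p +
          ∑ i, (Uᵀ *ᵥ g x) i ^ 2 * ((ev i + 1) ^ p - ev i ^ p)) / p.factorial) =
        (∑ i, ev i ^ p + ∑ i, (∑ x, w x * (Uᵀ *ᵥ g x) i ^ 2) * ((ev i + 1) ^ p - ev i ^ p))
          / p.factorial := by
      have e1 : ∑ i, (∑ x, w x * (Uᵀ *ᵥ g x) i ^ 2) * ((ev i + 1) ^ p - ev i ^ p) =
          ∑ x, w x * ∑ i, (Uᵀ *ᵥ g x) i ^ 2 * ((ev i + 1) ^ p - ev i ^ p) := by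
        simp only [Finset.sum_mul, Finset.mul_sum]
        rw [Finset.sum_comm]
        exact Finset.sum_congr rfl fun x _ => Finset.sum_congr rfl fun i _ => by ring
      have e2 : ∑ i, ev i ^ p = ∑ x, w x * ∑ i, ev i ^ p := by
        rw [← Finset.sum_mul, hw1, one_mul]
      rw [e1, e2, ← Finset.sum_add_distrib, Finset.sum_div]
      refine Finset.sum_congr rfl fun x _ => ?_
      rw [← e2]; ring
    rw [h2, ← Finset.sum_add_distrib, Finset.sum_div]
    refine Finset.sum_le_sum fun i _ => ?_
    have h3 : ev i ^ p ≤ (ev i + 1) ^ p := pow_le_pow_left₀ (hev i) (by linarith) p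
    have h4 := mul_le_mul_of_nonneg_right (hσi i) (sub_nonneg.2 h3)
    calc _ ≤ (ev i ^ p + σ * ((ev i + 1) ^ p - ev i ^ p)) / p.factorial :=
          div_le_div_of_nonneg_right (by linarith) hp.le
      _ = _ := by ring

/-- Laplace transform bound for a sum of independent random positive rank-one matrices. -/
theorem sum_expTrace_sum_rank_one {Ω : Type*} [Fintype Ω] {σ : ℝ} (hσ0 : 0 ≤ σ) {N : ℕ}
    {w : Fin N → Ω → ℝ} (hw : ∀ i x, 0 ≤ w i x) (hw1 : ∀ i, ∑ x, w i x = 1)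
    {g : Fin N → Ω → n → ℝ} (hg : ∀ i x, g i x ⬝ᵥ g i x ≤ 1)
    (hσ : ∀ i z, ∑ x, w i x * (g i x ⬝ᵥ z) ^ 2 ≤ σ * (z ⬝ᵥ z)) {A : Matrix n n ℝ} (hA : Aᵀ = A)
    (hA0 : ∀ z, 0 ≤ z ⬝ᵥ A *ᵥ z) :
    ∑ x : Fin N → Ω, (∏ i, w i (x i)) *
        expTrace (A + ∑ i, vecMulVec (g i (x i)) (g i (x i))) ≤
      (1 + σ * (Real.exp 1 - 1)) ^ N * expTrace A := by
  have hc : 0 ≤ 1 + σ * (Real.exp 1 - 1) := by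
    have := Real.add_one_le_exp (1 : ℝ)
    have := mul_nonneg hσ0 (by linarith : 0 ≤ Real.exp 1 - 1)
    linarith
  induction N generalizing A with
  | zero => simp
  | succ N ih =>
    rw [sum_fin_succ_pi]
    have h1 : ∀ a, ∑ y : Fin N → Ω, (∏ i, w i (Fin.cons (α := fun _ => Ω) a y i)) *
        expTrace (A + ∑ i, vecMulVec (g i (Fin.cons (α := fun _ => Ω) a y i))
          (g i (Fin.cons (α := fun _ => Ω) a y i))) ≤
        w 0 a * ((1 + σ * (Real.exp 1 - 1)) ^ N * expTrace (A + vecMulVec (g 0 a) (g 0 a))) := by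
      intro a
      simp only [Fin.prod_univ_succ, Fin.sum_univ_succ, Fin.cons_zero, Fin.cons_succ, mul_assoc,
        ← Finset.mul_sum, ← add_assoc]
      -- The first random summand is absorbed into the base matrix, which is why the induction runs
      -- over all positive semidefinite `A`.
      refine mul_le_mul_of_nonneg_left (ih (w := fun i => w i.succ) (g := fun i => g i.succ)
        (fun i => hw _) (fun i => hw1 _) (fun i => hg _) (fun i => hσ _) ?_ ?_) (hw 0 a)
      · rw [transpose_add, transpose_vecMulVec, hA]
      · intro z
        rw [add_mulVec, dotProduct_add, vecMulVec_mulVec]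
        have := hA0 z
        have h2 : 0 ≤ z ⬝ᵥ (MulOpposite.op (g 0 a ⬝ᵥ z) • g 0 a) := by
          simp only [op_smul_eq_smul, dotProduct_smul, smul_eq_mul]
          rw [dotProduct_comm z]; exact mul_self_nonneg _
        linarith
    refine (Finset.sum_le_sum fun a _ => h1 a).trans ?_
    have h2 := sum_expTrace_rank_one (hw 0) (hw1 0) (hg 0) (hσ 0) hA hA0
    calc _ = (1 + σ * (Real.exp 1 - 1)) ^ N *
          ∑ a, w 0 a * expTrace (A + vecMulVec (g 0 a) (g 0 a)) := by
          rw [Finset.mul_sum]; exact Finset.sum_congr rfl fun a _ => by ring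
      _ ≤ _ := mul_le_mul_of_nonneg_left h2 (pow_nonneg hc N)
      _ = _ := by ring

end RankOne
end KWise

/-! ### Noncommutative Khintchine inequality. -/

set_option linter.unusedSectionVars false
namespace KWise
open Matrix

/-- The sign attached to a Boolean. -/
def sgn (b : Bool) : ℝ := if b then 1 else -1

theorem sgn_mul_self (b : Bool) : sgn b * sgn b = 1 := by cases b <;> simp [sgn]

theorem sgn_not (b : Bool) : sgn (!b) = -sgn b := by cases b <;> simp [sgn]

/-- Flipping one sign. -/
def flipAt {ι : Type*} [DecidableEq ι] (j : ι) : Equiv.Perm (ι → Bool) where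
  toFun ε := Function.update ε j (!ε j)
  invFun ε := Function.update ε j (!ε j)
  left_inv ε := by simp
  right_inv ε := by simp

theorem flipAt_apply {ι : Type*} [DecidableEq ι] (j : ι) (ε : ι → Bool) :
    flipAt j ε = Function.update ε j (!ε j) := rfl

/-- The terms q and 2m - q are paired: the differences |a|^q - |b|^q and |a|^(2m-q) - |b|^(2m-q)
have the same sign, and expanding their product bounds the pair by a^(2m) + b^(2m). -/
theorem sum_pow_mul_pow_le (a b : ℝ) (m : ℕ) :
    ∑ q ∈ Finset.range (2 * m + 1), a ^ q * b ^ (2 * m - q) ≤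
      (2 * m + 1) / 2 * (a ^ (2 * m) + b ^ (2 * m)) := by
  have h1 : ∀ q ∈ Finset.range (2 * m + 1), a ^ q * b ^ (2 * m - q) + a ^ (2 * m - q) * b ^ q ≤
      a ^ (2 * m) + b ^ (2 * m) := by
    intro q hq
    have hq' : q + (2 * m - q) = 2 * m := by have := Finset.mem_range.1 hq; omega
    have ea : a ^ (2 * m) = |a| ^ (2 * m) := (Even.pow_abs (even_two_mul m) a).symm
    have eb : b ^ (2 * m) = |b| ^ (2 * m) := (Even.pow_abs (even_two_mul m) b).symm
    have hc : 0 ≤ (|a| ^ q - |b| ^ q) * (|a| ^ (2 * m - q) - |b| ^ (2 * m - q)) := by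
      rcases le_total |a| |b| with h | h
      · exact mul_nonneg_of_nonpos_of_nonpos
          (sub_nonpos.2 (pow_le_pow_left₀ (abs_nonneg _) h _))
          (sub_nonpos.2 (pow_le_pow_left₀ (abs_nonneg _) h _))
      · exact mul_nonneg (sub_nonneg.2 (pow_le_pow_left₀ (abs_nonneg _) h _))
          (sub_nonneg.2 (pow_le_pow_left₀ (abs_nonneg _) h _))
    have t1 : a ^ q * b ^ (2 * m - q) ≤ |a| ^ q * |b| ^ (2 * m - q) := by
      rw [← abs_pow, ← abs_pow, ← abs_mul]; exact le_abs_self _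
    have t2 : a ^ (2 * m - q) * b ^ q ≤ |a| ^ (2 * m - q) * |b| ^ q := by
      rw [← abs_pow, ← abs_pow, ← abs_mul]; exact le_abs_self _
    have e1 : |a| ^ q * |a| ^ (2 * m - q) = |a| ^ (2 * m) := by rw [← pow_add, hq']
    have e2 : |b| ^ q * |b| ^ (2 * m - q) = |b| ^ (2 * m) := by rw [← pow_add, hq']
    rw [ea, eb]
    nlinarith
  have h2 : ∑ q ∈ Finset.range (2 * m + 1), a ^ (2 * m - q) * b ^ q =
      ∑ q ∈ Finset.range (2 * m + 1), a ^ q * b ^ (2 * m - q) := by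
    rw [← Finset.sum_range_reflect]
    refine Finset.sum_congr rfl fun q hq => ?_
    have := Finset.mem_range.1 hq
    congr 2; omega
  have h3 := Finset.sum_le_sum h1
  rw [Finset.sum_add_distrib, h2, Finset.sum_const, Finset.card_range, nsmul_eq_mul] at h3
  push_cast at h3
  linarith

section Khintchine
variable {n : Type*} [Fintype n] [DecidableEq n]

theorem pow_sub_pow_eq_sum (W Y : Matrix n n ℝ) (r : ℕ) :
    W ^ r - Y ^ r = ∑ q ∈ Finset.range r, W ^ q * (W - Y) * Y ^ (r - 1 - q) := by
  induction r with
  | zero => simp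
  | succ r ih =>
    have e : ∑ q ∈ Finset.range r, W ^ q * (W - Y) * Y ^ (r + 1 - 1 - q) =
        (∑ q ∈ Finset.range r, W ^ q * (W - Y) * Y ^ (r - 1 - q)) * Y := by
      rw [Finset.sum_mul]
      refine Finset.sum_congr rfl fun q hq => ?_
      have := Finset.mem_range.1 hq
      rw [Matrix.mul_assoc _ (Y ^ _), ← pow_succ]
      congr 2; omega
    rw [Finset.sum_range_succ, e, ← ih]
    simp only [Nat.add_sub_cancel, Nat.sub_self, pow_zero, Matrix.mul_one, pow_succ]
    noncomm_ring

/-- Expanding in the two eigenbases reduces a mixed trace to scalars with nonnegative weights, so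
that scalar power inequalities apply to noncommuting matrices. -/
theorem trace_mul_pow_mul_pow {H U V : Matrix n n ℝ} (hH : Hᵀ = H) (hU : Uᵀ * U = 1)
    (hU' : U * Uᵀ = 1) (hV : Vᵀ * V = 1) (hV' : V * Vᵀ = 1) (a b : n → ℝ) (q s : ℕ) :
    (H * (U * diagonal a * Uᵀ) ^ q * H * (V * diagonal b * Vᵀ) ^ s).trace =
      ∑ i, ∑ j, (Uᵀ * H * V) i j ^ 2 * (a i ^ q * b j ^ s) := by
  have e : (H * (U * diagonal a * Uᵀ) ^ q * H * (V * diagonal b * Vᵀ) ^ s).trace =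
      ((Uᵀ * H * V)ᵀ * (diagonal (fun i => a i ^ q) * (Uᵀ * H * V) *
        diagonal (fun i => b i ^ s))).trace := by
    rw [conj_diagonal_pow hU hU', conj_diagonal_pow hV hV', ← Matrix.mul_assoc, ← Matrix.mul_assoc,
      Matrix.trace_mul_comm]
    congr 1
    simp only [transpose_mul, transpose_transpose, hH, Matrix.mul_assoc]
  rw [e, trace, Finset.sum_comm]
  refine Finset.sum_congr rfl fun j _ => ?_
  rw [diag_apply, mul_apply]
  refine Finset.sum_congr rfl fun i _ => ?_
  rw [transpose_apply, mul_diagonal, diagonal_mul]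
  ring

/-- A geometric mean-arithmetic mean inequality for traces. -/
theorem sum_trace_mul_pow_mul_pow_le {H W Y : Matrix n n ℝ} (hH : Hᵀ = H) (hW : Wᵀ = W)
    (hY : Yᵀ = Y) (m : ℕ) :
    ∑ q ∈ Finset.range (2 * m + 1), (H * W ^ q * H * Y ^ (2 * m - q)).trace ≤
      (2 * m + 1) / 2 * ((H * W ^ (2 * m) * H).trace + (H * Y ^ (2 * m) * H).trace) := by
  obtain ⟨U, a, hU, hU', rfl⟩ := exists_orthogonal_diagonalization hW
  obtain ⟨V, b, hV, hV', rfl⟩ := exists_orthogonal_diagonalization hY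
  have e1 := trace_mul_pow_mul_pow hH hU hU' hV hV' a b (2 * m) 0
  have e2 := trace_mul_pow_mul_pow hH hU hU' hV hV' a b 0 (2 * m)
  simp only [pow_zero, mul_one, one_mul] at e1 e2
  have e3 : (H * (V * diagonal b * Vᵀ) ^ (2 * m) * H).trace =
      (H * H * (V * diagonal b * Vᵀ) ^ (2 * m)).trace := by
    rw [Matrix.trace_mul_comm, ← Matrix.mul_assoc]
  rw [e3, e1, e2]
  simp only [trace_mul_pow_mul_pow hH hU hU' hV hV']
  rw [Finset.sum_comm, ← Finset.sum_add_distrib, Finset.mul_sum]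
  refine Finset.sum_le_sum fun i _ => ?_
  rw [Finset.sum_comm, ← Finset.sum_add_distrib, Finset.mul_sum]
  refine Finset.sum_le_sum fun j _ => ?_
  rw [← Finset.mul_sum]
  have := mul_le_mul_of_nonneg_left (sum_pow_mul_pow_le (a i) (b j) m)
    (sq_nonneg ((Uᵀ * H * V) i j))
  linarith

variable {ι : Type*} [Fintype ι] [DecidableEq ι]

theorem transpose_sum_sgn {H : ι → Matrix n n ℝ} (hH : ∀ j, (H j)ᵀ = H j) (ε : ι → Bool) :
    (∑ j, sgn (ε j) • H j)ᵀ = ∑ j, sgn (ε j) • H j := by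
  rw [transpose_sum]; simp [hH]

theorem sum_sgn_sub_flip (H : ι → Matrix n n ℝ) (ε : ι → Bool) (j : ι) :
    (∑ i, sgn (ε i) • H i) - ∑ i, sgn (flipAt j ε i) • H i = (2 * sgn (ε j)) • H j := by
  rw [← Finset.sum_sub_distrib, Finset.sum_eq_single j]
  · rw [flipAt_apply, Function.update_self, sgn_not, ← sub_smul]; congr 1; ring
  · intro i _ hij
    rw [flipAt_apply, Function.update_of_ne hij, sub_self]
  · simp

/-- A discrete integration by parts. Flipping the sign j turns the left side into half a difference
of powers of two matrices that differ by ±2 `H j`. The difference telescopes into mixed traces, the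
trace inequality above removes the mixing, and the flipped sum has the same average as the original
one. -/
theorem sum_sgn_trace_le {H : ι → Matrix n n ℝ} (hH : ∀ j, (H j)ᵀ = H j) (m : ℕ) (j : ι) :
    ∑ ε : ι → Bool, sgn (ε j) * (H j * (∑ i, sgn (ε i) • H i) ^ (2 * m + 1)).trace ≤
      (2 * m + 1) * ∑ ε : ι → Bool, (H j * (∑ i, sgn (ε i) • H i) ^ (2 * m) * H j).trace := by
  set X : (ι → Bool) → Matrix n n ℝ := fun ε => ∑ i, sgn (ε i) • H i with hX
  have hflip : ∑ ε : ι → Bool, sgn (ε j) * (H j * X ε ^ (2 * m + 1)).trace =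
      -∑ ε : ι → Bool, sgn (ε j) * (H j * X (flipAt j ε) ^ (2 * m + 1)).trace := by
    rw [← Equiv.sum_comp (flipAt j), ← Finset.sum_neg_distrib]
    refine Finset.sum_congr rfl fun ε _ => ?_
    rw [flipAt_apply, Function.update_self, sgn_not]; ring
  have h2 : 2 * ∑ ε : ι → Bool, sgn (ε j) * (H j * X ε ^ (2 * m + 1)).trace =
      ∑ ε : ι → Bool, 2 * ∑ q ∈ Finset.range (2 * m + 1),
        (H j * X ε ^ q * H j * X (flipAt j ε) ^ (2 * m - q)).trace := by
    rw [two_mul]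
    nth_rewrite 2 [hflip]
    rw [← sub_eq_add_neg, ← Finset.sum_sub_distrib]
    refine Finset.sum_congr rfl fun ε _ => ?_
    rw [← mul_sub, ← trace_sub, ← Matrix.mul_sub, pow_sub_pow_eq_sum, sum_sgn_sub_flip,
      Finset.mul_sum, trace_sum, Finset.mul_sum, Finset.mul_sum]
    refine Finset.sum_congr rfl fun q _ => ?_
    rw [Matrix.mul_smul, Matrix.smul_mul, Matrix.mul_smul, trace_smul, smul_eq_mul, ← mul_assoc,
      show sgn (ε j) * (2 * sgn (ε j)) = 2 by linarith [sgn_mul_self (ε j)],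
      Nat.add_sub_cancel]
    simp only [Matrix.mul_assoc]
  have h3 : ∑ ε : ι → Bool, (H j * X (flipAt j ε) ^ (2 * m) * H j).trace =
      ∑ ε : ι → Bool, (H j * X ε ^ (2 * m) * H j).trace :=
    Equiv.sum_comp (flipAt j) fun ε => (H j * X ε ^ (2 * m) * H j).trace
  have h4 : ∑ ε : ι → Bool, 2 * ∑ q ∈ Finset.range (2 * m + 1),
        (H j * X ε ^ q * H j * X (flipAt j ε) ^ (2 * m - q)).trace ≤
      ∑ ε : ι → Bool, (2 * m + 1) * ((H j * X ε ^ (2 * m) * H j).trace +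
        (H j * X (flipAt j ε) ^ (2 * m) * H j).trace) := by
    refine Finset.sum_le_sum fun ε _ => ?_
    have := sum_trace_mul_pow_mul_pow_le (hH j) (transpose_sum_sgn hH ε)
      (transpose_sum_sgn hH (flipAt j ε)) m
    linarith
  rw [← h2, ← Finset.mul_sum, Finset.sum_add_distrib, h3] at h4
  have h5 : ∑ ε : ι → Bool, sgn (ε j) * (H j * X ε ^ (2 * m + 1)).trace ≤
      (2 * m + 1) * ∑ ε : ι → Bool, (H j * X ε ^ (2 * m) * H j).trace := by linarith
  exact h5

theorem sum_trace_mul_pow_mul_le {H : ι → Matrix n n ℝ} (hH : ∀ j, (H j)ᵀ = H j) {V : ℝ}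
    (hV : ∀ z, ∑ j, (H j *ᵥ z) ⬝ᵥ (H j *ᵥ z) ≤ V * (z ⬝ᵥ z)) {X : Matrix n n ℝ} (hX : Xᵀ = X)
    (m : ℕ) : ∑ j, (H j * X ^ (2 * m) * H j).trace ≤ V * (X ^ (2 * m)).trace := by
  have hXm : (X ^ m)ᵀ = X ^ m := by rw [transpose_pow, hX]
  have key : ∀ B : Matrix n n ℝ, (Bᵀ * B).trace = ∑ c, B.col c ⬝ᵥ B.col c := fun B => rfl
  have h1 : ∀ j, (H j * X ^ (2 * m) * H j).trace =
      ∑ c, (H j *ᵥ (X ^ m).col c) ⬝ᵥ (H j *ᵥ (X ^ m).col c) := by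
    intro j
    have : (H j * X ^ (2 * m) * H j).trace = ((H j * X ^ m)ᵀ * (H j * X ^ m)).trace := by
      rw [transpose_mul, hH, hXm, two_mul, pow_add, Matrix.trace_mul_comm, Matrix.mul_assoc,
        ← Matrix.mul_assoc, ← Matrix.mul_assoc, Matrix.trace_mul_comm]
      simp only [Matrix.mul_assoc]
    rw [this, key]
    rfl
  have h2 : (X ^ (2 * m)).trace = ∑ c, (X ^ m).col c ⬝ᵥ (X ^ m).col c := by
    rw [← key, hXm, ← pow_add, two_mul]
  simp only [h1]
  rw [Finset.sum_comm, h2, Finset.mul_sum]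
  exact Finset.sum_le_sum fun c _ => hV _

/-- Noncommutative Khintchine inequality for the even moments of a Rademacher sum. -/
theorem sum_trace_pow_le {H : ι → Matrix n n ℝ} (hH : ∀ j, (H j)ᵀ = H j) {V : ℝ} (hV0 : 0 ≤ V)
    (hV : ∀ z, ∑ j, (H j *ᵥ z) ⬝ᵥ (H j *ᵥ z) ≤ V * (z ⬝ᵥ z)) (m : ℕ) :
    ∑ ε : ι → Bool, ((∑ i, sgn (ε i) • H i) ^ (2 * m)).trace / ((2 * m).factorial : ℝ) ≤
      (V / 2) ^ m / m.factorial * (Fintype.card n * 2 ^ Fintype.card ι) := by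
  induction m with
  | zero => simp [mul_comm]
  | succ m ih =>
    set X : (ι → Bool) → Matrix n n ℝ := fun ε => ∑ i, sgn (ε i) • H i with hX
    -- One factor of X is expanded as a signed sum and integrated by parts. The gain (2m+1)V against
    -- the factorial ratio (2m+2)(2m+1) leaves V/(2(m+1)), which builds the series of exp(V/2).
    have h1 : ∑ ε : ι → Bool, (X ε ^ (2 * (m + 1))).trace ≤
        (2 * m + 1) * (V * ∑ ε : ι → Bool, (X ε ^ (2 * m)).trace) := by
      have e : ∀ ε, (X ε ^ (2 * (m + 1))).trace =
          ∑ j, sgn (ε j) * (H j * X ε ^ (2 * m + 1)).trace := by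
        intro ε
        rw [show 2 * (m + 1) = (2 * m + 1) + 1 by ring, pow_succ' _ (2 * m + 1)]
        conv_lhs => enter [1, 1]; rw [hX]
        rw [Finset.sum_mul, trace_sum]
        simp [trace_smul]
      simp only [e]
      rw [Finset.sum_comm]
      refine (Finset.sum_le_sum fun j _ => sum_sgn_trace_le hH m j).trans ?_
      rw [← Finset.mul_sum, Finset.sum_comm, Finset.mul_sum _ _ V]
      refine mul_le_mul_of_nonneg_left (Finset.sum_le_sum fun ε _ => ?_) (by positivity)
      exact sum_trace_mul_pow_mul_le hH hV (transpose_sum_sgn hH ε) m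
    rw [← Finset.sum_div] at ih ⊢
    have hf : ((2 * (m + 1)).factorial : ℝ) =
        (2 * (m + 1)) * ((2 * m + 1) * (2 * m).factorial) := by
      rw [show 2 * (m + 1) = (2 * m + 1) + 1 by ring, Nat.factorial_succ, Nat.factorial_succ]
      push_cast; ring
    have hp : (0 : ℝ) < (2 * m).factorial := by positivity
    have hp' : (0 : ℝ) < m.factorial := by positivity
    calc (∑ ε : ι → Bool, (X ε ^ (2 * (m + 1))).trace) / ((2 * (m + 1)).factorial : ℝ)
        ≤ ((2 * m + 1) * (V * ∑ ε : ι → Bool, (X ε ^ (2 * m)).trace)) /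
            ((2 * (m + 1)).factorial : ℝ) := div_le_div_of_nonneg_right h1 (by positivity)
      _ = V / (2 * (m + 1)) * ((∑ ε : ι → Bool, (X ε ^ (2 * m)).trace) / (2 * m).factorial) := by
          rw [hf]; field_simp
      _ ≤ V / (2 * (m + 1)) *
            ((V / 2) ^ m / m.factorial * (Fintype.card n * 2 ^ Fintype.card ι)) :=
          mul_le_mul_of_nonneg_left ih (by positivity)
      _ = _ := by rw [Nat.factorial_succ, pow_succ]; push_cast; field_simp

/-- Laplace transform bound for a matrix Rademacher sum. -/
theorem sum_coshTrace_le {H : ι → Matrix n n ℝ} (hH : ∀ j, (H j)ᵀ = H j) {V : ℝ} (hV0 : 0 ≤ V)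
    (hV : ∀ z, ∑ j, (H j *ᵥ z) ⬝ᵥ (H j *ᵥ z) ≤ V * (z ⬝ᵥ z)) :
    ∑ ε : ι → Bool, coshTrace (∑ i, sgn (ε i) • H i) ≤
      Real.exp (V / 2) * (Fintype.card n * 2 ^ Fintype.card ι) :=
  hasSum_le (sum_trace_pow_le hH hV0 hV)
    (hasSum_sum fun ε _ => hasSum_coshTrace (transpose_sum_sgn hH ε))
    ((hasSum_exp (V / 2)).mul_right _)

end Khintchine
end KWise

namespace KWise

/-! ### Expectations under product distributions. -/

section Product
variable {S Z : Type*} [Fintype S] [DecidableEq S] [Fintype Z]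

/-- The weight of an outcome under a product distribution. -/
def prodWeight (v : S → Z → ℝ) (x : S → Z) : ℝ := ∏ s, v s (x s)

theorem prodWeight_nonneg {v : S → Z → ℝ} (hv : ∀ s z, 0 ≤ v s z) (x : S → Z) :
    0 ≤ prodWeight v x := Finset.prod_nonneg fun s _ => hv s _

theorem sum_prodWeight_mul_prod (v h : S → Z → ℝ) :
    ∑ x, prodWeight v x * ∏ s, h s (x s) = ∏ s, ∑ z, v s z * h s z := by
  rw [Finset.prod_univ_sum, Fintype.piFinset_univ]
  exact Finset.sum_congr rfl fun x _ => by rw [prodWeight, Finset.prod_mul_distrib]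

theorem sum_prodWeight {v : S → Z → ℝ} (hv1 : ∀ s, ∑ z, v s z = 1) :
    ∑ x, prodWeight v x = 1 := by
  have := sum_prodWeight_mul_prod v fun _ _ => 1
  simpa [hv1] using this

theorem sum_prodWeight_single [DecidableEq Z] {v : S → Z → ℝ} (hv1 : ∀ s, ∑ z, v s z = 1) (a : S)
    (F : Z → ℝ) : ∑ x, prodWeight v x * F (x a) = ∑ z, v a z * F z := by
  have h := sum_prodWeight_mul_prod v fun s z => if s = a then F z else 1
  have e1 : ∀ x : S → Z, ∏ s, (if s = a then F (x s) else 1) = F (x a) := fun x => by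
    rw [Finset.prod_ite_eq' Finset.univ a fun s => F (x s)]; simp
  have e2 : ∀ s, ∑ z, v s z * (if s = a then F z else 1) =
      if s = a then ∑ z, v s z * F z else 1 := by
    intro s; split_ifs <;> simp [hv1]
  simp only [e1, e2] at h
  rw [h, Finset.prod_ite_eq' Finset.univ a fun s => ∑ z, v s z * F z]; simp

theorem sum_prodWeight_pair [DecidableEq Z] {v : S → Z → ℝ} (hv1 : ∀ s, ∑ z, v s z = 1) {a b : S}
    (hab : a ≠ b) (F : Z → Z → ℝ) :
    ∑ x, prodWeight v x * F (x a) (x b) = ∑ z, ∑ z', v a z * v b z' * F z z' := by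
  have h1 : ∀ f g : Z → ℝ, ∑ x, prodWeight v x * (f (x a) * g (x b)) =
      (∑ z, v a z * f z) * ∑ z, v b z * g z := by
    intro f g
    have h := sum_prodWeight_mul_prod v fun s z =>
      (if s = a then f z else 1) * (if s = b then g z else 1)
    have e1 : ∀ x : S → Z, ∏ s, ((if s = a then f (x s) else 1) * (if s = b then g (x s) else 1)) =
        f (x a) * g (x b) := fun x => by
      rw [Finset.prod_mul_distrib, Finset.prod_ite_eq' Finset.univ a fun s => f (x s),
        Finset.prod_ite_eq' Finset.univ b fun s => g (x s)]
      simp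
    have e2 : ∀ s, ∑ z, v s z * ((if s = a then f z else 1) * (if s = b then g z else 1)) =
        (if s = a then ∑ z, v s z * f z else 1) * (if s = b then ∑ z, v s z * g z else 1) := by
      intro s
      by_cases ha : s = a
      · simp [ha, hab]
      · by_cases hb : s = b
        · subst hb; simp [ha]
        · simp [ha, hb, hv1]
    simp only [e1, e2] at h
    rw [h, Finset.prod_mul_distrib, Finset.prod_ite_eq' Finset.univ a fun s => ∑ z, v s z * f z,
        Finset.prod_ite_eq' Finset.univ b fun s => ∑ z, v s z * g z]
    simp
  -- A function of two coordinates is a combination of products of indicators, so the factorized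
  -- case suffices.
  have h2 : ∀ x : S → Z, F (x a) (x b) = ∑ z, ∑ z', F z z' *
      ((if x a = z then 1 else 0) * (if x b = z' then 1 else 0)) := by
    intro x
    simp
  simp only [h2, Finset.mul_sum]
  rw [Finset.sum_comm]
  refine Finset.sum_congr rfl fun z _ => ?_
  rw [Finset.sum_comm]
  refine Finset.sum_congr rfl fun z' _ => ?_
  have := h1 (fun y => if y = z then 1 else 0) (fun y => if y = z' then 1 else 0)
  simp only [mul_ite, mul_one, mul_zero, Finset.sum_ite_eq', Finset.mem_univ, if_true] at this
  calc _ = F z z' * ∑ x, prodWeight v x *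
        ((if x a = z then 1 else 0) * (if x b = z' then 1 else 0)) := by
        rw [Finset.mul_sum]; exact Finset.sum_congr rfl fun x _ => by ring
    _ = F z z' * (v a z * v b z') := by
        congr 1; rw [← this]; refine Finset.sum_congr rfl fun x _ => ?_
        split_ifs <;> simp
    _ = _ := by ring

end Product

/-! ### Contraction principle for Rademacher suprema. -/

section Contraction
variable {T : Type*} [Finite T] [Nonempty T]

theorem le_iSup_finite (f : T → ℝ) (t : T) : f t ≤ ⨆ t, f t :=
  le_ciSup (Set.finite_range f).bddAbove t

/-- One step of the contraction principle for Laplace transforms. -/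
theorem exp_iSup_contraction {u a b : T → ℝ} (hb : ∀ t, 0 ≤ b t) (hba : ∀ t, b t ≤ |a t|)
    (hL : ∀ t s, |b t - b s| ≤ |a t - a s|) :
    Real.exp (⨆ t, (u t + b t)) + Real.exp (⨆ t, (u t - b t)) ≤
      Real.exp (⨆ t, (u t + a t)) + Real.exp (⨆ t, (u t - a t)) := by
  obtain ⟨t, ht⟩ := exists_eq_ciSup_of_finite (f := fun t => u t + b t)
  obtain ⟨s, hs⟩ := exists_eq_ciSup_of_finite (f := fun t => u t - b t)
  rw [← ht, ← hs]
  have hts : u s + b s ≤ u t + b t := ht ▸ le_iSup_finite (fun t => u t + b t) s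
  have hst : u t - b t ≤ u s - b s := hs ▸ le_iSup_finite (fun t => u t - b t) t
  have hp : ∀ r, Real.exp (u r + a r) ≤ Real.exp (⨆ t, (u t + a t)) := fun r =>
    Real.exp_le_exp.2 (le_iSup_finite (fun t => u t + a t) r)
  have hm : ∀ r, Real.exp (u r - a r) ≤ Real.exp (⨆ t, (u t - a t)) := fun r =>
    Real.exp_le_exp.2 (le_iSup_finite (fun t => u t - a t) r)
  -- Used with `c = a` or `c = -a`, whichever is nonnegative at the maximizer `t`; changing the sign
  -- of `a` only exchanges the two terms on the right. The alternative records which of `t`, `s`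
  -- goes with which sign.
  have core : ∀ c : T → ℝ, (∀ t, b t ≤ |c t|) → (∀ t s, |b t - b s| ≤ |c t - c s|) → 0 ≤ c t →
      Real.exp (u t + b t) + Real.exp (u s - b s) ≤ Real.exp (u t + c t) + Real.exp (u s - c s) ∨
      Real.exp (u t + b t) + Real.exp (u s - b s) ≤
        Real.exp (u s + c s) + Real.exp (u t - c t) := by
    intro c hc hcL hct
    have hct' := hc t
    have hcs' := hc s
    rw [abs_of_nonneg hct] at hct'
    rcases le_total 0 (c s) with hcs | hcs
    · rw [abs_of_nonneg hcs] at hcs'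
      have hLts := hcL t s
      rcases le_total (c s) (c t) with h | h
      · left
        rw [abs_of_nonneg (sub_nonneg.2 h)] at hLts
        -- Here the upper term gains more than the lower one loses: its increment is larger, and
        -- maximality of `t` with `b ≥ 0` makes its base value larger too.
        have hx : c s - b s ≤ c t - b t := by linarith [(abs_le.1 hLts).2]
        have h1 : Real.exp (u s - b s) * (1 - Real.exp (-(c s - b s))) ≤
            Real.exp (u t + b t) * (Real.exp (c t - b t) - 1) := by
          have i1 := Real.add_one_le_exp (-(c s - b s))
          have i2 := Real.add_one_le_exp (c t - b t)
          have i3 : Real.exp (u s - b s) ≤ Real.exp (u t + b t) :=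
            Real.exp_le_exp.2 (by linarith [hb s])
          calc Real.exp (u s - b s) * (1 - Real.exp (-(c s - b s)))
              ≤ Real.exp (u s - b s) * (c t - b t) :=
                mul_le_mul_of_nonneg_left (by linarith) (Real.exp_pos _).le
            _ ≤ Real.exp (u t + b t) * (c t - b t) :=
                mul_le_mul_of_nonneg_right i3 (by linarith)
            _ ≤ _ := mul_le_mul_of_nonneg_left (by linarith) (Real.exp_pos _).le
        have e1 : Real.exp (u s - c s) = Real.exp (u s - b s) * Real.exp (-(c s - b s)) := by
          rw [← Real.exp_add]; congr 1; ring
        have e2 : Real.exp (u t + c t) = Real.exp (u t + b t) * Real.exp (c t - b t) := by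
          rw [← Real.exp_add]; congr 1; ring
        rw [e1, e2]; linarith
      · right
        rw [abs_of_nonpos (sub_nonpos.2 h)] at hLts
        -- Now the points exchange roles, and maximality of `s` for `u - b` compares the base
        -- values.
        have hx : c t + b t ≤ c s + b s := by linarith [(abs_le.1 hLts).2]
        have h1 : Real.exp (u t - c t) * (Real.exp (c t + b t) - 1) ≤
            Real.exp (u s - b s) * (Real.exp (c s + b s) - 1) := by
          have i2 := Real.add_one_le_exp (c t + b t)
          have i3 : Real.exp (u t - c t) ≤ Real.exp (u s - b s) :=
            Real.exp_le_exp.2 (by linarith)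
          have i4 := Real.exp_le_exp.2 hx
          exact mul_le_mul i3 (by linarith) (by linarith [hb t]) (Real.exp_pos _).le
        have e1 : Real.exp (u t + b t) = Real.exp (u t - c t) * Real.exp (c t + b t) := by
          rw [← Real.exp_add]; congr 1; ring
        have e2 : Real.exp (u s + c s) = Real.exp (u s - b s) * Real.exp (c s + b s) := by
          rw [← Real.exp_add]; congr 1; ring
        rw [e1, e2]; linarith
    · left
      rw [abs_of_nonpos hcs] at hcs'
      have i1 : Real.exp (u t + b t) ≤ Real.exp (u t + c t) := Real.exp_le_exp.2 (by linarith)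
      have i2 : Real.exp (u s - b s) ≤ Real.exp (u s - c s) :=
        Real.exp_le_exp.2 (by linarith [hb s])
      linarith
  rcases le_total 0 (a t) with h | h
  · rcases core a hba hL h with h' | h'
    · exact h'.trans (add_le_add (hp t) (hm s))
    · exact h'.trans (add_le_add (hp s) (hm t))
  · rcases core (fun t => -a t) (fun t => by rw [abs_neg]; exact hba t)
      (fun t s => by rw [← neg_sub', abs_neg]; exact hL t s) (by simpa using h) with h' | h'
    · simp only [sub_neg_eq_add, ← sub_eq_add_neg] at h'
      linarith [hp s, hm t]
    · simp only [sub_neg_eq_add, ← sub_eq_add_neg] at h'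
      linarith [hp t, hm s]

/-- The terms are replaced one sign at a time. The free function `u` stores the terms that are not
being treated. -/
theorem sum_exp_iSup_contraction_fin {N : ℕ} {a b : Fin N → T → ℝ} (hb : ∀ i t, 0 ≤ b i t)
    (hba : ∀ i t, b i t ≤ |a i t|) (hL : ∀ i t s, |b i t - b i s| ≤ |a i t - a i s|) (u : T → ℝ) :
    ∑ ε : Fin N → Bool, Real.exp (⨆ t, (u t + ∑ i, sgn (ε i) * b i t)) ≤
      ∑ ε : Fin N → Bool, Real.exp (⨆ t, (u t + ∑ i, sgn (ε i) * a i t)) := by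
  induction N generalizing u with
  | zero => simp
  | succ N ih =>
    rw [sum_fin_succ_pi, sum_fin_succ_pi]
    simp only [Fin.sum_univ_succ, Fin.cons_zero, Fin.cons_succ, ← add_assoc]
    have h1 := fun e : Bool => ih (a := fun i => a i.succ) (b := fun i => b i.succ)
      (fun i => hb _) (fun i => hba _) (fun i => hL _) (fun t => u t + sgn e * b 0 t)
    refine (Finset.sum_le_sum fun e _ => h1 e).trans ?_
    rw [Finset.sum_comm, Finset.sum_comm (γ := Bool)]
    refine Finset.sum_le_sum fun ε _ => ?_
    have h2 := exp_iSup_contraction (u := fun t => u t + ∑ i, sgn (ε i) * a i.succ t)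
      (hb 0) (hba 0) (hL 0)
    have e1 : ∀ (c : T → ℝ) (e : Bool),
        (⨆ t, (u t + sgn e * c t + ∑ i, sgn (ε i) * a i.succ t)) =
          ⨆ t, ((u t + ∑ i, sgn (ε i) * a i.succ t) + sgn e * c t) :=
      fun c e => iSup_congr fun t => by ring
    rw [Fintype.sum_bool, Fintype.sum_bool, e1, e1, e1, e1]
    simpa [sgn, ← sub_eq_add_neg] using h2

/-- Contraction principle for the Laplace transform of the supremum of a Rademacher process. -/
theorem sum_exp_iSup_contraction {ι : Type*} [Fintype ι] [DecidableEq ι] {a b : ι → T → ℝ}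
    (hb : ∀ i t, 0 ≤ b i t) (hba : ∀ i t, b i t ≤ |a i t|)
    (hL : ∀ i t s, |b i t - b i s| ≤ |a i t - a i s|) :
    ∑ ε : ι → Bool, Real.exp (⨆ t, ∑ i, sgn (ε i) * b i t) ≤
      ∑ ε : ι → Bool, Real.exp (⨆ t, ∑ i, sgn (ε i) * a i t) := by
  have key : ∀ c : ι → T → ℝ, ∑ ε : ι → Bool, Real.exp (⨆ t, ∑ i, sgn (ε i) * c i t) =
      ∑ ε : Fin (Fintype.card ι) → Bool,
        Real.exp (⨆ t, (0 + ∑ i, sgn (ε i) * c ((Fintype.equivFin ι).symm i) t)) := by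
    intro c
    rw [← Equiv.sum_comp (Equiv.arrowCongr (Fintype.equivFin ι) (Equiv.refl Bool))]
    refine Finset.sum_congr rfl fun ε _ => ?_
    congr 1
    refine iSup_congr fun t => ?_
    rw [zero_add, ← Equiv.sum_comp (Fintype.equivFin ι).symm]
    rfl
  rw [key, key]
  exact sum_exp_iSup_contraction_fin (fun i => hb _) (fun i => hba _) (fun i => hL _) 0

end Contraction

/-! ### Symmetrization with independent blocks. -/

section Symmetrization
variable {S Z P T : Type*} [Fintype S] [DecidableEq S] [Fintype Z] [Fintype P] [DecidableEq P]
  [Finite T] [Nonempty T]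

/-- Exchange two samples on the blocks where the sign is negative. -/
def blockSwap (blk : S → P) (ε : P → Bool) : Equiv.Perm ((S → Z) × (S → Z)) where
  toFun q := (fun s => if ε (blk s) then q.1 s else q.2 s,
    fun s => if ε (blk s) then q.2 s else q.1 s)
  invFun q := (fun s => if ε (blk s) then q.1 s else q.2 s,
    fun s => if ε (blk s) then q.2 s else q.1 s)
  left_inv q := by
    ext s <;> by_cases h : ε (blk s) <;> simp [h]
  right_inv q := by
    ext s <;> by_cases h : ε (blk s) <;> simp [h]

/-- Symmetrization for the Laplace transform of the supremum of an empirical process with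
independent blocks. -/
theorem sum_exp_iSup_symmetrization {v : S → Z → ℝ} (hv : ∀ s z, 0 ≤ v s z)
    (hv1 : ∀ s, ∑ z, v s z = 1) (blk : S → P) (y : P → (S → Z) → T → ℝ)
    (hloc : ∀ p x x', (∀ s, blk s = p → x s = x' s) → y p x = y p x') :
    2 ^ Fintype.card P * ∑ x, prodWeight v x *
        Real.exp (⨆ t, ∑ p, ((∑ x', prodWeight v x' * y p x' t) - y p x t)) ≤
      ∑ x, prodWeight v x * ∑ ε : P → Bool, Real.exp (⨆ t, ∑ p, sgn (ε p) * (2 * y p x t)) := by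
  have hμ := prodWeight_nonneg hv
  have hμ1 := sum_prodWeight hv1
  -- Jensen's inequality replaces the mean by an independent copy of the sample.
  have step1 : ∀ x, Real.exp (⨆ t, ∑ p, ((∑ x', prodWeight v x' * y p x' t) - y p x t)) ≤
      ∑ x', prodWeight v x' * Real.exp (⨆ t, ∑ p, (y p x' t - y p x t)) := by
    intro x
    have hJ := convexOn_exp.map_sum_le (t := Finset.univ) (w := prodWeight v)
      (p := fun x' => ⨆ t, ∑ p, (y p x' t - y p x t)) (fun x' _ => hμ x') hμ1
      (fun _ _ => Set.mem_univ _)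
    simp only [smul_eq_mul] at hJ
    refine le_trans (Real.exp_le_exp.2 (ciSup_le fun t => ?_)) hJ
    have : ∑ p, ((∑ x', prodWeight v x' * y p x' t) - y p x t) =
        ∑ x', prodWeight v x' * ∑ p, (y p x' t - y p x t) := by
      simp only [Finset.mul_sum, mul_sub, Finset.sum_sub_distrib]
      rw [Finset.sum_comm]
      congr 1
      simp only [← Finset.mul_sum]
      rw [← Finset.sum_mul, hμ1, one_mul]
    rw [this]
    exact Finset.sum_le_sum fun x' _ => mul_le_mul_of_nonneg_left
      (le_iSup_finite (fun t => ∑ p, (y p x' t - y p x t)) t) (hμ x')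
  -- Exchanging the two samples on a set of blocks preserves their joint law and, since `y p` sees
  -- only block p, flips exactly the chosen signs.
  have step2 : ∀ ε : P → Bool, ∑ x, prodWeight v x * ∑ x', prodWeight v x' *
      Real.exp (⨆ t, ∑ p, (y p x' t - y p x t)) =
      ∑ x, prodWeight v x * ∑ x', prodWeight v x' *
        Real.exp (⨆ t, ∑ p, sgn (ε p) * (y p x' t - y p x t)) := by
    intro ε
    simp only [Finset.mul_sum]
    rw [← Fintype.sum_prod_type', ← Fintype.sum_prod_type', ← Equiv.sum_comp (blockSwap blk ε)]
    refine Finset.sum_congr rfl fun q _ => ?_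
    have hw : prodWeight v (blockSwap blk ε q).1 * prodWeight v (blockSwap blk ε q).2 =
        prodWeight v q.1 * prodWeight v q.2 := by
      rw [prodWeight, prodWeight, prodWeight, prodWeight, ← Finset.prod_mul_distrib,
        ← Finset.prod_mul_distrib]
      refine Finset.prod_congr rfl fun s _ => ?_
      by_cases h : ε (blk s) <;> simp [blockSwap, h, mul_comm]
    have hy : ∀ p t, y p (blockSwap blk ε q).2 t - y p (blockSwap blk ε q).1 t =
        sgn (ε p) * (y p q.2 t - y p q.1 t) := by
      intro p t
      by_cases h : ε p
      · rw [hloc p (blockSwap blk ε q).2 q.2 fun s hs => by simp [blockSwap, hs, h],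
          hloc p (blockSwap blk ε q).1 q.1 fun s hs => by simp [blockSwap, hs, h]]
        simp [sgn, h]
      · rw [hloc p (blockSwap blk ε q).2 q.1 fun s hs => by simp [blockSwap, hs, h],
          hloc p (blockSwap blk ε q).1 q.2 fun s hs => by simp [blockSwap, hs, h]]
        simp [sgn, h]
    simp only [hy]
    rw [← mul_assoc, ← mul_assoc, hw]
  set Q : (S → Z) → (P → Bool) → ℝ := fun x ε => ⨆ t, ∑ p, sgn (ε p) * (2 * y p x t) with hQ
  -- The two samples are separated by convexity of exp at a midpoint; this is where the factor 2 in
  -- front of `y` arises.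
  have step3 : ∀ ε x x', Real.exp (⨆ t, ∑ p, sgn (ε p) * (y p x' t - y p x t)) ≤
      (Real.exp (Q x' ε) + Real.exp (Q x fun p => !ε p)) / 2 := by
    intro ε x x'
    have h1 : (⨆ t, ∑ p, sgn (ε p) * (y p x' t - y p x t)) ≤
        (Q x' ε + Q x fun p => !ε p) / 2 := by
      refine ciSup_le fun t => ?_
      have e : ∑ p, sgn (ε p) * (y p x' t - y p x t) =
          (∑ p, sgn (ε p) * (2 * y p x' t) + ∑ p, sgn (!ε p) * (2 * y p x t)) / 2 := by
        rw [← Finset.sum_add_distrib, Finset.sum_div]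
        refine Finset.sum_congr rfl fun p _ => ?_
        rw [sgn_not]; ring
      rw [e]
      have h2 := le_iSup_finite (fun t => ∑ p, sgn (ε p) * (2 * y p x' t)) t
      have h3 := le_iSup_finite (fun t => ∑ p, sgn (!ε p) * (2 * y p x t)) t
      simp only [hQ]
      linarith
    refine (Real.exp_le_exp.2 h1).trans ?_
    have h2 : Real.exp ((Q x' ε + Q x fun p => !ε p) / 2) ^ 2 =
        Real.exp (Q x' ε) * Real.exp (Q x fun p => !ε p) := by
      rw [sq, ← Real.exp_add, ← Real.exp_add]; congr 1; ring
    have h3 := Real.exp_pos (Q x' ε)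
    have h4 := Real.exp_pos (Q x fun p => !ε p)
    refine abs_le_of_sq_le_sq' ?_ (by positivity) |>.2
    rw [h2]
    nlinarith [sq_nonneg (Real.exp (Q x' ε) - Real.exp (Q x fun p => !ε p))]
  have step4 : ∀ ε : P → Bool, ∑ x, prodWeight v x * ∑ x', prodWeight v x' *
        Real.exp (⨆ t, ∑ p, sgn (ε p) * (y p x' t - y p x t)) ≤
      (∑ x, prodWeight v x * Real.exp (Q x ε) +
        ∑ x, prodWeight v x * Real.exp (Q x fun p => !ε p)) / 2 := by
    intro ε
    calc _ ≤ ∑ x, prodWeight v x * ∑ x', prodWeight v x' *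
        ((Real.exp (Q x' ε) + Real.exp (Q x fun p => !ε p)) / 2) :=
          Finset.sum_le_sum fun x _ => mul_le_mul_of_nonneg_left (Finset.sum_le_sum fun x' _ =>
            mul_le_mul_of_nonneg_left (step3 ε x x') (hμ x')) (hμ x)
      _ = ∑ x, prodWeight v x * ((∑ x', prodWeight v x' * Real.exp (Q x' ε) +
            Real.exp (Q x fun p => !ε p)) / 2) := by
          refine Finset.sum_congr rfl fun x _ => ?_
          congr 1
          simp only [mul_div_assoc', mul_add]
          rw [← Finset.sum_div, Finset.sum_add_distrib, ← Finset.sum_mul, hμ1, one_mul]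
      _ = _ := by
          simp only [mul_div_assoc', mul_add]
          rw [← Finset.sum_div, Finset.sum_add_distrib, ← Finset.sum_mul, hμ1, one_mul]
  have hneg : ∑ ε : P → Bool, ∑ x, prodWeight v x * Real.exp (Q x fun p => !ε p) =
      ∑ ε : P → Bool, ∑ x, prodWeight v x * Real.exp (Q x ε) := by
    exact Equiv.sum_comp (Equiv.arrowCongr (Equiv.refl P) Equiv.boolNot)
      fun ε => ∑ x, prodWeight v x * Real.exp (Q x ε)
  calc _ ≤ 2 ^ Fintype.card P * ∑ x, prodWeight v x * ∑ x', prodWeight v x' *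
      Real.exp (⨆ t, ∑ p, (y p x' t - y p x t)) :=
        mul_le_mul_of_nonneg_left (Finset.sum_le_sum fun x _ =>
          mul_le_mul_of_nonneg_left (step1 x) (hμ x)) (by positivity)
    _ = ∑ ε : P → Bool, ∑ x, prodWeight v x * ∑ x', prodWeight v x' *
        Real.exp (⨆ t, ∑ p, sgn (ε p) * (y p x' t - y p x t)) := by
        simp only [← step2]
        simp
    _ ≤ ∑ ε : P → Bool, (∑ x, prodWeight v x * Real.exp (Q x ε) +
        ∑ x, prodWeight v x * Real.exp (Q x fun p => !ε p)) / 2 :=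
        Finset.sum_le_sum fun ε _ => step4 ε
    _ = ∑ ε : P → Bool, ∑ x, prodWeight v x * Real.exp (Q x ε) := by
        rw [← Finset.sum_div, Finset.sum_add_distrib, hneg]; ring
    _ = _ := by
        rw [Finset.sum_comm]
        exact Finset.sum_congr rfl fun x _ => by rw [Finset.mul_sum]

end Symmetrization
end KWise

namespace KWise

/-! ### Moments of the MNL score of one user. -/

section Residual

/-- Hoeffding's lemma for a finite distribution. -/
theorem sum_exp_le_of_range {ι : Type*} [Fintype ι] {π : ι → ℝ} (hπ : ∀ i, 0 ≤ π i)
    (hπ1 : ∑ i, π i = 1) (y : ι → ℝ) {a b : ℝ} (hy : ∀ i, y i ∈ Set.Icc a b) (t : ℝ) :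
    ∑ i, π i * Real.exp (t * (y i - ∑ j, π j * y j)) ≤ Real.exp (t ^ 2 * (b - a) ^ 2 / 8) := by
  let _ : MeasurableSpace ι := ⊤
  have hsum : ∑ i, ENNReal.ofReal (π i) = 1 := by
    rw [← ENNReal.ofReal_sum_of_nonneg fun i _ => hπ i, hπ1, ENNReal.ofReal_one]
  set μ : Measure ι := (PMF.ofFintype (fun i => ENNReal.ofReal (π i)) hsum).toMeasure with hμ
  have hint : ∀ f : ι → ℝ, ∫ i, f i ∂μ = ∑ i, π i * f i := by
    intro f
    rw [hμ, PMF.integral_eq_sum]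
    refine Finset.sum_congr rfl fun i _ => ?_
    rw [PMF.ofFintype_apply, ENNReal.toReal_ofReal (hπ i), smul_eq_mul]
  have h := ProbabilityTheory.hasSubgaussianMGF_of_mem_Icc (μ := μ) (X := y) (a := a) (b := b)
    (measurable_of_finite _).aemeasurable (Filter.Eventually.of_forall hy)
  have h2 := h.mgf_le t
  rw [ProbabilityTheory.mgf, hint, hint] at h2
  refine h2.trans (le_of_eq ?_)
  congr 1
  simp only [NNReal.coe_pow, NNReal.coe_div, coe_nnnorm, Real.norm_eq_abs, NNReal.coe_ofNat,
    div_pow, sq_abs]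
  ring

variable {E : Type*} [AddCommGroup E] [Module ℝ E]

/-- The sum over the stages of a ranking of the deviation of the chosen value from its conditional
mean under the MNL model. -/
noncomputable def mnlResidual {k : ℕ} (u : Fin k → ℝ) (z : Fin k → E)
    (σ : Equiv.Perm (Fin k)) : E :=
  ∑ ℓ, (z (σ ℓ) - ∑ m ∈ Finset.Ici ℓ,
    (Real.exp (u (σ m)) / ∑ m' ∈ Finset.Ici ℓ, Real.exp (u (σ m'))) • z (σ m))

/-- The choice probabilities at the first stage. -/
noncomputable def softmax {k : ℕ} (u : Fin k → ℝ) (p : Fin k) : ℝ :=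
  Real.exp (u p) / ∑ m, Real.exp (u m)

theorem softmax_nonneg {k : ℕ} (u : Fin k → ℝ) (p : Fin k) : 0 ≤ softmax u p :=
  div_nonneg (Real.exp_pos _).le (Finset.sum_nonneg fun _ _ => (Real.exp_pos _).le)

theorem sum_softmax {k : ℕ} (u : Fin (k + 1) → ℝ) : ∑ p, softmax u p = 1 := by
  simp only [softmax]
  rw [← Finset.sum_div, div_self]
  exact (Finset.sum_pos (fun _ _ => Real.exp_pos _) Finset.univ_nonempty).ne'

theorem sum_perm_succ {k : ℕ} {M : Type*} [AddCommMonoid M] (F : Equiv.Perm (Fin (k + 1)) → M) :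
    ∑ σ, F σ = ∑ p, ∑ e, F (Equiv.Perm.decomposeFin.symm (p, e)) := by
  rw [← Equiv.sum_comp Equiv.Perm.decomposeFin.symm, Fintype.sum_prod_type]

theorem mnlResidual_decompose {k : ℕ} (u : Fin (k + 1) → ℝ) (z : Fin (k + 1) → E)
    (p : Fin (k + 1)) (e : Equiv.Perm (Fin k)) :
    mnlResidual u z (Equiv.Perm.decomposeFin.symm (p, e)) =
      (z p - ∑ m, softmax u m • z m) +
        mnlResidual (fun x => u (Equiv.swap 0 p x.succ)) (fun x => z (Equiv.swap 0 p x.succ)) e := by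
  have h0 : Finset.Ici (0 : Fin (k + 1)) = Finset.univ := by ext; simp
  have hs : ∀ ℓ : Fin k, Finset.Ici ℓ.succ = (Finset.Ici ℓ).map (Fin.succEmb k) := by
    intro ℓ; ext x
    refine Fin.cases ?_ (fun y => ?_) x <;> simp
  unfold mnlResidual
  rw [Fin.sum_univ_succ]
  congr 1
  · rw [h0, Equiv.Perm.decomposeFin_symm_apply_zero]
    congr 1
    rw [← Equiv.sum_comp (Equiv.Perm.decomposeFin.symm (p, e)) fun m => softmax u m • z m]
    refine Finset.sum_congr rfl fun m _ => ?_
    rw [softmax, Equiv.sum_comp (Equiv.Perm.decomposeFin.symm (p, e)) fun m => Real.exp (u m)]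
  · refine Finset.sum_congr rfl fun ℓ _ => ?_
    rw [hs, Finset.sum_map, Finset.sum_map]
    simp only [Fin.coe_succEmb, Equiv.Perm.decomposeFin_symm_apply_succ]

/-- Given the first choice, what remains is an MNL ranking of the other slots. The residual is thus
a sum of martingale differences, each centred at its conditional mean. -/
theorem sum_mnlWeight_mul_residual : ∀ {k : ℕ} (u z : Fin k → ℝ),
    ∑ σ, mnlWeight u σ * mnlResidual u z σ = 0
  | 0, u, z => by simp [mnlResidual]
  | k + 1, u, z => by
    rw [sum_perm_succ]
    set c := ∑ m, softmax u m • z m with hc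
    have h1 : ∀ p, ∑ e, mnlWeight u (Equiv.Perm.decomposeFin.symm (p, e)) *
        mnlResidual u z (Equiv.Perm.decomposeFin.symm (p, e)) =
        softmax u p • z p - softmax u p * c := by
      intro p
      have e1 : ∀ e, mnlWeight u (Equiv.Perm.decomposeFin.symm (p, e)) *
        mnlResidual u z (Equiv.Perm.decomposeFin.symm (p, e)) =
        softmax u p * ((z p - c) * mnlWeight (fun x => u (Equiv.swap 0 p x.succ)) e +
          mnlWeight (fun x => u (Equiv.swap 0 p x.succ)) e *
            mnlResidual (fun x => u (Equiv.swap 0 p x.succ))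
              (fun x => z (Equiv.swap 0 p x.succ)) e) := by
        intro e
        rw [mnlWeight_decompose, mnlResidual_decompose, ← hc, softmax]; ring
      rw [Finset.sum_congr rfl fun e _ => e1 e, ← Finset.mul_sum, Finset.sum_add_distrib,
        ← Finset.mul_sum, sum_mnlWeight, sum_mnlWeight_mul_residual, smul_eq_mul]
      ring
    rw [Finset.sum_congr rfl fun p _ => h1 p, Finset.sum_sub_distrib, ← Finset.sum_mul,
      sum_softmax, ← hc]
    ring

theorem sum_swap_succ {k : ℕ} (f : Fin (k + 1) → ℝ) (p : Fin (k + 1)) :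
    ∑ x : Fin k, f (Equiv.swap 0 p x.succ) = (∑ m, f m) - f p := by
  have := Equiv.sum_comp (Equiv.swap 0 p) f
  rw [Fin.sum_univ_succ, Equiv.swap_apply_left] at this
  linarith

/-- Martingale differences are orthogonal. By induction the later stages cost at most the squares of
the slots not chosen, and the first stage costs a variance, which the square of the chosen slot
covers on average. Hence the bound is free of the utilities. -/
theorem sum_mnlWeight_mul_residual_sq : ∀ {k : ℕ} (u z : Fin k → ℝ),
    ∑ σ, mnlWeight u σ * mnlResidual u z σ ^ 2 ≤ ∑ m, z m ^ 2
  | 0, u, z => by simp [mnlResidual]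
  | k + 1, u, z => by
    rw [sum_perm_succ]
    set c := ∑ m, softmax u m • z m with hc
    have h1 : ∀ p, ∑ e, mnlWeight u (Equiv.Perm.decomposeFin.symm (p, e)) *
        mnlResidual u z (Equiv.Perm.decomposeFin.symm (p, e)) ^ 2 ≤
        softmax u p * ((z p - c) ^ 2 + ((∑ m, z m ^ 2) - z p ^ 2)) := by
      intro p
      have e1 : ∀ e, mnlWeight u (Equiv.Perm.decomposeFin.symm (p, e)) *
        mnlResidual u z (Equiv.Perm.decomposeFin.symm (p, e)) ^ 2 =
        softmax u p * ((z p - c) ^ 2 * mnlWeight (fun x => u (Equiv.swap 0 p x.succ)) e +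
          2 * (z p - c) * (mnlWeight (fun x => u (Equiv.swap 0 p x.succ)) e *
            mnlResidual (fun x => u (Equiv.swap 0 p x.succ))
              (fun x => z (Equiv.swap 0 p x.succ)) e) +
          mnlWeight (fun x => u (Equiv.swap 0 p x.succ)) e *
            mnlResidual (fun x => u (Equiv.swap 0 p x.succ))
              (fun x => z (Equiv.swap 0 p x.succ)) e ^ 2) := by
        intro e
        rw [mnlWeight_decompose, mnlResidual_decompose, ← hc, softmax]; ring
      rw [Finset.sum_congr rfl fun e _ => e1 e, ← Finset.mul_sum, Finset.sum_add_distrib,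
        Finset.sum_add_distrib, ← Finset.mul_sum, ← Finset.mul_sum, sum_mnlWeight,
        sum_mnlWeight_mul_residual]
      refine mul_le_mul_of_nonneg_left ?_ (softmax_nonneg u p)
      have := sum_mnlWeight_mul_residual_sq (fun x => u (Equiv.swap 0 p x.succ))
        (fun x => z (Equiv.swap 0 p x.succ))
      rw [sum_swap_succ (fun m => z m ^ 2) p] at this
      linarith
    refine (Finset.sum_le_sum fun p _ => h1 p).trans ?_
    have e2 : ∀ p, softmax u p * ((z p - c) ^ 2 + ((∑ m, z m ^ 2) - z p ^ 2)) =
        softmax u p * (∑ m, z m ^ 2) - 2 * c * (softmax u p • z p) + softmax u p * c ^ 2 := by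
      intro p; rw [smul_eq_mul]; ring
    rw [Finset.sum_congr rfl fun p _ => e2 p, Finset.sum_add_distrib, Finset.sum_sub_distrib,
      ← Finset.sum_mul, ← Finset.sum_mul, ← Finset.mul_sum, sum_softmax, ← hc]
    nlinarith [sq_nonneg c]

/-- Expand the square: the deviation has norm at most √2, which costs 2b. The cross term is a
centred variable of range √2‖x‖, for which Hoeffding's lemma at parameter 2b gives exactly b²‖x‖².
-/
theorem sum_softmax_mul_exp_sq_le {F : Type*} [NormedAddCommGroup F] [InnerProductSpace ℝ F]
    {k : ℕ} (u : Fin (k + 1) → ℝ) (z : Fin (k + 1) → F) (hz : ∀ m m', ‖z m - z m'‖ ≤ √2) (x : F)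
    {b : ℝ} (hb : 0 ≤ b) :
    ∑ p, softmax u p * Real.exp (b * ‖x + (z p - ∑ m, softmax u m • z m)‖ ^ 2) ≤
      Real.exp (2 * b + (b + b ^ 2) * ‖x‖ ^ 2) := by
  set c := ∑ m, softmax u m • z m with hc
  have hdev : ∀ p, ‖z p - c‖ ≤ √2 := by
    intro p
    have e : z p - c = ∑ m, softmax u m • (z p - z m) := by
      simp only [smul_sub, Finset.sum_sub_distrib, ← Finset.sum_smul, sum_softmax, one_smul, hc]
    rw [e]
    refine (norm_sum_le _ _).trans ?_
    calc ∑ m, ‖softmax u m • (z p - z m)‖ ≤ ∑ m, softmax u m * √2 :=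
          Finset.sum_le_sum fun m _ => by
            rw [norm_smul, Real.norm_of_nonneg (softmax_nonneg u m)]
            exact mul_le_mul_of_nonneg_left (hz p m) (softmax_nonneg u m)
      _ = √2 := by rw [← Finset.sum_mul, sum_softmax, one_mul]
  have h1 : ∀ p, ‖x + (z p - c)‖ ^ 2 ≤ ‖x‖ ^ 2 + 2 +
      2 * (inner ℝ x (z p) - ∑ m, softmax u m * inner ℝ x (z m)) := by
    intro p
    have hi : inner ℝ x c = ∑ m, softmax u m * inner ℝ x (z m) := by
      rw [hc, inner_sum]; simp [inner_smul_right]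
    have h2 : ‖z p - c‖ ^ 2 ≤ 2 := by
      calc ‖z p - c‖ ^ 2 ≤ √2 ^ 2 := pow_le_pow_left₀ (norm_nonneg _) (hdev p) 2
        _ = 2 := Real.sq_sqrt (by norm_num)
    rw [norm_add_sq_real, inner_sub_right, hi]
    linarith
  obtain ⟨p₀, hp₀⟩ := Finite.exists_min fun p => (inner ℝ x (z p) : ℝ)
  have hrange : ∀ p, (inner ℝ x (z p) : ℝ) ∈
      Set.Icc (inner ℝ x (z p₀) : ℝ) (inner ℝ x (z p₀) + √2 * ‖x‖) := by
    intro p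
    refine ⟨hp₀ p, ?_⟩
    have h2 : (inner ℝ x (z p - z p₀) : ℝ) ≤ ‖x‖ * ‖z p - z p₀‖ := real_inner_le_norm _ _
    have h3 := mul_le_mul_of_nonneg_left (hz p p₀) (norm_nonneg x)
    rw [inner_sub_right] at h2
    linarith
  have hH := sum_exp_le_of_range (softmax_nonneg u) (sum_softmax u) (fun p => inner ℝ x (z p))
    hrange (2 * b)
  have e1 : (2 * b) ^ 2 * (inner ℝ x (z p₀) + √2 * ‖x‖ - inner ℝ x (z p₀)) ^ 2 / 8 =
      b ^ 2 * ‖x‖ ^ 2 := by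
    have : √2 ^ 2 = (2 : ℝ) := Real.sq_sqrt (by norm_num)
    rw [add_sub_cancel_left, mul_pow √2, this]; ring
  rw [e1] at hH
  calc _ ≤ ∑ p, Real.exp (b * (‖x‖ ^ 2 + 2)) * (softmax u p *
        Real.exp (2 * b * (inner ℝ x (z p) - ∑ m, softmax u m * inner ℝ x (z m)))) := by
        refine Finset.sum_le_sum fun p _ => ?_
        rw [mul_left_comm, ← Real.exp_add]
        refine mul_le_mul_of_nonneg_left (Real.exp_le_exp.2 ?_) (softmax_nonneg u p)
        have := mul_le_mul_of_nonneg_left (h1 p) hb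
        linarith
    _ ≤ Real.exp (b * (‖x‖ ^ 2 + 2)) * Real.exp (b ^ 2 * ‖x‖ ^ 2) := by
        rw [← Finset.mul_sum]
        exact mul_le_mul_of_nonneg_left hH (Real.exp_pos _).le
    _ = _ := by rw [← Real.exp_add]; congr 1; ring

/-- Sub-Gaussian concentration of the norm of the MNL residual. -/
theorem sum_mnlWeight_mul_exp_le {F : Type*} [NormedAddCommGroup F] [InnerProductSpace ℝ F]
    {lam : ℝ} (hlam : 0 ≤ lam) : ∀ {k : ℕ} (_ : k * lam < 1) (u : Fin k → ℝ) (z : Fin k → F)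
    (_ : ∀ m m', ‖z m - z m'‖ ≤ √2) (x : F),
    ∑ σ, mnlWeight u σ * Real.exp (lam * ‖x + mnlResidual u z σ‖ ^ 2) ≤
      Real.exp (2 * k * (lam / (1 - k * lam)) + lam / (1 - k * lam) * ‖x‖ ^ 2)
  | 0, _, u, z, _, x => by simp [mnlWeight, mnlResidual]
  | k + 1, hk, u, z, hz, x => by
    push_cast at hk ⊢
    have hk' : k * lam < 1 := by linarith
    set b := lam / (1 - k * lam) with hb
    have hb0 : 0 ≤ b := div_nonneg hlam (by linarith)
    -- Each earlier stage replaces the coefficient b by b + b². Since 1/(b + b²) = 1/b - 1/(1 + b) ≥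
    -- 1/b - 1 for b > 0, the closed form `lam / (1 - k * lam)`, whose inverse drops by 1 per stage,
    -- dominates this recursion.
    have hbb : b + b ^ 2 ≤ lam / (1 - (k + 1) * lam) := by
      rw [le_div_iff₀ (by linarith)]
      have hbs : b * (1 - k * lam) = lam := div_mul_cancel₀ _ (by linarith)
      have : (b + b ^ 2) * (1 - (k + 1) * lam) = lam * (1 - b ^ 2) := by
        calc (b + b ^ 2) * (1 - (k + 1) * lam)
            = (1 + b) * (b * (1 - k * lam)) - (b + b ^ 2) * lam := by ring
          _ = _ := by rw [hbs]; ring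
      rw [this]
      nlinarith [mul_nonneg hlam (sq_nonneg b)]
    rw [sum_perm_succ]
    have h1 : ∀ p, ∑ e, mnlWeight u (Equiv.Perm.decomposeFin.symm (p, e)) *
        Real.exp (lam * ‖x + mnlResidual u z (Equiv.Perm.decomposeFin.symm (p, e))‖ ^ 2) ≤
        Real.exp (2 * k * b) * (softmax u p *
          Real.exp (b * ‖x + (z p - ∑ m, softmax u m • z m)‖ ^ 2)) := by
      intro p
      have ih := sum_mnlWeight_mul_exp_le hlam hk' (fun x => u (Equiv.swap 0 p x.succ))
        (fun x => z (Equiv.swap 0 p x.succ)) (fun m m' => hz _ _)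
        (x + (z p - ∑ m, softmax u m • z m))
      rw [← hb, Real.exp_add] at ih
      have ih' := mul_le_mul_of_nonneg_left ih (softmax_nonneg u p)
      calc _ = softmax u p * ∑ e, mnlWeight (fun x => u (Equiv.swap 0 p x.succ)) e *
            Real.exp (lam * ‖x + (z p - ∑ m, softmax u m • z m) +
              mnlResidual (fun x => u (Equiv.swap 0 p x.succ))
                (fun x => z (Equiv.swap 0 p x.succ)) e‖ ^ 2) := by
            rw [Finset.mul_sum]
            refine Finset.sum_congr rfl fun e _ => ?_
            rw [mnlWeight_decompose, mnlResidual_decompose, add_assoc, softmax, mul_assoc]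
        _ ≤ _ := ih'
        _ = _ := by ring
    refine (Finset.sum_le_sum fun p _ => h1 p).trans ?_
    rw [← Finset.mul_sum]
    refine (mul_le_mul_of_nonneg_left (sum_softmax_mul_exp_sq_le u z hz x hb0)
      (Real.exp_pos _).le).trans ?_
    rw [← Real.exp_add, Real.exp_le_exp]
    have h2 := mul_le_mul_of_nonneg_right hbb (sq_nonneg ‖x‖)
    have h3 : 2 * (k + 1) * b ≤ 2 * (k + 1) * (lam / (1 - (k + 1) * lam)) :=
      mul_le_mul_of_nonneg_left (by nlinarith [sq_nonneg b]) (by positivity)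
    linarith

end Residual
end KWise

namespace KWise

/-! ### Comparison of MNL survivors with independent thinning. -/

section Domination
variable {α : Type*} [DecidableEq α]

/-- The expectation of `f` at the set of alternatives left after `n` choices from `A`, when every
choice is made with probabilities proportional to `w`. -/
noncomputable def chainMean (w : α → ℝ) (f : Finset α → ℝ) : ℕ → Finset α → ℝ
  | 0, A => f A
  | n + 1, A => ∑ m ∈ A, w m / (∑ m' ∈ A, w m') * chainMean w f n (A.erase m)

/-- The weight of the subset `B` of `A` under independent thinning with survival probabilities
`q`. -/
noncomputable def thinWeight (q : α → ℝ) (A B : Finset α) : ℝ :=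
  ∏ m ∈ A, if m ∈ B then q m else 1 - q m

theorem sum_thinWeight (q : α → ℝ) (A : Finset α) : ∑ B ∈ A.powerset, thinWeight q A B = 1 := by
  have h := Finset.prod_add q (fun m => 1 - q m) A
  simp only [add_sub_cancel, Finset.prod_const_one] at h
  rw [h]
  refine Finset.sum_congr rfl fun B hB => ?_
  have hB := Finset.mem_powerset.1 hB
  rw [thinWeight, ← Finset.prod_sdiff hB, mul_comm]
  congr 1
  · exact Finset.prod_congr rfl fun m hm => if_pos hm
  · exact Finset.prod_congr rfl fun m hm => if_neg (Finset.mem_sdiff.1 hm).2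

theorem thinWeight_nonneg {q : α → ℝ} (h0 : ∀ m, 0 ≤ q m) (h1 : ∀ m, q m ≤ 1) (A B : Finset α) :
    0 ≤ thinWeight q A B :=
  Finset.prod_nonneg fun m _ => by split_ifs <;> linarith [h0 m, h1 m]

/-- The value `f B`, replaced by the value at the empty set when fewer than `n` elements of `A` are
missing from `B`. -/
noncomputable def stopped (f : Finset α → ℝ) (n : ℕ) (A B : Finset α) : ℝ :=
  if n ≤ (A \ B).card then f B else f ∅

theorem chainMean_le {w : α → ℝ} (hw : ∀ m, 0 < w m) {f : Finset α → ℝ} (hf : Antitone f) (n : ℕ)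
    (A : Finset α) (hA : n ≤ A.card) : chainMean w f n A ≤ f ∅ := by
  induction n generalizing A with
  | zero => exact hf (Finset.empty_subset A)
  | succ n ih =>
    have hne : A.Nonempty := Finset.card_pos.1 (by omega)
    have hW : 0 < ∑ m ∈ A, w m := Finset.sum_pos (fun m _ => hw m) hne
    calc chainMean w f (n + 1) A ≤ ∑ m ∈ A, w m / (∑ m' ∈ A, w m') * f ∅ :=
          Finset.sum_le_sum fun m hm => mul_le_mul_of_nonneg_left
            (ih _ (by rw [Finset.card_erase_of_mem hm]; omega)) (div_nonneg (hw m).le hW.le)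
      _ = f ∅ := by rw [← Finset.sum_mul, ← Finset.sum_div, div_self hW.ne', one_mul]

/-- Derivative of an expectation under thinning at exponential times. -/
theorem hasDerivAt_thin (w : α → ℝ) (A : Finset α) (φ : Finset α → ℝ) (t : ℝ) :
    HasDerivAt (fun t => ∑ B ∈ A.powerset, thinWeight (fun m => Real.exp (-(w m * t))) A B * φ B)
      (∑ m ∈ A, w m * ((∑ B ∈ (A.erase m).powerset,
          thinWeight (fun m => Real.exp (-(w m * t))) (A.erase m) B * φ B) -
        ∑ B ∈ A.powerset, thinWeight (fun m => Real.exp (-(w m * t))) A B * φ B)) t := by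
  have hr : ∀ (B : Finset α) m, HasDerivAt
      (fun t => if m ∈ B then Real.exp (-(w m * t)) else 1 - Real.exp (-(w m * t)))
      (if m ∈ B then -(w m * Real.exp (-(w m * t))) else w m * Real.exp (-(w m * t))) t := by
    intro B m
    have h : HasDerivAt (fun t => Real.exp (-(w m * t))) (-(w m * Real.exp (-(w m * t)))) t := by
      have h0 : HasDerivAt (fun t => -(w m * t)) (-(w m * 1)) t :=
        ((hasDerivAt_id t).const_mul (w m)).neg
      convert h0.exp using 1; ring
    split_ifs
    · exact h
    · simpa using h.const_sub 1
  have hB : ∀ B, HasDerivAt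
      (fun t => thinWeight (fun m => Real.exp (-(w m * t))) A B * φ B)
      ((∑ m ∈ A, (∏ j ∈ A.erase m,
        if j ∈ B then Real.exp (-(w j * t)) else 1 - Real.exp (-(w j * t))) •
        (if m ∈ B then -(w m * Real.exp (-(w m * t))) else w m * Real.exp (-(w m * t)))) * φ B)
      t := fun B =>
    (HasDerivAt.fun_finsetProd (u := A) fun m _ => hr B m).mul_const (φ B)
  have hsum := HasDerivAt.fun_sum (u := A.powerset) fun B _ => hB B
  refine hsum.congr_deriv (Eq.symm ?_)
  simp only [Finset.sum_mul, smul_eq_mul]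
  rw [Finset.sum_comm]
  refine Finset.sum_congr rfl fun m hm => ?_
  -- Isolating the factor of `m` turns the identity into one between sums over the subsets of `A'`,
  -- according to whether they are joined by `m`.
  obtain ⟨A', hmA', rfl⟩ : ∃ A', m ∉ A' ∧ A = insert m A' :=
    ⟨A.erase m, Finset.notMem_erase m A, (Finset.insert_erase hm).symm⟩
  rw [Finset.erase_insert hmA', Finset.sum_powerset_insert hmA', Finset.sum_powerset_insert hmA']
  set q := fun m => Real.exp (-(w m * t)) with hq
  have e1 : ∀ B ∈ A'.powerset, thinWeight q (insert m A') B = (1 - q m) * thinWeight q A' B := by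
    intro B hB
    have : m ∉ B := fun h => hmA' (Finset.mem_powerset.1 hB h)
    rw [thinWeight, Finset.prod_insert hmA', if_neg this]; rfl
  have e2' : ∀ B, ∏ j ∈ A', (if j ∈ insert m B then q j else 1 - q j) = thinWeight q A' B := by
    intro B
    refine Finset.prod_congr rfl fun j hj => ?_
    have : j ≠ m := fun h => hmA' (h ▸ hj)
    simp [this]
  have e2 : ∀ B, thinWeight q (insert m A') (insert m B) = q m * thinWeight q A' B := by
    intro B
    rw [thinWeight, Finset.prod_insert hmA', if_pos (Finset.mem_insert_self m B), e2']
  have f1 : ∑ B ∈ A'.powerset, thinWeight q (insert m A') B * φ B =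
      (1 - q m) * ∑ B ∈ A'.powerset, thinWeight q A' B * φ B := by
    rw [Finset.mul_sum]
    exact Finset.sum_congr rfl fun B hB => by rw [e1 B hB]; ring
  have f2 : ∑ B ∈ A'.powerset, thinWeight q (insert m A') (insert m B) * φ (insert m B) =
      q m * ∑ B ∈ A'.powerset, thinWeight q A' B * φ (insert m B) := by
    rw [Finset.mul_sum]
    exact Finset.sum_congr rfl fun B hB => by rw [e2 B]; ring
  have f3 : ∑ B ∈ A'.powerset, (∏ j ∈ A', if j ∈ B then q j else 1 - q j) *
      (if m ∈ B then -(w m * q m) else w m * q m) * φ B =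
      w m * q m * ∑ B ∈ A'.powerset, thinWeight q A' B * φ B := by
    rw [Finset.mul_sum]
    refine Finset.sum_congr rfl fun B hB => ?_
    have : m ∉ B := fun h => hmA' (Finset.mem_powerset.1 hB h)
    rw [if_neg this, thinWeight]; ring
  have f4 : ∑ B ∈ A'.powerset, (∏ j ∈ A', if j ∈ insert m B then q j else 1 - q j) *
      (if m ∈ insert m B then -(w m * q m) else w m * q m) * φ (insert m B) =
      -(w m * q m) * ∑ B ∈ A'.powerset, thinWeight q A' B * φ (insert m B) := by
    rw [Finset.mul_sum]
    refine Finset.sum_congr rfl fun B hB => ?_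
    rw [if_pos (Finset.mem_insert_self m B), e2']; ring
  rw [f1, f2, f3, f4]
  ring

/-- Sampling without replacement is dominated by independent thinning. -/
theorem chainMean_le_thin {w : α → ℝ} (hw : ∀ m, 0 < w m) {f : Finset α → ℝ} (hf : Antitone f)
    (n : ℕ) (A : Finset α) (hA : n ≤ A.card) {t : ℝ} (ht : 0 ≤ t) :
    chainMean w f n A ≤ ∑ B ∈ A.powerset,
      thinWeight (fun m => Real.exp (-(w m * t))) A B * stopped f n A B := by
  have hq0 : ∀ (t : ℝ) m, 0 ≤ Real.exp (-(w m * t)) := fun t m => (Real.exp_pos _).le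
  have hq1 : ∀ (t : ℝ), 0 ≤ t → ∀ m, Real.exp (-(w m * t)) ≤ 1 := fun t ht m =>
    Real.exp_le_one_iff.2 (by nlinarith [hw m])
  induction n generalizing A t with
  | zero =>
    simp only [chainMean, stopped, Nat.zero_le, if_true]
    calc f A = ∑ B ∈ A.powerset, thinWeight (fun m => Real.exp (-(w m * t))) A B * f A := by
          rw [← Finset.sum_mul, sum_thinWeight, one_mul]
      _ ≤ _ := Finset.sum_le_sum fun B hB => mul_le_mul_of_nonneg_left
          (hf (Finset.mem_powerset.1 hB)) (thinWeight_nonneg (hq0 t) (hq1 t ht) A B)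
  | succ n ih =>
    -- `G t` is the mean at time t of the race of exponential clocks, with the largest value of `f`
    -- charged if fewer than n + 1 clocks have rung. It satisfies G' = Σ w_m (G_m - G), where `G_m`
    -- runs the race without `m`; the chain mean satisfies the stationary analogue.
    set G : ℝ → ℝ := fun t => ∑ B ∈ A.powerset,
      thinWeight (fun m => Real.exp (-(w m * t))) A B * stopped f (n + 1) A B with hG
    set W := ∑ m ∈ A, w m with hWdef
    set F := chainMean w f (n + 1) A with hF
    have hne : A.Nonempty := Finset.card_pos.1 (by omega)
    have hW : 0 < W := Finset.sum_pos (fun m _ => hw m) hne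
    have hder : ∀ t, HasDerivAt (fun t => Real.exp (W * t) * (G t - F))
        (Real.exp (W * t) * (W * 1) * (G t - F) + Real.exp (W * t) * _) t := fun t =>
      (((hasDerivAt_id t).const_mul W).exp).mul
        ((hasDerivAt_thin w A (stopped f (n + 1) A) t).sub_const F)
    have hWF : W * F = ∑ m ∈ A, w m * chainMean w f n (A.erase m) := by
      rw [hF, chainMean, Finset.mul_sum]
      refine Finset.sum_congr rfl fun m _ => ?_
      rw [← hWdef]; field_simp
    -- The integrating factor exp(W t) cancels the -W G term, so the sign of the derivative is
    -- decided by the induction hypothesis for the sets `A.erase m`.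
    have hmono : MonotoneOn (fun t => Real.exp (W * t) * (G t - F)) (Set.Ici 0) := by
      refine monotoneOn_of_deriv_nonneg (convex_Ici 0)
        (fun t _ => (hder t).continuousAt.continuousWithinAt)
        (fun t _ => (hder t).differentiableAt.differentiableWithinAt) fun t ht => ?_
      rw [interior_Ici, Set.mem_Ioi] at ht
      rw [(hder t).deriv, mul_assoc, ← mul_add]
      refine mul_nonneg (Real.exp_pos _).le ?_
      have h1 : ∀ m ∈ A, chainMean w f n (A.erase m) ≤ ∑ B ∈ (A.erase m).powerset,
          thinWeight (fun m => Real.exp (-(w m * t))) (A.erase m) B * stopped f (n + 1) A B := by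
        intro m hm
        have h := ih (A.erase m) (by rw [Finset.card_erase_of_mem hm]; omega) ht.le
        refine h.trans (le_of_eq (Finset.sum_congr rfl fun B hB => ?_))
        congr 1
        have hmB : m ∉ B := fun h => Finset.notMem_erase m A (Finset.mem_powerset.1 hB h)
        -- An element already gone counts as one removal, so threshold n + 1 for `A` is threshold n
        -- for `A.erase m`.
        have : A \ B = insert m (A.erase m \ B) := by
          rw [← Finset.insert_sdiff_of_notMem _ hmB, Finset.insert_erase hm]
        rw [stopped, stopped, this, Finset.card_insert_of_notMem (by simp)]
        simp
      have h2 := Finset.sum_le_sum fun m hm => mul_le_mul_of_nonneg_left (h1 m hm) (hw m).le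
      rw [← hWF] at h2
      simp only [mul_sub, Finset.sum_sub_distrib, ← Finset.sum_mul]
      rw [← hWdef]
      linarith
    have h0 : 0 ≤ G 0 - F := by
      -- At time 0 nothing is removed, so the default value `f ∅` is taken; it is an upper bound
      -- because `f` is antitone.
      have e : G 0 = f ∅ := by
        rw [hG]
        simp only [mul_zero, neg_zero, Real.exp_zero]
        rw [Finset.sum_eq_single A]
        · simp only [stopped, Finset.sdiff_self, Finset.card_empty, thinWeight]
          rw [Finset.prod_congr rfl fun m hm => if_pos hm]; simp
        · intro B hB hBA
          have hB := Finset.mem_powerset.1 hB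
          obtain ⟨m, hm, hmB⟩ := Finset.exists_of_ssubset (lt_of_le_of_ne hB hBA)
          rw [thinWeight, Finset.prod_eq_zero hm (by simp [hmB]), zero_mul]
        · simp
      rw [e, sub_nonneg]
      exact chainMean_le hw hf _ _ hA
    have h1 := hmono (Set.mem_Ici.2 le_rfl) (Set.mem_Ici.2 ht) ht
    simp only [mul_zero, Real.exp_zero, one_mul] at h1
    have h2 := nonneg_of_mul_nonneg_right (h0.trans h1) (Real.exp_pos _)
    exact sub_nonneg.1 h2

/-- The slots not among the first `n` of the ranking `σ`. -/
def survivors {k : ℕ} (σ : Equiv.Perm (Fin k)) (n : ℕ) : Finset (Fin k) :=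
  (Finset.univ.filter fun m : Fin k => n ≤ (m : ℕ)).image σ

theorem survivors_zero {k : ℕ} (σ : Equiv.Perm (Fin k)) : survivors σ 0 = Finset.univ := by
  ext x
  simp only [survivors, Finset.mem_image, Finset.mem_filter, Finset.mem_univ, true_and, zero_le,
    iff_true]
  exact ⟨σ.symm x, by simp⟩

theorem survivors_decompose {k : ℕ} (p : Fin (k + 1)) (e : Equiv.Perm (Fin k)) (n : ℕ) :
    survivors (Equiv.Perm.decomposeFin.symm (p, e)) (n + 1) =
      (survivors e n).image fun x => Equiv.swap 0 p x.succ := by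
  ext x
  simp only [survivors, Finset.mem_image, Finset.mem_filter, Finset.mem_univ, true_and]
  constructor
  · rintro ⟨m, hm, rfl⟩
    obtain ⟨m', rfl⟩ := Fin.exists_succ_eq.2 (show m ≠ 0 by rintro rfl; simp at hm)
    exact ⟨e m', ⟨m', by simpa using hm, rfl⟩,
      (Equiv.Perm.decomposeFin_symm_apply_succ e p m').symm⟩
  · rintro ⟨y, ⟨m, hm, rfl⟩, rfl⟩
    exact ⟨m.succ, by simpa using hm, Equiv.Perm.decomposeFin_symm_apply_succ e p m⟩

/-- Deleting the first choice relabels the remaining slots through a swap, so the induction must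
allow an arbitrary injective labelling. The factor `c` allows the clock rates to be rescaled, which
leaves the choice probabilities unchanged. -/
theorem sum_mnlWeight_survivors {w : α → ℝ} {f : Finset α → ℝ} {c : ℝ} (hc : 0 < c) :
    ∀ {k : ℕ} (n : ℕ) (_ : n ≤ k) (u : Fin k → ℝ) (ι : Fin k → α) (_ : Function.Injective ι)
      (_ : ∀ m, w (ι m) = c * Real.exp (u m)),
    ∑ σ, mnlWeight u σ * f ((survivors σ n).image ι) = chainMean w f n (Finset.univ.image ι)
  | k, 0, _, u, ι, _, _ => by
    simp only [survivors_zero, ← Finset.sum_mul, sum_mnlWeight, one_mul, chainMean]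
  | 0, n + 1, h, _, _, _, _ => absurd h (by omega)
  | k + 1, n + 1, h, u, ι, hι, hwι => by
    rw [sum_perm_succ, chainMean, Finset.sum_image fun a _ b _ hab => hι hab,
      Finset.sum_image fun a _ b _ hab => hι hab]
    refine Finset.sum_congr rfl fun p _ => ?_
    have hinj : Function.Injective fun x : Fin k => ι (Equiv.swap 0 p x.succ) := fun a b hab =>
      Fin.succ_injective _ ((Equiv.swap 0 p).injective (hι hab))
    have ih := sum_mnlWeight_survivors (f := f) hc n (by omega : n ≤ k)
      (fun x => u (Equiv.swap 0 p x.succ)) (fun x => ι (Equiv.swap 0 p x.succ)) hinj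
      (fun m => hwι _)
    have himg : (Finset.univ.image ι).erase (ι p) =
        Finset.univ.image fun x : Fin k => ι (Equiv.swap 0 p x.succ) := by
      ext a
      simp only [Finset.mem_erase, Finset.mem_image, Finset.mem_univ, true_and]
      constructor
      · rintro ⟨hne, m, rfl⟩
        have hm : Equiv.swap 0 p m ≠ 0 := by
          intro h0
          apply hne
          have h1 := congrArg (Equiv.swap 0 p) h0
          rw [Equiv.swap_apply_self, Equiv.swap_apply_left] at h1
          rw [h1]
        obtain ⟨x, hx⟩ := Fin.exists_succ_eq.2 hm
        exact ⟨x, by rw [hx, Equiv.swap_apply_self]⟩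
      · rintro ⟨x, rfl⟩
        refine ⟨fun h0 => ?_, _, rfl⟩
        have h1 := hι h0
        rw [← Equiv.swap_apply_left 0 p] at h1
        exact Fin.succ_ne_zero x ((Equiv.swap 0 p).injective h1)
    rw [himg, ← ih, Finset.mul_sum]
    refine Finset.sum_congr rfl fun e _ => ?_
    rw [mnlWeight_decompose, survivors_decompose, Finset.image_image, mul_assoc]
    congr 1
    rw [Finset.sum_congr rfl fun m _ => hwι m, hwι, ← Finset.mul_sum, mul_div_mul_left _ _ hc.ne']

/-- The alternatives left after the first `n` choices of an MNL ranking dominate an independent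
thinning of all the alternatives. -/
theorem sum_mnlWeight_survivors_le {k : ℕ} (u : Fin k → ℝ) {f : Finset (Fin k) → ℝ}
    (hf : Antitone f) {n : ℕ} (hn : n ≤ k) (c : ℝ) {t : ℝ} (ht : 0 ≤ t) :
    ∑ σ, mnlWeight u σ * f (survivors σ n) ≤
      ∑ B, thinWeight (fun m => Real.exp (-(Real.exp (u m - c) * t))) Finset.univ B *
        stopped f n Finset.univ B := by
  have h1 := sum_mnlWeight_survivors (w := fun m => Real.exp (u m - c)) (f := f)
    (Real.exp_pos (-c)) n hn u id Function.injective_id fun m => by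
      rw [← Real.exp_add]; congr 1; simp; ring
  simp only [Finset.image_id] at h1
  rw [h1]
  have h2 := chainMean_le_thin (w := fun m => Real.exp (u m - c)) (fun m => Real.exp_pos _) hf n
    Finset.univ (by simpa using hn) ht
  rwa [Finset.powerset_univ] at h2

end Domination
end KWise

namespace KWise
open Matrix

/-! ### Nuclear norm: duality, polar factor, decomposability. -/

section Nuclear
variable {d₁ d₂ : ℕ}

/-- The trace inner product of two matrices. -/
def matInner {m n : Type*} [Fintype m] [Fintype n] (A B : Matrix m n ℝ) : ℝ := (Aᵀ * B).trace

/-- The operator norm of `A` is at most `c`. -/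
def OpBound {m n : Type*} [Fintype m] [Fintype n] (A : Matrix m n ℝ) (c : ℝ) : Prop :=
  ∀ x y, x ⬝ᵥ A *ᵥ y ≤ c * (√(x ⬝ᵥ x) * √(y ⬝ᵥ y))

theorem dotProduct_self_nonneg' {n : Type*} [Fintype n] (x : n → ℝ) : 0 ≤ x ⬝ᵥ x :=
  Finset.sum_nonneg fun _ _ => mul_self_nonneg _

theorem dotProduct_le_sqrt {n : Type*} [Fintype n] (x y : n → ℝ) :
    x ⬝ᵥ y ≤ √(x ⬝ᵥ x) * √(y ⬝ᵥ y) := by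
  have h := Finset.sum_mul_sq_le_sq_mul_sq Finset.univ x y
  rw [← Real.sqrt_mul (dotProduct_self_nonneg' x)]
  refine Real.le_sqrt_of_sq_le ?_
  simpa [dotProduct, sq] using h

theorem matInner_eq_sum {m n : Type*} [Fintype m] [Fintype n] (A B : Matrix m n ℝ) :
    matInner A B = ∑ i, ∑ j, A i j * B i j := by
  rw [matInner, trace, Finset.sum_comm]
  rfl

theorem matInner_self_nonneg {m n : Type*} [Fintype m] [Fintype n] (A : Matrix m n ℝ) :
    0 ≤ matInner A A := by
  rw [matInner_eq_sum]
  exact Finset.sum_nonneg fun _ _ => Finset.sum_nonneg fun _ _ => mul_self_nonneg _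

theorem matInner_le_sqrt {m n : Type*} [Fintype m] [Fintype n] (A B : Matrix m n ℝ) :
    matInner A B ≤ √(matInner A A) * √(matInner B B) := by
  have h := dotProduct_le_sqrt (fun q : m × n => A q.1 q.2) (fun q => B q.1 q.2)
  simpa only [dotProduct, Fintype.sum_prod_type, ← matInner_eq_sum] using h

theorem matInner_comm {m n : Type*} [Fintype m] [Fintype n] (A B : Matrix m n ℝ) :
    matInner A B = matInner B A := by
  rw [matInner, ← trace_transpose, transpose_mul, transpose_transpose, matInner]

theorem matInner_mul_mul {m n : Type*} [Fintype m] [Fintype n] (A B : Matrix m n ℝ)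
    (X : Matrix m m ℝ) (Y : Matrix n n ℝ) :
    matInner (X * A * Y) B = matInner A (Xᵀ * B * Yᵀ) := by
  rw [matInner, matInner, transpose_mul, transpose_mul, Matrix.mul_assoc, Matrix.trace_mul_comm]
  simp only [Matrix.mul_assoc]

theorem frobNorm_eq (A : Matrix (Fin d₁) (Fin d₂) ℝ) : frobNorm A = √(matInner A A) := by
  rw [frobNorm, Matrix.frobenius_norm_def, matInner_eq_sum, ← Real.sqrt_eq_rpow]
  congr 1
  refine Finset.sum_congr rfl fun i _ => Finset.sum_congr rfl fun j _ => ?_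
  rw [Real.norm_eq_abs, Real.rpow_two, sq_abs, sq]

theorem transpose_mul_orthonormalBasis {n : ℕ}
    (b : OrthonormalBasis (Fin n) ℝ (EuclideanSpace ℝ (Fin n))) :
    (Matrix.of fun i a => b a i)ᵀ * (Matrix.of fun i a => b a i) = (1 : Matrix _ _ ℝ) := by
  ext a c
  have h := orthonormal_iff_ite.1 b.orthonormal a c
  rw [Matrix.one_apply, ← h, mul_apply, PiLp.inner_apply]
  refine Finset.sum_congr rfl fun i _ => ?_
  rw [transpose_apply, of_apply, of_apply, mul_comm]
  rfl

/-- An orthonormal basis of right singular vectors. -/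
theorem exists_singular_basis (A : Matrix (Fin d₁) (Fin d₂) ℝ) :
    ∃ (U : Matrix (Fin d₂) (Fin d₂) ℝ) (s : Fin d₂ → ℝ), Uᵀ * U = 1 ∧ U * Uᵀ = 1 ∧
      (∀ a, 0 ≤ s a) ∧ Aᵀ * A = U * diagonal (fun a => s a ^ 2) * Uᵀ ∧
      nuclearNorm A = ∑ a, s a := by
  obtain ⟨T, hT⟩ : ∃ T, T = Matrix.toEuclideanLin A := ⟨_, rfl⟩
  have hn : Module.finrank ℝ (EuclideanSpace ℝ (Fin d₂)) = d₂ := finrank_euclideanSpace_fin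
  obtain ⟨b, heig⟩ : ∃ b : OrthonormalBasis (Fin d₂) ℝ (EuclideanSpace ℝ (Fin d₂)),
      ∀ a, (Aᵀ * A) *ᵥ (b a) = (T.singularValues a ^ 2) • (b a : Fin d₂ → ℝ) := by
    refine ⟨T.isSymmetric_adjoint_comp_self.eigenvectorBasis hn, fun a => ?_⟩
    have h := T.isSymmetric_adjoint_comp_self.apply_eigenvectorBasis hn a
    rw [← T.sq_singularValues_fin hn] at h
    generalize T.isSymmetric_adjoint_comp_self.eigenvectorBasis hn = b at h
    have hadj : LinearMap.adjoint T = Matrix.toEuclideanLin Aᵀ := by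
      rw [hT, ← Matrix.toEuclideanLin_conjTranspose_eq_adjoint,
        conjTranspose_eq_transpose_of_trivial]
    have h2 := congrArg WithLp.ofLp h
    have hTb : T (b a) = WithLp.toLp 2 (A *ᵥ (b a)) := by rw [hT, toLpLin_apply]
    rw [LinearMap.comp_apply, hadj, hTb, toLpLin_apply, mulVec_mulVec] at h2
    exact h2
  set U : Matrix (Fin d₂) (Fin d₂) ℝ := Matrix.of fun i a => b a i with hU
  have hUU : Uᵀ * U = 1 := transpose_mul_orthonormalBasis b
  have hUU' : U * Uᵀ = 1 := mul_eq_one_comm.1 hUU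
  refine ⟨U, fun a => T.singularValues a, hUU, hUU', fun a => T.singularValues_nonneg a, ?_, ?_⟩
  · have h : Aᵀ * A * U = U * diagonal (fun a : Fin d₂ => T.singularValues a ^ 2) := by
      ext i a
      have h1 := congrFun (heig a) i
      rw [mul_diagonal]
      calc (Aᵀ * A * U) i a = ((Aᵀ * A) *ᵥ (b a)) i := rfl
        _ = _ := by rw [h1]; simp [hU, mul_comm]
    rw [← h, Matrix.mul_assoc, hUU', Matrix.mul_one]
  · rw [nuclearNorm, ← hT, ← Fin.sum_univ_eq_sum_range]
    have : ∑ a : Fin d₂, T.singularValues a = ∑ a ∈ Finset.range d₂, T.singularValues a :=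
      Fin.sum_univ_eq_sum_range (fun a => T.singularValues a) d₂
    rw [this, Fin.sum_univ_eq_sum_range (fun a => T.singularValues a) (min d₁ d₂)]
    -- The surplus singular values vanish, since the rank is at most `d₁`.
    refine Finset.sum_subset (Finset.range_mono (min_le_right _ _)) fun j hj hj' => ?_
    rw [T.singularValues_eq_zero_iff_le_finrank_range]
    rw [Finset.mem_range] at hj hj'
    have h1 : Module.finrank ℝ (LinearMap.range T) ≤ Module.finrank ℝ
      (EuclideanSpace ℝ (Fin d₁)) := Submodule.finrank_le _
    rw [finrank_euclideanSpace_fin] at h1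
    omega

/-- Duality between the operator norm and the nuclear norm. -/
theorem matInner_le_mul_nuclearNorm {N A : Matrix (Fin d₁) (Fin d₂) ℝ} {c : ℝ}
    (hN : OpBound N c) : matInner N A ≤ c * nuclearNorm A := by
  obtain ⟨U, s, hU, hU', hs, hA, hnuc⟩ := exists_singular_basis A
  have e1 : matInner N A = ∑ a, ((A * U).col a) ⬝ᵥ N *ᵥ (U.col a) := by
    have : matInner N A = ((A * U)ᵀ * (N * U)).trace := by
      rw [matInner_comm, matInner, transpose_mul, Matrix.mul_assoc, Matrix.trace_mul_comm Uᵀ,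
        Matrix.mul_assoc, Matrix.mul_assoc, hU', Matrix.mul_one]
    rw [this]; rfl
  rw [e1, hnuc, Finset.mul_sum]
  refine Finset.sum_le_sum fun a _ => (hN _ _).trans (le_of_eq ?_)
  have h1 : U.col a ⬝ᵥ U.col a = 1 := by
    have := congrFun (congrFun hU a) a
    simpa [mul_apply, dotProduct] using this
  have h2 : (A * U).col a ⬝ᵥ (A * U).col a = s a ^ 2 := by
    have : ((A * U)ᵀ * (A * U)) = diagonal (fun a => s a ^ 2) := by
      rw [transpose_mul, Matrix.mul_assoc, ← Matrix.mul_assoc Aᵀ, hA]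
      calc Uᵀ * (U * diagonal (fun a => s a ^ 2) * Uᵀ * U)
          = (Uᵀ * U) * diagonal (fun a => s a ^ 2) * (Uᵀ * U) := by simp only [Matrix.mul_assoc]
        _ = _ := by rw [hU, Matrix.one_mul, Matrix.mul_one]
    have h3 := congrFun (congrFun this a) a
    rw [diagonal_apply_eq] at h3
    exact h3
  rw [h1, h2, Real.sqrt_one, mul_one, Real.sqrt_sq (hs a)]

/-- The partial isometry of the polar decomposition. -/
theorem exists_polar (A : Matrix (Fin d₁) (Fin d₂) ℝ) :
    ∃ W : Matrix (Fin d₁) (Fin d₂) ℝ, matInner W A = nuclearNorm A ∧ W * Wᵀ * W = W ∧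
      W * Wᵀ * A = A ∧ A * (Wᵀ * W) = A ∧ (Wᵀ * W).trace = A.rank := by
  obtain ⟨U, s, hU, hU', hs, hA, hnuc⟩ := exists_singular_basis A
  -- With the convention 0⁻¹ = 0, `R` is the pseudo-inverse of |A| and `J` the orthogonal projection
  -- onto the row space, so that `A * R` is the polar factor.
  set R := U * diagonal (fun a => (s a)⁻¹) * Uᵀ with hR
  set J := U * diagonal (fun a => (s a)⁻¹ * (s a)) * Uᵀ with hJ
  have hRt : Rᵀ = R := by rw [hR]; simp [Matrix.mul_assoc]
  have hJt : Jᵀ = J := by rw [hJ]; simp [Matrix.mul_assoc]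
  have hss : ∀ a, (s a)⁻¹ * (s a ^ 2 * (s a)⁻¹) = (s a)⁻¹ * s a := by
    intro a
    by_cases h : s a = 0
    · simp [h]
    · field_simp
  have hJJ : J * J = J := by
    rw [hJ, conj_diagonal_mul hU]
    congr 3; ext a
    by_cases h : s a = 0
    · simp [h]
    · simp [h]
  have hRJ : R * J = R := by
    rw [hJ, hR, conj_diagonal_mul hU]
    congr 3; ext a
    by_cases h : s a = 0
    · simp [h]
    · simp [h]
  have hWW : (A * R)ᵀ * (A * R) = J := by
    rw [transpose_mul, hRt, Matrix.mul_assoc, ← Matrix.mul_assoc Aᵀ, hA, hR, conj_diagonal_mul hU,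
      conj_diagonal_mul hU, hJ]
    simp only [hss]
  have hAJ : A * J = A := by
    have h0 : matInner (A - A * J) (A - A * J) = 0 := by
      have : (A - A * J)ᵀ * (A - A * J) = (1 - J) * (Aᵀ * A) * (1 - J) := by
        rw [transpose_sub, transpose_mul, hJt]
        simp only [Matrix.sub_mul, Matrix.mul_sub, Matrix.one_mul, Matrix.mul_one,
          Matrix.mul_assoc]
      rw [matInner, this]
      have h1 : (1 - J) * (Aᵀ * A) = 0 := by
        rw [Matrix.sub_mul, Matrix.one_mul, hA, hJ, conj_diagonal_mul hU, sub_eq_zero]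
        congr 3; ext a
        by_cases h : s a = 0
        · simp [h]
        · simp [h]
      rw [h1]; simp
    rw [matInner, ← conjTranspose_eq_transpose_of_trivial,
      trace_conjTranspose_mul_self_eq_zero_iff, sub_eq_zero] at h0
    exact h0.symm
  refine ⟨A * R, ?_, ?_, ?_, ?_, ?_⟩
  · rw [matInner, transpose_mul, hRt, Matrix.mul_assoc, hA, hR, conj_diagonal_mul hU,
      trace_conj_diagonal hU, hnuc]
    refine Finset.sum_congr rfl fun a _ => ?_
    by_cases h : s a = 0
    · simp [h]
    · field_simp
  · rw [Matrix.mul_assoc, hWW, Matrix.mul_assoc, hRJ]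
  · have : A * R * (A * R)ᵀ * A = A * (R * (R * (Aᵀ * A))) := by
      rw [transpose_mul, hRt]; simp only [Matrix.mul_assoc]
    have h2 : R * (R * (Aᵀ * A)) = J := by
      rw [hA, hR, conj_diagonal_mul hU, conj_diagonal_mul hU, hJ]
      congr 3; ext a
      by_cases h : s a = 0
      · simp [h]
      · field_simp
    rw [this, h2, hAJ]
  · rw [hWW, hAJ]
  · rw [hWW, hJ, trace_conj_diagonal hU, ← rank_transpose_mul_self A, hA]
    have hunit : IsUnit U.det := by
      rw [← isUnit_iff_isUnit_det]; exact IsUnit.of_mul_eq_one _ hU'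
    have hunit' : IsUnit Uᵀ.det := by rwa [det_transpose]
    rw [rank_mul_eq_left_of_isUnit_det _ _ hunit', rank_mul_eq_right_of_isUnit_det _ _ hunit,
      rank_diagonal, Fintype.card_subtype, Finset.card_filter]
    push_cast
    refine Finset.sum_congr rfl fun a _ => ?_
    by_cases h : s a = 0
    · simp [h]
    · simp [h]

theorem dotProduct_mulVec_of_symm {n : Type*} [Fintype n] {P : Matrix n n ℝ} (hPt : Pᵀ = P)
    (x y : n → ℝ) : (P *ᵥ x) ⬝ᵥ y = x ⬝ᵥ P *ᵥ y := by
  rw [dotProduct_mulVec, ← mulVec_transpose, hPt]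

/-- Pythagoras for an orthogonal projection. -/
theorem dotProduct_projection {n : Type*} [Fintype n] [DecidableEq n] {P : Matrix n n ℝ}
    (hPt : Pᵀ = P) (hPP : P * P = P) (x : n → ℝ) :
    (P *ᵥ x) ⬝ᵥ (P *ᵥ x) + ((1 - P) *ᵥ x) ⬝ᵥ ((1 - P) *ᵥ x) = x ⬝ᵥ x := by
  have h1 : (P *ᵥ x) ⬝ᵥ (P *ᵥ x) = x ⬝ᵥ P *ᵥ x := by
    rw [dotProduct_mulVec, ← mulVec_transpose, hPt, mulVec_mulVec, hPP, dotProduct_comm]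
  rw [sub_mulVec, one_mulVec, dotProduct_sub, sub_dotProduct, sub_dotProduct, h1,
    dotProduct_comm (P *ᵥ x) x]
  ring

theorem opBound_of_partial_isometry {m n : Type*} [Fintype m] [Fintype n] [DecidableEq n]
    {W : Matrix m n ℝ} (hW : W * Wᵀ * W = W) : OpBound W 1 := by
  intro x y
  rw [one_mul]
  refine (dotProduct_le_sqrt _ _).trans ?_
  refine mul_le_mul_of_nonneg_left (Real.sqrt_le_sqrt ?_) (Real.sqrt_nonneg _)
  have h := dotProduct_projection (P := Wᵀ * W) (by simp)
    (by rw [Matrix.mul_assoc, ← Matrix.mul_assoc W, hW]) y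
  have h1 : (W *ᵥ y) ⬝ᵥ (W *ᵥ y) = ((Wᵀ * W) *ᵥ y) ⬝ᵥ ((Wᵀ * W) *ᵥ y) := by
    rw [dotProduct_mulVec ((Wᵀ * W) *ᵥ y), ← mulVec_transpose, transpose_mul, transpose_transpose,
      mulVec_mulVec, Matrix.mul_assoc, ← Matrix.mul_assoc W, hW, dotProduct_mulVec,
      ← mulVec_transpose, mulVec_mulVec]
  linarith [dotProduct_self_nonneg' ((1 - Wᵀ * W) *ᵥ y)]

theorem nuclearNorm_add_le (A B : Matrix (Fin d₁) (Fin d₂) ℝ) :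
    nuclearNorm (A + B) ≤ nuclearNorm A + nuclearNorm B := by
  obtain ⟨W, hW, hWW, -⟩ := exists_polar (A + B)
  have h := opBound_of_partial_isometry hWW
  have h1 := matInner_le_mul_nuclearNorm (A := A) h
  have h2 := matInner_le_mul_nuclearNorm (A := B) h
  rw [← hW, matInner, Matrix.mul_add, trace_add]
  rw [matInner] at h1 h2
  linarith

theorem nuclearNorm_nonneg (A : Matrix (Fin d₁) (Fin d₂) ℝ) : 0 ≤ nuclearNorm A :=
  Finset.sum_nonneg fun _ _ => LinearMap.singularValues_nonneg _ _

theorem nuclearNorm_smul_le {t : ℝ} (ht : 0 ≤ t) (A : Matrix (Fin d₁) (Fin d₂) ℝ) :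
    nuclearNorm (t • A) ≤ t * nuclearNorm A := by
  obtain ⟨W, hW, hWW, -⟩ := exists_polar (t • A)
  have h1 := matInner_le_mul_nuclearNorm (A := A) (opBound_of_partial_isometry hWW)
  rw [← hW, matInner, Matrix.mul_smul, trace_smul, smul_eq_mul]
  rw [matInner, one_mul] at h1
  exact mul_le_mul_of_nonneg_left h1 ht

/-- A contraction does not lengthen the columns of the projection, whose squared lengths add up to
its trace. Applied to polar factors, this yields the √rank in the two comparisons of nuclear and
Frobenius norms below. -/
theorem trace_projection_mul_le {m n : Type*} [Fintype m] [Fintype n] [DecidableEq m]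
    [DecidableEq n] {W : Matrix m n ℝ} (hW : OpBound Wᵀ 1)
    {P : Matrix m m ℝ} (hPt : Pᵀ = P) (hPP : P * P = P) :
    matInner (P * W) (P * W) ≤ P.trace := by
  have e1 : matInner (P * W) (P * W) = ∑ c, (Wᵀ *ᵥ P.col c) ⬝ᵥ (Wᵀ *ᵥ P.col c) := by
    have : matInner (P * W) (P * W) = ((Wᵀ * P)ᵀ * (Wᵀ * P)).trace := by
      rw [matInner, Matrix.trace_mul_comm, transpose_mul, transpose_mul, hPt, transpose_transpose]
    rw [this]; rfl
  have e2 : P.trace = ∑ c, P.col c ⬝ᵥ P.col c := by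
    have : P.trace = (Pᵀ * P).trace := by rw [hPt, hPP]
    rw [this]; rfl
  rw [e1, e2]
  refine Finset.sum_le_sum fun c _ => ?_
  have h := hW (Wᵀ *ᵥ P.col c) (P.col c)
  rw [one_mul] at h
  have h0 := dotProduct_self_nonneg' (Wᵀ *ᵥ P.col c)
  have h1 := dotProduct_self_nonneg' (P.col c)
  have h2 := Real.sqrt_nonneg ((Wᵀ *ᵥ P.col c) ⬝ᵥ (Wᵀ *ᵥ P.col c))
  have h3 := Real.sqrt_nonneg (P.col c ⬝ᵥ P.col c)
  have h4 := Real.sq_sqrt h0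
  have h5 := Real.sq_sqrt h1
  have h6 : √((Wᵀ *ᵥ P.col c) ⬝ᵥ (Wᵀ *ᵥ P.col c)) ≤ √(P.col c ⬝ᵥ P.col c) := by
    by_contra hlt
    push Not at hlt
    nlinarith
  nlinarith

/-- Pair `P * M` with its polar factor, move the projection onto that factor, and use
Cauchy-Schwarz. -/
theorem nuclearNorm_projection_left_le {P : Matrix (Fin d₁) (Fin d₁) ℝ} (hPt : Pᵀ = P)
    (hPP : P * P = P) (M : Matrix (Fin d₁) (Fin d₂) ℝ) :
    nuclearNorm (P * M) ≤ √P.trace * √(matInner M M) := by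
  obtain ⟨W, hW, hWW, -⟩ := exists_polar (P * M)
  have hWt : OpBound Wᵀ 1 := opBound_of_partial_isometry (by
    have := congrArg transpose hWW
    simpa [Matrix.mul_assoc] using this)
  have h1 := matInner_mul_mul W M P 1
  rw [Matrix.mul_one, transpose_one, Matrix.mul_one, hPt, hW] at h1
  rw [← h1]
  exact (matInner_le_sqrt _ _).trans (mul_le_mul_of_nonneg_right
    (Real.sqrt_le_sqrt (trace_projection_mul_le hWt hPt hPP)) (Real.sqrt_nonneg _))

theorem nuclearNorm_projection_right_le {Q : Matrix (Fin d₂) (Fin d₂) ℝ} (hQt : Qᵀ = Q)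
    (hQQ : Q * Q = Q) (M : Matrix (Fin d₁) (Fin d₂) ℝ) :
    nuclearNorm (M * Q) ≤ √Q.trace * √(matInner M M) := by
  obtain ⟨W, hW, hWW, -⟩ := exists_polar (M * Q)
  have hWt : OpBound Wᵀᵀ 1 := opBound_of_partial_isometry (by simpa using hWW)
  have h1 := matInner_mul_mul W M 1 Q
  rw [Matrix.one_mul, transpose_one, Matrix.one_mul, hQt, hW] at h1
  have h2 : matInner (W * Q) (W * Q) = matInner (Q * Wᵀ) (Q * Wᵀ) := by
    rw [matInner, matInner, Matrix.trace_mul_comm, transpose_mul, transpose_mul, hQt,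
      transpose_transpose]
  rw [← h1]
  refine (matInner_le_sqrt _ _).trans (mul_le_mul_of_nonneg_right
    (Real.sqrt_le_sqrt ?_) (Real.sqrt_nonneg _))
  rw [h2]
  exact trace_projection_mul_le hWt hQt hQQ

theorem matInner_projection_le {m n : Type*} [Fintype m] [Fintype n] [DecidableEq m]
    {P : Matrix m m ℝ} (hPt : Pᵀ = P) (hPP : P * P = P) (M : Matrix m n ℝ) :
    matInner ((1 - P) * M) ((1 - P) * M) ≤ matInner M M := by
  have key : ∀ B : Matrix m n ℝ, matInner B B = ∑ c, B.col c ⬝ᵥ B.col c := fun B => rfl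
  rw [key, key]
  refine Finset.sum_le_sum fun c _ => ?_
  have h := dotProduct_projection hPt hPP (M.col c)
  have h1 := dotProduct_self_nonneg' (P *ᵥ M.col c)
  have h2 : ((1 - P) * M).col c = (1 - P) *ᵥ M.col c := rfl
  rw [h2]; linarith

/-- Decomposability of the nuclear norm at a matrix of small rank. -/
theorem nuclearNorm_decomposable {T : Matrix (Fin d₁) (Fin d₂) ℝ} {r : ℕ} (hr : T.rank ≤ r)
    (Δ : Matrix (Fin d₁) (Fin d₂) ℝ) :
    ∃ ν, 0 ≤ ν ∧ nuclearNorm T - nuclearNorm (T + Δ) ≤ √r * frobNorm Δ - ν ∧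
      nuclearNorm Δ ≤ 2 * (√r * frobNorm Δ) + ν := by
  obtain ⟨W, hW, hWW, hPT, hTQ, htr⟩ := exists_polar T
  set P := W * Wᵀ with hP
  set Q := Wᵀ * W with hQ
  have hPt : Pᵀ = P := by simp [hP]
  have hQt : Qᵀ = Q := by simp [hQ]
  have hPP : P * P = P := by rw [hP, ← Matrix.mul_assoc, ← hP, hWW]
  have hQQ : Q * Q = Q := by rw [hQ, Matrix.mul_assoc, ← Matrix.mul_assoc W, ← hP, hWW]
  have hPW : P * W = W := hWW
  have hWQ : W * Q = W := by rw [hQ, ← Matrix.mul_assoc, ← hP, hWW]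
  have htrQ : Q.trace ≤ r := by rw [htr]; exact_mod_cast hr
  have htrP : P.trace ≤ r := by rw [hP, Matrix.trace_mul_comm, ← hQ]; exact htrQ
  have hP1t : (1 - P)ᵀ = 1 - P := by rw [transpose_sub, transpose_one, hPt]
  have hQ1t : (1 - Q)ᵀ = 1 - Q := by rw [transpose_sub, transpose_one, hQt]
  -- The part of Δ whose row and column spaces are orthogonal to those of `T`; its nuclear norm is
  -- the witness ν.
  set Δ₂ := (1 - P) * Δ * (1 - Q) with hΔ₂
  obtain ⟨W₂, hW₂, hWW₂, -⟩ := exists_polar Δ₂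
  have hb₁ := opBound_of_partial_isometry (hP ▸ hWW : W * Wᵀ * W = W)
  have hb₂ := opBound_of_partial_isometry hWW₂
  -- The two summands act between orthogonal pairs of subspaces, so their sum is still a
  -- contraction. Tested against `T + Δ`, it certifies the lower bound for the nuclear norm of `T +
  -- Δ`.
  have hb : OpBound (W + (1 - P) * W₂ * (1 - Q)) 1 := by
    intro x y
    have e1 : x ⬝ᵥ W *ᵥ y = (P *ᵥ x) ⬝ᵥ W *ᵥ (Q *ᵥ y) := by
      rw [mulVec_mulVec, hWQ, dotProduct_mulVec_of_symm hPt, mulVec_mulVec, hPW]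
    have e2 : x ⬝ᵥ ((1 - P) * W₂ * (1 - Q)) *ᵥ y =
        ((1 - P) *ᵥ x) ⬝ᵥ W₂ *ᵥ ((1 - Q) *ᵥ y) := by
      rw [mulVec_mulVec, dotProduct_mulVec_of_symm hP1t, mulVec_mulVec, ← Matrix.mul_assoc]
    rw [add_mulVec, dotProduct_add, e1, e2, one_mul]
    refine (add_le_add (hb₁ _ _) (hb₂ _ _)).trans ?_
    rw [one_mul, one_mul, ← dotProduct_projection hPt hPP x, ← dotProduct_projection hQt hQQ y]
    set a := (P *ᵥ x) ⬝ᵥ (P *ᵥ x)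
    set b := ((1 - P) *ᵥ x) ⬝ᵥ ((1 - P) *ᵥ x)
    set c := (Q *ᵥ y) ⬝ᵥ (Q *ᵥ y)
    set e := ((1 - Q) *ᵥ y) ⬝ᵥ ((1 - Q) *ᵥ y)
    have ha : 0 ≤ a := dotProduct_self_nonneg' _
    have hb : 0 ≤ b := dotProduct_self_nonneg' _
    have hc : 0 ≤ c := dotProduct_self_nonneg' _
    have he : 0 ≤ e := dotProduct_self_nonneg' _
    rw [← Real.sqrt_mul (add_nonneg ha hb)]
    refine Real.le_sqrt_of_sq_le ?_
    have h1 := Real.sq_sqrt ha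
    have h2 := Real.sq_sqrt hb
    have h3 := Real.sq_sqrt hc
    have h4 := Real.sq_sqrt he
    calc (√a * √c + √b * √e) ^ 2 ≤ (√a ^ 2 + √b ^ 2) * (√c ^ 2 + √e ^ 2) := by
          nlinarith [sq_nonneg (√a * √e - √b * √c)]
      _ = _ := by rw [h1, h2, h3, h4]
  have hdual := matInner_le_mul_nuclearNorm (A := T + Δ) hb
  have hexp : matInner (W + (1 - P) * W₂ * (1 - Q)) (T + Δ) =
      nuclearNorm T + matInner W Δ + nuclearNorm Δ₂ := by
    have h1 : matInner ((1 - P) * W₂ * (1 - Q)) T = 0 := by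
      rw [matInner_mul_mul, hP1t, hQ1t]
      have : (1 - P) * T = 0 := by rw [Matrix.sub_mul, Matrix.one_mul, hPT, sub_self]
      rw [this, matInner]; simp
    have h2 : matInner ((1 - P) * W₂ * (1 - Q)) Δ = nuclearNorm Δ₂ := by
      rw [matInner_mul_mul, hP1t, hQ1t, ← hW₂]
    rw [← h2, ← hW]
    have h3 : matInner (W + (1 - P) * W₂ * (1 - Q)) (T + Δ) = matInner W T + matInner W Δ +
        (matInner ((1 - P) * W₂ * (1 - Q)) T + matInner ((1 - P) * W₂ * (1 - Q)) Δ) := by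
      simp only [matInner, transpose_add, Matrix.add_mul, Matrix.mul_add, trace_add]; ring
    rw [h3, h1]; ring
  have hWΔ : -(√r * frobNorm Δ) ≤ matInner W Δ := by
    have h1 := matInner_le_sqrt W (-Δ)
    have h2 : matInner W (-Δ) = -matInner W Δ := by simp [matInner]
    have h3 : matInner (-Δ) (-Δ) = matInner Δ Δ := by simp [matInner]
    rw [h2, h3, ← frobNorm_eq Δ] at h1
    have h4 : √(matInner W W) * frobNorm Δ ≤ √r * frobNorm Δ := by
      refine mul_le_mul_of_nonneg_right (Real.sqrt_le_sqrt htrQ) ?_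
      rw [frobNorm_eq]; exact Real.sqrt_nonneg _
    linarith
  have hr0 : √P.trace * √(matInner Δ Δ) ≤ √r * frobNorm Δ := by
    rw [frobNorm_eq]
    exact mul_le_mul_of_nonneg_right (Real.sqrt_le_sqrt htrP) (Real.sqrt_nonneg _)
  have hr1 : √Q.trace * √(matInner ((1 - P) * Δ) ((1 - P) * Δ)) ≤ √r * frobNorm Δ := by
    rw [frobNorm_eq]
    exact mul_le_mul (Real.sqrt_le_sqrt htrQ)
      (Real.sqrt_le_sqrt (matInner_projection_le hPt hPP Δ)) (Real.sqrt_nonneg _)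
      (Real.sqrt_nonneg _)
  refine ⟨nuclearNorm Δ₂, nuclearNorm_nonneg _, ?_, ?_⟩
  · rw [hexp, one_mul] at hdual
    linarith
  · have e : Δ = P * Δ + ((1 - P) * Δ * Q + Δ₂) := by
      rw [hΔ₂]
      simp only [Matrix.sub_mul, Matrix.mul_sub, Matrix.one_mul, Matrix.mul_one, Matrix.mul_assoc]
      abel
    have h1 := nuclearNorm_add_le (P * Δ) ((1 - P) * Δ * Q + Δ₂)
    have h2 := nuclearNorm_add_le ((1 - P) * Δ * Q) Δ₂
    have h3 := (nuclearNorm_projection_left_le hPt hPP Δ).trans hr0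
    have h4 := (nuclearNorm_projection_right_le hQt hQQ ((1 - P) * Δ)).trans hr1
    rw [← e] at h1
    linarith

end Nuclear
end KWise

namespace KWise
open Matrix

/-! ### Strong convexity of log-sum-exp. -/

section LogSumExp
variable {ι : Type*}

/-- Quantitative strong convexity of the log-sum-exp function on a cube. -/
theorem logSumExp_lower {s : Finset ι} (hs : s.Nonempty) {θ δ : ι → ℝ} {α B : ℝ}
    (hθ : ∀ m ∈ s, |θ m| ≤ α) (hθδ : ∀ m ∈ s, |θ m + δ m| ≤ α)
    (hB : ∀ c, B ≤ ∑ m ∈ s, (δ m - c) ^ 2) :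
    Real.log (∑ m ∈ s, Real.exp (θ m)) +
        ∑ m ∈ s, Real.exp (θ m) / (∑ m' ∈ s, Real.exp (θ m')) * δ m +
        Real.exp (-(2 * α)) / s.card * B / 2 ≤
      Real.log (∑ m ∈ s, Real.exp (θ m + δ m)) := by
  set c₀ := Real.exp (-(2 * α)) / s.card * B with hc₀
  set Z : ℝ → ℝ := fun t => ∑ m ∈ s, Real.exp (θ m + t * δ m) with hZ
  set Y : ℝ → ℝ := fun t => ∑ m ∈ s, Real.exp (θ m + t * δ m) * δ m with hY
  have hZpos : ∀ t, 0 < Z t := fun t => Finset.sum_pos (fun _ _ => Real.exp_pos _) hs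
  have hexp : ∀ m t, HasDerivAt (fun t => Real.exp (θ m + t * δ m))
      (Real.exp (θ m + t * δ m) * δ m) t := by
    intro m t
    have h0 : HasDerivAt (fun t => θ m + t * δ m) (1 * δ m) t :=
      ((hasDerivAt_id t).mul_const (δ m)).const_add (θ m)
    simpa using h0.exp
  have hZ' : ∀ t, HasDerivAt Z (Y t) t := fun t => HasDerivAt.fun_sum fun m _ => hexp m t
  have hY' : ∀ t, HasDerivAt Y (∑ m ∈ s, Real.exp (θ m + t * δ m) * δ m * δ m) t := fun t =>
    HasDerivAt.fun_sum fun m _ => (hexp m t).mul_const (δ m)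
  have hM' : ∀ t, HasDerivAt (fun t => Y t / Z t)
      (((∑ m ∈ s, Real.exp (θ m + t * δ m) * δ m * δ m) * Z t - Y t * Y t) / Z t ^ 2) t :=
    fun t => (hY' t).div (hZ' t) (hZpos t).ne'
  -- The second derivative along the segment is the softmax variance of δ. All utilities stay in
  -- [-α, α], so every probability is at least e^{-2α}/|s|, and `hB` bounds the sum of squares about
  -- any centre.
  have hcurv : ∀ t ∈ Set.Icc (0 : ℝ) 1, c₀ ≤
      ((∑ m ∈ s, Real.exp (θ m + t * δ m) * δ m * δ m) * Z t - Y t * Y t) / Z t ^ 2 := by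
    intro t ht
    have hbd : ∀ m ∈ s, |θ m + t * δ m| ≤ α := by
      intro m hm
      have h1 := abs_le.1 (hθ m hm)
      have h2 := abs_le.1 (hθδ m hm)
      rw [abs_le]
      constructor <;> nlinarith [ht.1, ht.2]
    have hp : ∀ m ∈ s, Real.exp (-(2 * α)) / s.card ≤ Real.exp (θ m + t * δ m) / Z t := by
      intro m hm
      have hcard : (0 : ℝ) < s.card := by exact_mod_cast hs.card_pos
      rw [div_le_div_iff₀ hcard (hZpos t)]
      have h1 : Z t ≤ s.card * Real.exp α := by
        rw [← nsmul_eq_mul]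
        exact Finset.sum_le_card_nsmul _ _ _ fun m hm =>
          Real.exp_le_exp.2 (abs_le.1 (hbd m hm)).2
      have h2 : Real.exp (-α) ≤ Real.exp (θ m + t * δ m) :=
        Real.exp_le_exp.2 (abs_le.1 (hbd m hm)).1
      have h3 : Real.exp (-(2 * α)) * Real.exp α = Real.exp (-α) := by
        rw [← Real.exp_add]; congr 1; ring
      calc Real.exp (-(2 * α)) * Z t ≤ Real.exp (-(2 * α)) * (s.card * Real.exp α) :=
            mul_le_mul_of_nonneg_left h1 (Real.exp_pos _).le
        _ = Real.exp (-α) * s.card := by rw [← h3]; ring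
        _ ≤ _ := mul_le_mul_of_nonneg_right h2 hcard.le
    have hvar : ((∑ m ∈ s, Real.exp (θ m + t * δ m) * δ m * δ m) * Z t - Y t * Y t) / Z t ^ 2 =
        ∑ m ∈ s, Real.exp (θ m + t * δ m) / Z t * (δ m - Y t / Z t) ^ 2 := by
      have e1 : ∑ m ∈ s, Real.exp (θ m + t * δ m) / Z t * (δ m - Y t / Z t) ^ 2 =
          (∑ m ∈ s, Real.exp (θ m + t * δ m) * δ m * δ m) / Z t -
          2 * (Y t / Z t) * (Y t / Z t) + (Y t / Z t) ^ 2 * (Z t / Z t) := by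
        have e3 : Y t = ∑ m ∈ s, Real.exp (θ m + t * δ m) * δ m := rfl
        have e4 : Z t = ∑ m ∈ s, Real.exp (θ m + t * δ m) := rfl
        have e5 : ∀ m, Real.exp (θ m + t * δ m) / Z t * (δ m - Y t / Z t) ^ 2 =
          (Real.exp (θ m + t * δ m) * δ m * δ m) / Z t -
          2 * (Y t / Z t) * ((Real.exp (θ m + t * δ m) * δ m) / Z t) +
          (Y t / Z t) ^ 2 * (Real.exp (θ m + t * δ m) / Z t) := fun m => by ring
        rw [Finset.sum_congr rfl fun m _ => e5 m, Finset.sum_add_distrib, Finset.sum_sub_distrib,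
          ← Finset.sum_div, ← Finset.mul_sum, ← Finset.mul_sum, ← Finset.sum_div, ← Finset.sum_div,
          ← e3, ← e4]
      rw [e1, div_self (hZpos t).ne']
      have := (hZpos t).ne'
      field_simp; ring
    rw [hvar]
    have h1 : Real.exp (-(2 * α)) / s.card * ∑ m ∈ s, (δ m - Y t / Z t) ^ 2 ≤
        ∑ m ∈ s, Real.exp (θ m + t * δ m) / Z t * (δ m - Y t / Z t) ^ 2 := by
      rw [Finset.mul_sum]
      exact Finset.sum_le_sum fun m hm => mul_le_mul_of_nonneg_right (hp m hm) (sq_nonneg _)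
    refine le_trans ?_ h1
    exact mul_le_mul_of_nonneg_left (hB _) (by positivity)
  have hmono1 : MonotoneOn (fun t => Y t / Z t - c₀ * t) (Set.Icc 0 1) := by
    have hd : ∀ t, HasDerivAt (fun t => Y t / Z t - c₀ * t) _ t := fun t =>
      (hM' t).sub ((hasDerivAt_id t).const_mul c₀)
    refine monotoneOn_of_deriv_nonneg (convex_Icc 0 1)
      (fun t _ => (hd t).continuousAt.continuousWithinAt)
      (fun t _ => (hd t).differentiableAt.differentiableWithinAt) fun t ht => ?_
    rw [(hd t).deriv, mul_one, sub_nonneg]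
    exact hcurv t (interior_subset ht)
  -- Second integration: the first one bounds the growth of the slope, this one yields the quadratic
  -- Taylor remainder c₀ t²/2.
  have hmono2 : MonotoneOn (fun t => Real.log (Z t) - (Y 0 / Z 0) * t - c₀ * t ^ 2 / 2)
      (Set.Icc 0 1) := by
    have hd : ∀ t, HasDerivAt (fun t => Real.log (Z t) - (Y 0 / Z 0) * t - c₀ * t ^ 2 / 2)
        (Y t / Z t - Y 0 / Z 0 - c₀ * t) t := by
      intro t
      have h1 := (hZ' t).log (hZpos t).ne'
      have h2 := (hasDerivAt_id t).const_mul (Y 0 / Z 0)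
      have h3 := (((hasDerivAt_id t).pow 2).const_mul c₀).div_const 2
      refine ((h1.sub h2).sub h3).congr_deriv ?_
      simp; ring
    refine monotoneOn_of_deriv_nonneg (convex_Icc 0 1)
      (fun t _ => (hd t).continuousAt.continuousWithinAt)
      (fun t _ => (hd t).differentiableAt.differentiableWithinAt) fun t ht => ?_
    have ht' := interior_subset ht
    rw [(hd t).deriv]
    have := hmono1 (Set.left_mem_Icc.2 zero_le_one) ht' ht'.1
    simp only [mul_zero, sub_zero] at this
    linarith
  have h := hmono2 (Set.left_mem_Icc.2 zero_le_one) (Set.right_mem_Icc.2 zero_le_one) zero_le_one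
  simp only [mul_zero, sub_zero, mul_one, one_pow, ne_eq, OfNat.ofNat_ne_zero, not_false_eq_true,
    zero_pow, zero_div] at h
  have e0 : Z 0 = ∑ m ∈ s, Real.exp (θ m) := by simp [hZ]
  have e1 : Z 1 = ∑ m ∈ s, Real.exp (θ m + δ m) := by simp [hZ]
  have e2 : Y 0 / Z 0 = ∑ m ∈ s, Real.exp (θ m) / (∑ m' ∈ s, Real.exp (θ m')) * δ m := by
    rw [e0, hY]
    simp only [zero_mul, add_zero]
    rw [Finset.sum_div]
    exact Finset.sum_congr rfl fun m _ => by ring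
  rw [e2, e0, e1] at h
  linarith

end LogSumExp

/-! ### Curvature of the likelihood and the deterministic error bound. -/

section Likelihood
variable {d₁ d₂ k : ℕ}

/-- The first slot of the `p`-th pair. -/
def pairFst (k : ℕ) (p : Fin (k / 2)) : Fin k := ⟨p, by omega⟩

/-- The second slot of the `p`-th pair. -/
def pairSnd (k : ℕ) (p : Fin (k / 2)) : Fin k := ⟨k / 2 + p, by omega⟩

/-- The sum of the squared differences over the pairs of slots contained in `S`. -/
noncomputable def pairEnergy (S : Finset (Fin k)) (δ : Fin k → ℝ) : ℝ :=
  ∑ p, if pairFst k p ∈ S ∧ pairSnd k p ∈ S then (δ (pairFst k p) - δ (pairSnd k p)) ^ 2 else 0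

theorem sum_pairs_le (f : Fin k → ℝ) (hf : ∀ m, 0 ≤ f m) :
    ∑ p, (f (pairFst k p) + f (pairSnd k p)) ≤ ∑ m, f m := by
  have hinj : Function.Injective
      (Sum.elim (pairFst k) (pairSnd k) : Fin (k / 2) ⊕ Fin (k / 2) → Fin k) := by
    rintro (a | a) (b | b) h <;> simp [pairFst, pairSnd, Fin.ext_iff] at h ⊢ <;> omega
  rw [Finset.sum_add_distrib]
  have h := Finset.sum_le_univ_sum_of_nonneg (s := Finset.univ.map ⟨_, hinj⟩) hf
  rw [Finset.sum_map, Fintype.sum_sum_type] at h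
  exact h

theorem pairEnergy_nonneg (S : Finset (Fin k)) (δ : Fin k → ℝ) : 0 ≤ pairEnergy S δ :=
  Finset.sum_nonneg fun p _ => by split_ifs <;> positivity

theorem pairEnergy_mono {S S' : Finset (Fin k)} (h : S ⊆ S') (δ : Fin k → ℝ) :
    pairEnergy S δ ≤ pairEnergy S' δ := by
  refine Finset.sum_le_sum fun p _ => ?_
  by_cases h1 : pairFst k p ∈ S ∧ pairSnd k p ∈ S
  · rw [if_pos h1, if_pos ⟨h h1.1, h h1.2⟩]
  · rw [if_neg h1]; split_ifs <;> positivity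

theorem pairEnergy_smul (S : Finset (Fin k)) (t : ℝ) (δ : Fin k → ℝ) :
    pairEnergy S (fun m => t * δ m) = t ^ 2 * pairEnergy S δ := by
  rw [pairEnergy, pairEnergy, Finset.mul_sum]
  refine Finset.sum_congr rfl fun p _ => ?_
  split_ifs
  · ring
  · simp

/-- For each pair (a - b)² ≤ 2(a - c)² + 2(b - c)², and the pairs are disjoint. -/
theorem pairEnergy_le_sum_sq (S : Finset (Fin k)) (δ : Fin k → ℝ) (c : ℝ) :
    pairEnergy S δ / 2 ≤ ∑ m ∈ S, (δ m - c) ^ 2 := by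
  have h := sum_pairs_le (fun m => if m ∈ S then (δ m - c) ^ 2 else 0)
    (fun m => by split_ifs <;> positivity)
  rw [← Finset.sum_filter, Finset.filter_mem_eq_inter, Finset.univ_inter] at h
  refine le_trans ?_ h
  rw [pairEnergy, Finset.sum_div]
  refine Finset.sum_le_sum fun p _ => ?_
  split_ifs with h1 h2 h3 h2 h2 h3 <;> first | tauto | skip
  · nlinarith [sq_nonneg (δ (pairFst k p) - c + (δ (pairSnd k p) - c))]
  all_goals nlinarith [sq_nonneg (δ (pairFst k p) - c), sq_nonneg (δ (pairSnd k p) - c)]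

/-- The score of one user. -/
noncomputable def scoreRow (θ : Fin d₂ → ℝ) (x : UserData d₂ k) : Fin d₂ → ℝ :=
  mnlResidual (fun m => θ (x.1 m)) (fun m => (Pi.single (x.1 m) 1 : Fin d₂ → ℝ)) x.2

/-- The matrix of all scores. -/
noncomputable def scoreMat (Θ : Matrix (Fin d₁) (Fin d₂) ℝ) (x : Fin d₁ → UserData d₂ k) :
    Matrix (Fin d₁) (Fin d₂) ℝ := Matrix.of fun i => scoreRow (Θ i) (x i)

theorem scoreRow_dotProduct (θ w : Fin d₂ → ℝ) (x : UserData d₂ k) :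
    scoreRow θ x ⬝ᵥ w = mnlResidual (fun m => θ (x.1 m)) (fun m => w (x.1 m)) x.2 := by
  rw [scoreRow, mnlResidual, mnlResidual, sum_dotProduct]
  refine Finset.sum_congr rfl fun ℓ _ => ?_
  rw [sub_dotProduct, sum_dotProduct, single_dotProduct, one_mul]
  congr 1
  refine Finset.sum_congr rfl fun m _ => ?_
  rw [smul_dotProduct, single_dotProduct, one_mul]

theorem matInner_scoreMat (Θ Δ : Matrix (Fin d₁) (Fin d₂) ℝ) (x : Fin d₁ → UserData d₂ k) :
    matInner (scoreMat Θ x) Δ =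
      ∑ i, mnlResidual (fun m => Θ i ((x i).1 m)) (fun m => Δ i ((x i).1 m)) (x i).2 := by
  rw [matInner_eq_sum]
  exact Finset.sum_congr rfl fun i _ => scoreRow_dotProduct (Θ i) (Δ i) (x i)

/-- At each of the first `L` stages the alternatives still present contain those left after `L`
choices, so a single energy serves all these stages; at later stages plain convexity is used. The 4
collects the 1/2 of Taylor's formula and the 1/2 lost in passing to pairs. -/
theorem logLik_user_lower {α : ℝ} {θ δ : Fin k → ℝ} (hθ : ∀ m, |θ m| ≤ α)
    (hθδ : ∀ m, |θ m + δ m| ≤ α) (σ : Equiv.Perm (Fin k)) {L : ℕ} (hL : L ≤ k) :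
    ∑ ℓ, (θ (σ ℓ) + δ (σ ℓ) - Real.log (∑ m ∈ Finset.Ici ℓ, Real.exp (θ (σ m) + δ (σ m)))) +
        L * (Real.exp (-(2 * α)) / (4 * k) * pairEnergy (survivors σ L) δ) ≤
      ∑ ℓ, (θ (σ ℓ) - Real.log (∑ m ∈ Finset.Ici ℓ, Real.exp (θ (σ m)))) +
        mnlResidual θ δ σ := by
  have hstep : ∀ ℓ : Fin k,
      (θ (σ ℓ) + δ (σ ℓ) - Real.log (∑ m ∈ Finset.Ici ℓ, Real.exp (θ (σ m) + δ (σ m)))) +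
        (if (ℓ : ℕ) < L then Real.exp (-(2 * α)) / (4 * k) * pairEnergy (survivors σ L) δ else 0) ≤
      (θ (σ ℓ) - Real.log (∑ m ∈ Finset.Ici ℓ, Real.exp (θ (σ m)))) +
        (δ (σ ℓ) - ∑ m ∈ Finset.Ici ℓ,
          (Real.exp (θ (σ m)) / ∑ m' ∈ Finset.Ici ℓ, Real.exp (θ (σ m'))) • δ (σ m)) := by
    intro ℓ
    have hne : (Finset.Ici ℓ).Nonempty := ⟨ℓ, Finset.mem_Ici.2 le_rfl⟩
    have hcard : ((Finset.Ici ℓ).card : ℝ) ≤ k := by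
      exact_mod_cast (Finset.card_le_univ _).trans (by simp)
    have hcard0 : (0 : ℝ) < (Finset.Ici ℓ).card := by exact_mod_cast hne.card_pos
    have hE := pairEnergy_nonneg (survivors σ L) δ
    have h := logSumExp_lower hne (θ := fun m => θ (σ m)) (δ := fun m => δ (σ m)) (α := α)
      (B := if (ℓ : ℕ) < L then pairEnergy (survivors σ L) δ / 2 else 0)
      (fun m _ => hθ _) (fun m _ => hθδ _) (by
        intro c
        split_ifs with hℓ
        · refine (pairEnergy_le_sum_sq _ _ c).trans ?_
          rw [← Finset.sum_image (s := Finset.Ici ℓ) (g := σ) (f := fun m => (δ m - c) ^ 2)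
            fun a _ b _ hab => σ.injective hab]
          refine Finset.sum_le_sum_of_subset_of_nonneg ?_ fun _ _ _ => sq_nonneg _
          refine Finset.image_subset_image fun m hm => ?_
          have := (Finset.mem_filter.1 hm).2
          rw [Finset.mem_Ici, Fin.le_def]; omega
        · exact Finset.sum_nonneg fun _ _ => sq_nonneg _)
    have h2 : (if (ℓ : ℕ) < L then Real.exp (-(2 * α)) / (4 * k) * pairEnergy (survivors σ L) δ
        else 0) ≤ Real.exp (-(2 * α)) / (Finset.Ici ℓ).card *
        (if (ℓ : ℕ) < L then pairEnergy (survivors σ L) δ / 2 else 0) / 2 := by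
      split_ifs
      · have : Real.exp (-(2 * α)) / k ≤ Real.exp (-(2 * α)) / (Finset.Ici ℓ).card :=
          div_le_div_of_nonneg_left (Real.exp_pos _).le hcard0 hcard
        have h3 := mul_le_mul_of_nonneg_right this hE
        have e : Real.exp (-(2 * α)) / (4 * k) * pairEnergy (survivors σ L) δ =
          Real.exp (-(2 * α)) / k * pairEnergy (survivors σ L) δ / 4 := by
          rw [mul_comm 4 (k : ℝ), ← div_div]; ring
        rw [e]; linarith
      · simp
    simp only [smul_eq_mul]
    linarith
  have h := Finset.sum_le_sum fun ℓ (_ : ℓ ∈ Finset.univ) => hstep ℓ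
  rw [Finset.sum_add_distrib, Finset.sum_add_distrib] at h
  have e : ∑ ℓ : Fin k, (if (ℓ : ℕ) < L then
      Real.exp (-(2 * α)) / (4 * k) * pairEnergy (survivors σ L) δ else 0) =
      L * (Real.exp (-(2 * α)) / (4 * k) * pairEnergy (survivors σ L) δ) := by
    rw [← Finset.sum_filter, Finset.sum_const, nsmul_eq_mul]
    congr 2
    rw [Fin.card_filter_val_lt]
    exact min_eq_right hL
  rw [e] at h
  exact h

/-- Lower bound of the Bregman divergence of the negative log likelihood. -/
theorem negLogLik_lower {α : ℝ} {Θ Δ : Matrix (Fin d₁) (Fin d₂) ℝ} (hΘ : ∀ i j, |Θ i j| ≤ α)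
    (hΘΔ : ∀ i j, |(Θ + Δ) i j| ≤ α) (x : Fin d₁ → UserData d₂ k) {L : ℕ} (hL : L ≤ k) :
    negLogLik x Θ - 1 / (k * d₁) * matInner (scoreMat Θ x) Δ +
        1 / (k * d₁) * (L * (Real.exp (-(2 * α)) / (4 * k)) *
          ∑ i, pairEnergy (survivors (x i).2 L) (fun m => Δ i ((x i).1 m))) ≤
      negLogLik x (Θ + Δ) := by
  have h := Finset.sum_le_sum fun i (_ : i ∈ Finset.univ) =>
    logLik_user_lower (θ := fun m => Θ i ((x i).1 m)) (δ := fun m => Δ i ((x i).1 m))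
      (fun m => hΘ _ _) (fun m => hΘΔ _ _) (x i).2 hL
  rw [Finset.sum_add_distrib, Finset.sum_add_distrib, ← matInner_scoreMat] at h
  have e : ∑ i, L * (Real.exp (-(2 * α)) / (4 * k) *
      pairEnergy (survivors (x i).2 L) (fun m => Δ i ((x i).1 m))) =
      L * (Real.exp (-(2 * α)) / (4 * k)) *
        ∑ i, pairEnergy (survivors (x i).2 L) (fun m => Δ i ((x i).1 m)) := by
    rw [Finset.mul_sum]; exact Finset.sum_congr rfl fun i _ => by ring
  rw [e] at h
  have hc : (0 : ℝ) ≤ 1 / (k * d₁) := by positivity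
  have h2 := mul_le_mul_of_nonneg_left h hc
  rw [negLogLik, negLogLik]
  simp only [UserData.choice, Matrix.add_apply]
  rw [mul_add, mul_add] at h2
  linarith

/-- A row of zero sum has mean zero, so an entry is the average of its differences with the entries
of its row. This makes the truth feasible. -/
theorem abs_le_dynamicRange {Θ : Matrix (Fin d₁) (Fin d₂) ℝ} [NeZero d₂]
    (hrow : ∀ i, ∑ j, Θ i j = 0) (i : Fin d₁) (j : Fin d₂) : |Θ i j| ≤ dynamicRange Θ := by
  have h1 : ∀ j', |Θ i j - Θ i j'| ≤ dynamicRange Θ := fun j' =>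
    le_ciSup (f := fun q : Fin d₁ × Fin d₂ × Fin d₂ => |Θ q.1 q.2.1 - Θ q.1 q.2.2|)
      (Set.finite_range _).bddAbove (i, j, j')
  have hd : (0 : ℝ) < d₂ := by exact_mod_cast Nat.pos_of_ne_zero (NeZero.ne d₂)
  have h2 : d₂ * Θ i j = ∑ j', (Θ i j - Θ i j') := by
    rw [Finset.sum_sub_distrib, hrow]; simp
  have h3 : |(d₂ : ℝ) * Θ i j| ≤ d₂ * dynamicRange Θ := by
    rw [h2]
    refine (Finset.abs_sum_le_sum_abs _ _).trans ?_
    refine (Finset.sum_le_sum fun j' _ => h1 j').trans ?_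
    simp
  rw [abs_mul, abs_of_pos hd] at h3
  exact le_of_mul_le_mul_left h3 hd

/-- On the event that the score is small and the pair energy is large on a suitable slice, every
estimate is close to the truth. -/
theorem frobNorm_le_of_events {α lam g F₀ u c : ℝ} {r L : ℕ}
    {Θ Θhat : Matrix (Fin d₁) (Fin d₂) ℝ} (hΘ : Θ ∈ feasible d₁ d₂ α) (hr : Θ.rank ≤ r)
    {x : Fin d₁ → UserData d₂ k} (hx : IsEstimate α lam x Θhat) (hL : L ≤ k)
    (hlam : 0 < lam) (hg : OpBound (scoreMat Θ x) g) (hglam : 1 / (k * d₁) * g ≤ lam / 2)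
    (hF₀ : 0 < F₀)
    (hE : ∀ Δ : Matrix (Fin d₁) (Fin d₂) ℝ, (∀ i j, |Δ i j| ≤ 2 * α) → (∀ i, ∑ j, Δ i j = 0) →
      frobNorm Δ = F₀ → nuclearNorm Δ ≤ 6 * (√r * F₀) →
      u ≤ ∑ i, pairEnergy (survivors (x i).2 L) (fun m => Δ i ((x i).1 m)))
    (hc : c = 1 / (k * d₁) * (L * (Real.exp (-(2 * α)) / (4 * k)))) (hc0 : 0 ≤ c)
    (hbig : 2 * lam * √r * F₀ < c * u) : frobNorm (Θhat - Θ) ≤ F₀ := by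
  by_contra hlt
  push Not at hlt
  set Δ := Θhat - Θ with hΔ
  set F := frobNorm Δ with hF
  have hFpos : 0 < F := hF₀.trans hlt
  have hadd : Θ + Δ = Θhat := by rw [hΔ]; abel
  obtain ⟨ν, hν0, hν1, hν2⟩ := nuclearNorm_decomposable hr Δ
  have hlow := negLogLik_lower hΘ.1 (by rw [hadd]; exact hx.1.1) x hL (Δ := Δ)
  have hmin := hx.2 hΘ
  simp only [Set.mem_ofPred_eq] at hmin
  rw [hadd] at hlow hν1
  have hdual := matInner_le_mul_nuclearNorm (A := Δ) hg
  have hkd : (0 : ℝ) ≤ 1 / (k * d₁) := by positivity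
  have h1 := mul_le_mul_of_nonneg_left hdual hkd
  have h2 : 1 / (k * d₁) * (g * nuclearNorm Δ) ≤ lam / 2 * nuclearNorm Δ := by
    rw [← mul_assoc]; exact mul_le_mul_of_nonneg_right hglam (nuclearNorm_nonneg _)
  have h3 := mul_le_mul_of_nonneg_left hν1 hlam.le
  have h4 := mul_le_mul_of_nonneg_left hν2 (by linarith : (0 : ℝ) ≤ lam / 2)
  set e := ∑ i, pairEnergy (survivors (x i).2 L) (fun m => Δ i ((x i).1 m)) with he
  rw [← mul_assoc, ← hc] at hlow
  -- The score term gives λ/2 · (2√r F + ν) and the penalties give λ(√r F - ν). The remaining -λν/2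
  -- forces ν ≤ 4√r F, hence the cone constant 6.
  have hmain : c * e ≤ 2 * lam * (√r * F) - lam / 2 * ν := by linarith
  have he0 : 0 ≤ e := Finset.sum_nonneg fun i _ => pairEnergy_nonneg _ _
  have hνF : ν ≤ 4 * (√r * F) := by
    have h5 : 0 ≤ c * e := mul_nonneg hc0 he0
    have : lam * ν ≤ lam * (4 * (√r * F)) := by linarith
    exact le_of_mul_le_mul_left this hlam
  -- Scaling by t ≤ 1 reaches the slice and keeps the entrywise, row-sum and cone constraints.
  set t := F₀ / F with ht
  have ht0 : 0 < t := div_pos hF₀ hFpos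
  have ht1 : t ≤ 1 := (div_le_one hFpos).2 hlt.le
  have htF : t * F = F₀ := div_mul_cancel₀ _ hFpos.ne'
  have hlower := hE (t • Δ) (fun i j => by
      rw [Matrix.smul_apply, smul_eq_mul, abs_mul, abs_of_pos ht0]
      have h5 : |Δ i j| ≤ 2 * α := by
        rw [hΔ, Matrix.sub_apply]
        have h6 := hΘ.1 i j
        have h7 := hx.1.1 i j
        rw [abs_le] at h6 h7 ⊢
        constructor <;> linarith
      exact (mul_le_of_le_one_left (abs_nonneg _) ht1).trans h5)
    (fun i => by
      simp only [Matrix.smul_apply, smul_eq_mul, ← Finset.mul_sum, hΔ, Matrix.sub_apply,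
        Finset.sum_sub_distrib, hΘ.2 i, hx.1.2 i, sub_zero, mul_zero])
    (by
      have h5 : matInner (t • Δ) (t • Δ) = t ^ 2 * matInner Δ Δ := by
        simp only [matInner, transpose_smul, Matrix.smul_mul, Matrix.mul_smul, trace_smul,
          smul_eq_mul]
        ring
      rw [frobNorm_eq, h5, Real.sqrt_mul (sq_nonneg t), Real.sqrt_sq ht0.le, ← frobNorm_eq, ← hF,
        htF])
    (by
      refine (nuclearNorm_smul_le ht0.le Δ).trans ?_
      have h5 : nuclearNorm Δ ≤ 6 * (√r * F) := by linarith
      calc t * nuclearNorm Δ ≤ t * (6 * (√r * F)) := mul_le_mul_of_nonneg_left h5 ht0.le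
        _ = 6 * (√r * (t * F)) := by ring
        _ = _ := by rw [htF])
  have hsc : ∑ i, pairEnergy (survivors (x i).2 L) (fun m => (t • Δ) i ((x i).1 m)) =
      t ^ 2 * e := by
    rw [he, Finset.mul_sum]
    exact Finset.sum_congr rfl fun i _ => pairEnergy_smul _ t _
  rw [hsc] at hlower
  have h6 : c * u ≤ t ^ 2 * (2 * lam * (√r * F)) := by
    calc c * u ≤ c * (t ^ 2 * e) := mul_le_mul_of_nonneg_left hlower hc0
      _ = t ^ 2 * (c * e) := by ring
      _ ≤ _ := mul_le_mul_of_nonneg_left (by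
          have : 0 ≤ lam / 2 * ν := by positivity
          linarith) (sq_nonneg t)
  have h7 : t ^ 2 * (2 * lam * (√r * F)) = t * (2 * lam * √r * F₀) := by rw [← htF]; ring
  have h8 : t * (2 * lam * √r * F₀) ≤ 2 * lam * √r * F₀ :=
    mul_le_of_le_one_left (by positivity) ht1
  linarith

end Likelihood
end KWise

namespace KWise
open Matrix

/-! ### Symmetric dilation. -/

section Dilation
variable {d₁ d₂ : ℕ}

/-- The symmetric dilation of a matrix. -/
noncomputable def dilation (A : Matrix (Fin d₁) (Fin d₂) ℝ) :
    Matrix (Fin d₁ ⊕ Fin d₂) (Fin d₁ ⊕ Fin d₂) ℝ := fromBlocks 0 A Aᵀ 0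

theorem dilation_transpose (A : Matrix (Fin d₁) (Fin d₂) ℝ) : (dilation A)ᵀ = dilation A := by
  simp [dilation, fromBlocks_transpose]

theorem dilation_sum_smul {ι : Type*} [Fintype ι] (c : ι → ℝ)
    (A : ι → Matrix (Fin d₁) (Fin d₂) ℝ) :
    dilation (∑ i, c i • A i) = ∑ i, c i • dilation (A i) := by
  ext (a | a) (b | b) <;> simp [dilation, Matrix.sum_apply]

theorem dotProduct_dilation (A : Matrix (Fin d₁) (Fin d₂) ℝ) (u : Fin d₁ → ℝ) (w : Fin d₂ → ℝ) :
    Sum.elim u w ⬝ᵥ dilation A *ᵥ Sum.elim u w = 2 * (u ⬝ᵥ A *ᵥ w) := by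
  rw [dilation, fromBlocks_mulVec]
  simp only [zero_mulVec, zero_add, add_zero, sumElim_dotProduct_sumElim, Sum.elim_comp_inl,
    Sum.elim_comp_inr]
  have : w ⬝ᵥ Aᵀ *ᵥ u = u ⬝ᵥ A *ᵥ w := by
    rw [mulVec_transpose, dotProduct_comm, dotProduct_mulVec]
  rw [this]; ring

/-- Test on the pair of normalized vectors: its squared norm 2 cancels the factor 2 of the dilated
quadratic form. -/
theorem opBound_of_dilation {A : Matrix (Fin d₁) (Fin d₂) ℝ} {μ : ℝ}
    (h : ∀ z, z ⬝ᵥ dilation A *ᵥ z ≤ μ * (z ⬝ᵥ z)) : OpBound A μ := by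
  intro x y
  have hx := dotProduct_self_nonneg' x
  have hy := dotProduct_self_nonneg' y
  rcases hx.eq_or_lt with hx0 | hx0
  · have : x = 0 := dotProduct_self_eq_zero.1 hx0.symm
    simp [this]
  rcases hy.eq_or_lt with hy0 | hy0
  · have : y = 0 := dotProduct_self_eq_zero.1 hy0.symm
    simp [this]
  have ha := Real.sqrt_pos.2 hx0
  have hb := Real.sqrt_pos.2 hy0
  have h1 := h (Sum.elim ((√(x ⬝ᵥ x))⁻¹ • x) ((√(y ⬝ᵥ y))⁻¹ • y))
  rw [dotProduct_dilation, sumElim_dotProduct_sumElim] at h1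
  simp only [smul_dotProduct, mulVec_smul, dotProduct_smul, smul_eq_mul] at h1
  have e1 : (√(x ⬝ᵥ x))⁻¹ * ((√(x ⬝ᵥ x))⁻¹ * (x ⬝ᵥ x)) = 1 := by
    nth_rw 3 [← Real.mul_self_sqrt hx]; field_simp
  have e2 : (√(y ⬝ᵥ y))⁻¹ * ((√(y ⬝ᵥ y))⁻¹ * (y ⬝ᵥ y)) = 1 := by
    nth_rw 3 [← Real.mul_self_sqrt hy]; field_simp
  rw [e1, e2] at h1
  have h2 : (√(x ⬝ᵥ x))⁻¹ * ((√(y ⬝ᵥ y))⁻¹ * (x ⬝ᵥ A *ᵥ y)) ≤ μ := by linarith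
  have h3 := mul_le_mul_of_nonneg_right h2 (mul_pos ha hb).le
  calc _ = (√(x ⬝ᵥ x))⁻¹ * ((√(y ⬝ᵥ y))⁻¹ * (x ⬝ᵥ A *ᵥ y)) * (√(x ⬝ᵥ x) * √(y ⬝ᵥ y)) := by
        field_simp
    _ ≤ _ := h3

end Dilation

/-! ### Restricted strong convexity for independently retained slots. -/

section Pairs
variable {d₁ d₂ k : ℕ}

/-- The retained slots of user `i`. -/
def retained (x : Fin d₁ × Fin k → Fin d₂ × Bool) (i : Fin d₁) : Finset (Fin k) :=
  Finset.univ.filter fun m => (x (i, m)).2 = true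

/-- Whether both slots of a pair are retained. -/
def pairKept (x : Fin d₁ × Fin k → Fin d₂ × Bool) (p : Fin d₁ × Fin (k / 2)) : Bool :=
  (x (p.1, pairFst k p.2)).2 && (x (p.1, pairSnd k p.2)).2

/-- The design matrix of a pair of slots. -/
noncomputable def pairMat (x : Fin d₁ × Fin k → Fin d₂ × Bool) (p : Fin d₁ × Fin (k / 2)) :
    Matrix (Fin d₁) (Fin d₂) ℝ :=
  if pairKept x p then vecMulVec (Pi.single p.1 1)
    (Pi.single (x (p.1, pairFst k p.2)).1 1 - Pi.single (x (p.1, pairSnd k p.2)).1 1) else 0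

/-- The difference of the entries of `Δ` seen by a pair of slots. -/
noncomputable def pairDiff (x : Fin d₁ × Fin k → Fin d₂ × Bool) (p : Fin d₁ × Fin (k / 2))
    (Δ : Matrix (Fin d₁) (Fin d₂) ℝ) : ℝ :=
  if pairKept x p then Δ p.1 (x (p.1, pairFst k p.2)).1 - Δ p.1 (x (p.1, pairSnd k p.2)).1 else 0

theorem matInner_vecMulVec (a : Fin d₁ → ℝ) (b : Fin d₂ → ℝ) (Δ : Matrix (Fin d₁) (Fin d₂) ℝ) :
    matInner (vecMulVec a b) Δ = a ⬝ᵥ Δ *ᵥ b := by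
  rw [matInner, trace_mul_comm, transpose_vecMulVec, mul_vecMulVec, trace_vecMulVec,
    dotProduct_comm]

theorem matInner_pairMat (x : Fin d₁ × Fin k → Fin d₂ × Bool) (p : Fin d₁ × Fin (k / 2))
    (Δ : Matrix (Fin d₁) (Fin d₂) ℝ) : matInner (pairMat x p) Δ = pairDiff x p Δ := by
  rw [pairMat, pairDiff]
  split_ifs
  · rw [matInner_vecMulVec, mulVec_sub, dotProduct_sub]
    simp
  · simp [matInner]

theorem matInner_sum_smul {ι : Type*} [Fintype ι] (c : ι → ℝ)
    (A : ι → Matrix (Fin d₁) (Fin d₂) ℝ) (Δ : Matrix (Fin d₁) (Fin d₂) ℝ) :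
    matInner (∑ i, c i • A i) Δ = ∑ i, c i * matInner (A i) Δ := by
  simp [matInner, transpose_sum, Matrix.sum_mul, trace_sum]

/-- How often the item `j` is presented. -/
noncomputable def itemCount (x : Fin d₁ × Fin k → Fin d₂ × Bool) (j : Fin d₂) : ℝ :=
  ∑ s, if (x s).1 = j then 1 else 0

/-- The variance of the Rademacher sum for a fixed design. A user occurs in `k / 2` pairs, which
bounds the row block; an item occurs in at most `C` slots, which bounds the column block. -/
theorem sum_pairMat_variance (x : Fin d₁ × Fin k → Fin d₂ × Bool) {C : ℝ}
    (hC : ∀ j, itemCount x j ≤ C) (hC0 : 0 ≤ C) (z : Fin d₁ ⊕ Fin d₂ → ℝ) :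
    ∑ p, (dilation (pairMat x p) *ᵥ z) ⬝ᵥ (dilation (pairMat x p) *ᵥ z) ≤
      2 * ((k / 2 : ℕ) + C) * (z ⬝ᵥ z) := by
  obtain ⟨u, w, rfl⟩ : ∃ u w, z = Sum.elim u w := ⟨z ∘ Sum.inl, z ∘ Sum.inr, by simp⟩
  have hterm : ∀ p : Fin d₁ × Fin (k / 2),
      (dilation (pairMat x p) *ᵥ Sum.elim u w) ⬝ᵥ (dilation (pairMat x p) *ᵥ Sum.elim u w) ≤
      2 * u p.1 ^ 2 + (2 * w (x (p.1, pairFst k p.2)).1 ^ 2 +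
        2 * w (x (p.1, pairSnd k p.2)).1 ^ 2) := by
    intro p
    rw [dilation, fromBlocks_mulVec]
    simp only [zero_mulVec, zero_add, add_zero, sumElim_dotProduct_sumElim, Sum.elim_comp_inl,
      Sum.elim_comp_inr]
    rw [pairMat]
    split_ifs
    · set a := (x (p.1, pairFst k p.2)).1
      set b := (x (p.1, pairSnd k p.2)).1
      set e : Fin d₂ → ℝ := Pi.single a 1 - Pi.single b 1 with he
      have e1 : vecMulVec (Pi.single p.1 (1 : ℝ)) e *ᵥ w = (w a - w b) • Pi.single p.1 1 := by
        rw [vecMulVec_mulVec, op_smul_eq_smul, he, sub_dotProduct]; simp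
      have e2 : (vecMulVec (Pi.single p.1 (1 : ℝ)) e)ᵀ *ᵥ u = u p.1 • e := by
        rw [transpose_vecMulVec, vecMulVec_mulVec]; simp
      have e3 : e ⬝ᵥ e ≤ 2 := by
        rw [he, sub_dotProduct]
        simp only [single_dotProduct, one_mul, Pi.sub_apply, Pi.single_eq_same]
        have h1 : (0 : ℝ) ≤ (Pi.single b 1 : Fin d₂ → ℝ) a := by
          by_cases h : a = b <;> simp [h]
        have h2 : (0 : ℝ) ≤ (Pi.single a 1 : Fin d₂ → ℝ) b := by
          by_cases h : b = a <;> simp [h]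
        linarith
      rw [e1, e2]
      simp only [smul_dotProduct, dotProduct_smul, smul_eq_mul, single_dotProduct,
        Pi.single_eq_same, mul_one]
      nlinarith [sq_nonneg (w a + w b), mul_le_mul_of_nonneg_left e3 (sq_nonneg (u p.1))]
    · simp; positivity
  refine (Finset.sum_le_sum fun p _ => hterm p).trans ?_
  rw [Finset.sum_add_distrib, sumElim_dotProduct_sumElim]
  have h1 : ∑ p : Fin d₁ × Fin (k / 2), 2 * u p.1 ^ 2 = 2 * (k / 2 : ℕ) * (u ⬝ᵥ u) := by
    rw [Fintype.sum_prod_type, dotProduct, Finset.mul_sum]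
    refine Finset.sum_congr rfl fun i _ => ?_
    simp only [Finset.sum_const, Finset.card_univ, Fintype.card_fin, nsmul_eq_mul]; ring
  have h2 : ∑ p : Fin d₁ × Fin (k / 2), (2 * w (x (p.1, pairFst k p.2)).1 ^ 2 +
      2 * w (x (p.1, pairSnd k p.2)).1 ^ 2) ≤ 2 * C * (w ⬝ᵥ w) := by
    rw [Fintype.sum_prod_type]
    calc _ ≤ ∑ i : Fin d₁, ∑ m : Fin k, 2 * w (x (i, m)).1 ^ 2 :=
          Finset.sum_le_sum fun i _ => sum_pairs_le (fun m => 2 * w (x (i, m)).1 ^ 2)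
            fun m => by positivity
      _ = ∑ s, 2 * w (x s).1 ^ 2 := by rw [Fintype.sum_prod_type]
      _ = ∑ s, ∑ j, (if (x s).1 = j then 1 else 0) * (2 * w j ^ 2) := by simp
      _ = ∑ j, itemCount x j * (2 * w j ^ 2) := by
          rw [Finset.sum_comm]; simp only [itemCount, Finset.sum_mul]
      _ ≤ ∑ j, C * (2 * w j ^ 2) :=
          Finset.sum_le_sum fun j _ => mul_le_mul_of_nonneg_right (hC j) (by positivity)
      _ = _ := by
          rw [dotProduct, Finset.mul_sum]; exact Finset.sum_congr rfl fun j _ => by ring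
  have hu := dotProduct_self_nonneg' u
  have hw := dotProduct_self_nonneg' w
  rw [h1]
  nlinarith [mul_nonneg hC0 hu, mul_nonneg (Nat.cast_nonneg (α := ℝ) (k / 2)) hw]

/-- For a fixed design the process is a pairing of Δ with one Rademacher matrix. Duality bounds the
supremum by ρ times its operator norm, whose Laplace transform is controlled by the trace of cosh of
the dilation. -/
theorem sum_exp_iSup_pairDiff {T : Type*} [Finite T] [Nonempty T] [NeZero d₁]
    (x : Fin d₁ × Fin k → Fin d₂ × Bool) {C : ℝ} (hC : ∀ j, itemCount x j ≤ C) (hC0 : 0 ≤ C)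
    {Δ : T → Matrix (Fin d₁) (Fin d₂) ℝ} {ρ β y₀ : ℝ} (hρ : ∀ t, nuclearNorm (Δ t) ≤ ρ)
    (hβ : 0 ≤ β) (hy : 0 < y₀) (hβρ : β * ρ ≤ y₀) :
    ∑ ε : Fin d₁ × Fin (k / 2) → Bool,
        Real.exp (⨆ t, ∑ p, sgn (ε p) * (β * pairDiff x p (Δ t))) ≤
      2 * (Real.exp (y₀ ^ 2 * ((k / 2 : ℕ) + C)) *
        (((d₁ : ℝ) + d₂) * 2 ^ Fintype.card (Fin d₁ × Fin (k / 2)))) := by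
  have hV : ∀ z, ∑ p, (dilation (y₀ • pairMat x p) *ᵥ z) ⬝ᵥ (dilation (y₀ • pairMat x p) *ᵥ z) ≤
      y₀ ^ 2 * (2 * ((k / 2 : ℕ) + C)) * (z ⬝ᵥ z) := by
    intro z
    have e : ∀ p, dilation (y₀ • pairMat x p) = y₀ • dilation (pairMat x p) := fun p => by
      simp [dilation, fromBlocks_smul]
    simp only [e, smul_mulVec, smul_dotProduct, dotProduct_smul, smul_eq_mul]
    have := mul_le_mul_of_nonneg_left (sum_pairMat_variance x hC hC0 z) (sq_nonneg y₀)
    rw [Finset.mul_sum] at this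
    calc _ = ∑ p, y₀ ^ 2 * ((dilation (pairMat x p) *ᵥ z) ⬝ᵥ (dilation (pairMat x p) *ᵥ z)) :=
          Finset.sum_congr rfl fun p _ => by ring
      _ ≤ _ := this
      _ = _ := by ring
  have h := sum_coshTrace_le (H := fun p => dilation (y₀ • pairMat x p))
    (fun p => dilation_transpose _) (by positivity) hV
  rw [show y₀ ^ 2 * (2 * (((k / 2 : ℕ) : ℝ) + C)) / 2 = y₀ ^ 2 * ((k / 2 : ℕ) + C) by ring] at h
  have h2 : ∀ ε : Fin d₁ × Fin (k / 2) → Bool,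
      Real.exp (⨆ t, ∑ p, sgn (ε p) * (β * pairDiff x p (Δ t))) ≤
      2 * coshTrace (∑ p, sgn (ε p) • dilation (y₀ • pairMat x p)) := by
    intro ε
    rw [← dilation_sum_smul]
    obtain ⟨μ, h1, -, h3⟩ := exists_top_eigenvalue
      (dilation_transpose (∑ p, sgn (ε p) • y₀ • pairMat x p))
    refine le_trans (Real.exp_le_exp.2 (ciSup_le fun t => ?_)) h3
    have hop := opBound_of_dilation h1
    -- The diagonal blocks of the dilation vanish, so its quadratic form takes the value 0 on a unit
    -- vector.
    have hμ : 0 ≤ μ := by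
      have := h1 (Sum.elim (Pi.single 0 1) 0)
      rw [dotProduct_dilation, sumElim_dotProduct_sumElim] at this
      simpa using this
    have h4 := matInner_le_mul_nuclearNorm (A := Δ t) hop
    rw [matInner_sum_smul] at h4
    have e : ∀ p, matInner (y₀ • pairMat x p) (Δ t) = y₀ * pairDiff x p (Δ t) := fun p => by
      rw [← matInner_pairMat]; simp [matInner]
    simp only [e] at h4
    have h5 : ∑ p, sgn (ε p) * (y₀ * pairDiff x p (Δ t)) =
        y₀ * ∑ p, sgn (ε p) * pairDiff x p (Δ t) := by
      rw [Finset.mul_sum]; exact Finset.sum_congr rfl fun p _ => by ring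
    have h6 : ∑ p, sgn (ε p) * (β * pairDiff x p (Δ t)) =
        β * ∑ p, sgn (ε p) * pairDiff x p (Δ t) := by
      rw [Finset.mul_sum]; exact Finset.sum_congr rfl fun p _ => by ring
    rw [h5] at h4
    rw [h6]
    have h7 : y₀ * (β * ∑ p, sgn (ε p) * pairDiff x p (Δ t)) ≤ y₀ * μ := by
      calc _ = β * (y₀ * ∑ p, sgn (ε p) * pairDiff x p (Δ t)) := by ring
        _ ≤ β * (μ * nuclearNorm (Δ t)) := mul_le_mul_of_nonneg_left h4 hβ
        _ ≤ β * (μ * ρ) := by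
            exact mul_le_mul_of_nonneg_left (mul_le_mul_of_nonneg_left (hρ t) hμ) hβ
        _ = (β * ρ) * μ := by ring
        _ ≤ _ := mul_le_mul_of_nonneg_right hβρ hμ
    exact le_of_mul_le_mul_left h7 hy
  refine (Finset.sum_le_sum fun ε _ => h2 ε).trans ?_
  rw [← Finset.mul_sum]
  refine mul_le_mul_of_nonneg_left ?_ (by norm_num)
  simpa using h

/-- The law of a slot: a uniform item, retained with probability `q i j`. -/
noncomputable def slotWeight (d₂ k : ℕ) (q : Fin d₁ → Fin d₂ → ℝ) (s : Fin d₁ × Fin k)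
    (z : Fin d₂ × Bool) : ℝ := 1 / d₂ * if z.2 then q s.1 z.1 else 1 - q s.1 z.1

theorem slotWeight_nonneg {q : Fin d₁ → Fin d₂ → ℝ} (hq0 : ∀ i j, 0 ≤ q i j)
    (hq1 : ∀ i j, q i j ≤ 1) (s : Fin d₁ × Fin k) (z : Fin d₂ × Bool) :
    0 ≤ slotWeight d₂ k q s z := by
  rw [slotWeight]
  have h0 := hq0 s.1 z.1
  have h1 := hq1 s.1 z.1
  refine mul_nonneg (by positivity) ?_
  split_ifs <;> linarith

theorem sum_slotWeight_mul (q : Fin d₁ → Fin d₂ → ℝ) (s : Fin d₁ × Fin k) (f : Fin d₂ → ℝ) :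
    ∑ z, slotWeight d₂ k q s z * f z.1 = 1 / d₂ * ∑ j, f j := by
  rw [Fintype.sum_prod_type, Finset.mul_sum]
  refine Finset.sum_congr rfl fun j _ => ?_
  rw [Fintype.sum_bool]; simp [slotWeight]; ring

theorem sum_slotWeight [NeZero d₂] (q : Fin d₁ → Fin d₂ → ℝ) (s : Fin d₁ × Fin k) :
    ∑ z, slotWeight d₂ k q s z = 1 := by
  have := sum_slotWeight_mul q s fun _ => 1
  have h : (d₂ : ℝ) ≠ 0 := by exact_mod_cast NeZero.ne d₂
  simpa [h] using this

/-- The count is a sum of d₁k independent indicators of mean 1/d₂, and e^t - 1 ≤ 2t on [0, 1]. -/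
theorem sum_exp_itemCount_le [NeZero d₂] (q : Fin d₁ → Fin d₂ → ℝ) {t : ℝ} (ht0 : 0 ≤ t)
    (ht1 : t ≤ 1) (j : Fin d₂) :
    ∑ x, prodWeight (slotWeight d₂ k q) x * Real.exp (t * itemCount x j) ≤
      Real.exp (2 * t * (d₁ * k) / d₂) := by
  have hd : (0 : ℝ) < d₂ := by exact_mod_cast Nat.pos_of_ne_zero (NeZero.ne d₂)
  have e1 : ∀ x : Fin d₁ × Fin k → Fin d₂ × Bool, Real.exp (t * itemCount x j) =
      ∏ s, if (x s).1 = j then Real.exp t else 1 := by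
    intro x
    rw [itemCount, Finset.mul_sum, Real.exp_sum]
    refine Finset.prod_congr rfl fun s _ => ?_
    split_ifs <;> simp
  simp only [e1]
  rw [sum_prodWeight_mul_prod (slotWeight d₂ k q)
    (fun _ z => if z.1 = j then Real.exp t else 1)]
  have e2 : ∀ s : Fin d₁ × Fin k, ∑ z, slotWeight d₂ k q s z *
      (if z.1 = j then Real.exp t else 1) = 1 + (Real.exp t - 1) / d₂ := by
    intro s
    rw [sum_slotWeight_mul q s fun j' => if j' = j then Real.exp t else 1]
    have : ∀ j', (if j' = j then Real.exp t else 1) =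
      1 + if j' = j then Real.exp t - 1 else 0 := fun j' => by split_ifs <;> ring
    simp only [this, Finset.sum_add_distrib]
    simp
    field_simp
  simp only [e2, Finset.prod_const, Finset.card_univ, Fintype.card_prod, Fintype.card_fin]
  have h1 : Real.exp t - 1 ≤ 2 * t := by
    have := Real.abs_exp_sub_one_le (x := t) (by rwa [abs_of_nonneg ht0])
    rw [abs_of_nonneg ht0] at this
    exact (le_abs_self _).trans this
  have h0 : 0 ≤ Real.exp t - 1 := by linarith [Real.add_one_le_exp t]
  have h2 : 1 + (Real.exp t - 1) / d₂ ≤ Real.exp (2 * t / d₂) := by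
    have := Real.add_one_le_exp (2 * t / d₂)
    have h3 : (Real.exp t - 1) / d₂ ≤ 2 * t / d₂ := by gcongr
    linarith
  calc _ ≤ Real.exp (2 * t / d₂) ^ (d₁ * k) := by gcongr
    _ = _ := by rw [← Real.exp_nat_mul]; congr 1; push_cast; ring

/-- The two slots are independent and both are kept with probability at least 1/4. Zero row sums
kill the cross terms, so the squared differences over all pairs of items add up to 2d₂ times the
squared norm of the row. -/
theorem sum_pairDiff_sq_mean [NeZero d₂] {q : Fin d₁ → Fin d₂ → ℝ} (hq : ∀ i j, 1 / 2 ≤ q i j)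
    (hk : 2 ≤ k) {Δ : Matrix (Fin d₁) (Fin d₂) ℝ} (hΔ : ∀ i, ∑ j, Δ i j = 0)
    (p : Fin d₁ × Fin (k / 2)) :
    1 / (2 * d₂) * ∑ j, Δ p.1 j ^ 2 ≤
      ∑ x, prodWeight (slotWeight d₂ k q) x * pairDiff x p Δ ^ 2 := by
  have hd : (0 : ℝ) < d₂ := by exact_mod_cast Nat.pos_of_ne_zero (NeZero.ne d₂)
  have hab : (p.1, pairFst k p.2) ≠ (p.1, pairSnd k p.2) := by
    intro h
    have h2 := p.2.isLt
    simp [pairFst, pairSnd, Fin.ext_iff] at h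
    omega
  have h := sum_prodWeight_pair (fun s => sum_slotWeight (k := k) q s) hab
    fun z z' => (if z.2 && z'.2 then Δ p.1 z.1 - Δ p.1 z'.1 else 0) ^ 2
  have e : ∀ x : Fin d₁ × Fin k → Fin d₂ × Bool, pairDiff x p Δ =
    (if (x (p.1, pairFst k p.2)).2 && (x (p.1, pairSnd k p.2)).2 then
      Δ p.1 (x (p.1, pairFst k p.2)).1 - Δ p.1 (x (p.1, pairSnd k p.2)).1 else 0) := fun x => rfl
  simp only [e]
  rw [h]
  simp only [Fintype.sum_prod_type, Fintype.sum_bool, slotWeight]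
  simp only [Bool.and_true, Bool.and_false, Bool.false_eq_true, if_true, if_false, ne_eq,
    OfNat.ofNat_ne_zero, not_false_eq_true, zero_pow, mul_zero, add_zero, Finset.sum_const_zero]
  have h1 : ∀ j j' : Fin d₂, 1 / (4 * d₂ ^ 2) * (Δ p.1 j - Δ p.1 j') ^ 2 ≤
      1 / d₂ * q p.1 j * (1 / d₂ * q p.1 j') * (Δ p.1 j - Δ p.1 j') ^ 2 := by
    intro j j'
    refine mul_le_mul_of_nonneg_right ?_ (sq_nonneg _)
    have hqq : 1 / 4 ≤ q p.1 j * q p.1 j' := by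
      have := mul_le_mul (hq p.1 j) (hq p.1 j') (by norm_num) (by linarith [hq p.1 j])
      linarith
    calc (1 : ℝ) / (4 * d₂ ^ 2) = 1 / d₂ ^ 2 * (1 / 4) := by field_simp
      _ ≤ 1 / d₂ ^ 2 * (q p.1 j * q p.1 j') := by gcongr
      _ = _ := by field_simp
  refine le_trans (le_of_eq ?_) (Finset.sum_le_sum fun j _ => Finset.sum_le_sum fun j' _ => h1 j j')
  have h2 : ∑ j, ∑ j', (Δ p.1 j - Δ p.1 j') ^ 2 = 2 * d₂ * ∑ j, Δ p.1 j ^ 2 := by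
    have e3 : ∀ j j', (Δ p.1 j - Δ p.1 j') ^ 2 =
      Δ p.1 j ^ 2 + Δ p.1 j' ^ 2 - 2 * Δ p.1 j * Δ p.1 j' := fun j j' => by ring
    simp only [e3, Finset.sum_sub_distrib, Finset.sum_add_distrib, ← Finset.mul_sum, hΔ]
    simp; rw [← Finset.mul_sum]; ring
  simp only [← Finset.mul_sum]
  rw [h2]; field_simp; ring

theorem sum_pairDiff_sq (x : Fin d₁ × Fin k → Fin d₂ × Bool) (Δ : Matrix (Fin d₁) (Fin d₂) ℝ) :
    ∑ p, pairDiff x p Δ ^ 2 = ∑ i, pairEnergy (retained x i) (fun m => Δ i (x (i, m)).1) := by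
  rw [Fintype.sum_prod_type]
  refine Finset.sum_congr rfl fun i _ => Finset.sum_congr rfl fun p _ => ?_
  simp only [pairDiff, pairKept, retained, Finset.mem_filter, Finset.mem_univ, true_and,
    Bool.and_eq_true]
  split_ifs <;> simp

/-- By `hu` the mean energy is at least 2u, so failure is a deviation of size u below the mean. The
exponential Markov inequality at s = y₀/(16αρ) is followed by symmetrization, contraction and the
matrix bound for a fixed design, and finally by an average over the item counts. -/
theorem restricted_strong_convexity_tail [NeZero d₁] [NeZero d₂] {q : Fin d₁ → Fin d₂ → ℝ}
    (hq : ∀ i j, 1 / 2 ≤ q i j) (hq1 : ∀ i j, q i j ≤ 1) (hk : 2 ≤ k) {α ρ y₀ u F₀ : ℝ}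
    (hα : 0 < α) (hρ : 0 < ρ) (hy0 : 0 < y₀) (hy1 : y₀ ≤ 1)
    (hu : 4 * d₂ * u ≤ (k / 2 : ℕ) * F₀ ^ 2)
    (D : Set (Matrix (Fin d₁) (Fin d₂) ℝ))
    (hD : ∀ Δ ∈ D, (∀ i j, |Δ i j| ≤ 2 * α) ∧ (∀ i, ∑ j, Δ i j = 0) ∧ frobNorm Δ = F₀ ∧
      nuclearNorm Δ ≤ ρ) :
    ∑ x, prodWeight (slotWeight d₂ k q) x * {x | ∃ Δ ∈ D, ∑ i, pairEnergy (retained x i)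
        (fun m => Δ i (x (i, m)).1) < u}.indicator 1 x ≤
      2 * (d₁ + d₂) * d₂ *
        Real.exp (y₀ ^ 2 * ((k / 2 : ℕ) + 2 * (d₁ * k) / d₂) - y₀ * u / (16 * α * ρ)) := by
  classical
  set bad : Set (Fin d₁ × Fin k → Fin d₂ × Bool) := {x | ∃ Δ ∈ D, ∑ i, pairEnergy (retained x i)
        (fun m => Δ i (x (i, m)).1) < u} with hbad
  have hd : (0 : ℝ) < d₂ := by exact_mod_cast Nat.pos_of_ne_zero (NeZero.ne d₂)
  rcases bad.eq_empty_or_nonempty with he | ⟨x₀, hx₀⟩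
  · rw [he]; simp; positivity
  have hw0 : ∀ x, 0 ≤ prodWeight (slotWeight d₂ k q) x :=
    prodWeight_nonneg (slotWeight_nonneg (fun i j => by linarith [hq i j]) hq1)
  have hchoose : ∀ x : bad, ∃ Δ ∈ D, ∑ i, pairEnergy (retained x.1 i)
        (fun m => Δ i (x.1 (i, m)).1) < u := fun x => x.2
  -- One witness for each bad outcome: the supremum is indexed by the finite set of bad outcomes
  -- instead of the infinite class `D`.
  choose Δ hΔD hΔu using hchoose
  have : Nonempty bad := ⟨⟨x₀, hx₀⟩⟩
  set s : ℝ := y₀ / (16 * α * ρ) with hs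
  have hs0 : 0 < s := by positivity
  set y : Fin d₁ × Fin (k / 2) → (Fin d₁ × Fin k → Fin d₂ × Bool) → bad → ℝ :=
    fun p x t => s * pairDiff x p (Δ t) ^ 2 with hydef
  have hKpos : 0 < k / 2 := by omega
  have hmean : ∀ t, s * (2 * u) ≤ ∑ p, ∑ x', prodWeight (slotWeight d₂ k q) x' * y p x' t := by
    intro t
    obtain ⟨-, hrow, hfrob, -⟩ := hD _ (hΔD t)
    have h1 : ∀ p, ∑ x', prodWeight (slotWeight d₂ k q) x' * y p x' t =
        s * ∑ x', prodWeight (slotWeight d₂ k q) x' * pairDiff x' p (Δ t) ^ 2 := by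
      intro p; rw [Finset.mul_sum]; exact Finset.sum_congr rfl fun x' _ => by rw [hydef]; ring
    simp only [h1, ← Finset.mul_sum]
    refine mul_le_mul_of_nonneg_left ?_ hs0.le
    refine le_trans ?_ (Finset.sum_le_sum fun p _ => sum_pairDiff_sq_mean hq hk hrow p)
    have h2 : F₀ ^ 2 = ∑ i, ∑ j, Δ t i j ^ 2 := by
      rw [← hfrob, frobNorm_eq, Real.sq_sqrt (matInner_self_nonneg _), matInner_eq_sum]
      refine Finset.sum_congr rfl fun i _ => ?_
      exact Finset.sum_congr rfl fun j _ => (sq _).symm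
    rw [← Finset.mul_sum, Fintype.sum_prod_type]
    simp only [Finset.sum_const, Finset.card_univ, Fintype.card_fin, nsmul_eq_mul]
    rw [← Finset.mul_sum, ← h2]
    rw [div_mul_eq_mul_div, le_div_iff₀ (by positivity)]
    linarith
  have hpoint : ∀ x, bad.indicator 1 x ≤ Real.exp (-(s * u)) *
      Real.exp (⨆ t, ∑ p, ((∑ x', prodWeight (slotWeight d₂ k q) x' * y p x' t) - y p x t)) := by
    intro x
    by_cases hx : x ∈ bad
    · rw [Set.indicator_of_mem hx, Pi.one_apply, ← Real.exp_add]
      refine Real.one_le_exp ?_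
      have h1 := le_iSup_finite (fun t => ∑ p,
        ((∑ x', prodWeight (slotWeight d₂ k q) x' * y p x' t) - y p x t)) ⟨x, hx⟩
      have h2 := hmean ⟨x, hx⟩
      have h3 : ∑ p, y p x ⟨x, hx⟩ ≤ s * u := by
        rw [hydef]; simp only [← Finset.mul_sum]
        rw [sum_pairDiff_sq]
        exact mul_le_mul_of_nonneg_left (hΔu ⟨x, hx⟩).le hs0.le
      simp only [Finset.sum_sub_distrib] at h1
      simp only [Finset.sum_sub_distrib]
      linarith
    · rw [Set.indicator_of_notMem hx]; positivity
  set P := Fintype.card (Fin d₁ × Fin (k / 2)) with hP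
  have hsymm := sum_exp_iSup_symmetrization
    (slotWeight_nonneg (k := k) (fun i j => by linarith [hq i j]) hq1) (fun s => sum_slotWeight q s)
    -- Residues modulo `k / 2` put both slots of a pair in its block. For odd `k` the last slot
    -- falls into block 0, harmlessly, since no pair uses it.
    (fun s : Fin d₁ × Fin k => (s.1, (⟨s.2 % (k / 2), Nat.mod_lt _ hKpos⟩ : Fin (k / 2)))) y (by
      intro p x x' h
      have h1 := h (p.1, pairFst k p.2) (by
        ext <;> simp [pairFst, Nat.mod_eq_of_lt p.2.isLt])
      have h2 := h (p.1, pairSnd k p.2) (by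
        ext <;> simp [pairSnd, Nat.mod_eq_of_lt p.2.isLt])
      funext t
      have h3 : pairKept x p = pairKept x' p := by rw [pairKept, pairKept, h1, h2]
      simp only [hydef, pairDiff, h1, h2, h3])
  have hinner : ∀ x, ∑ ε : Fin d₁ × Fin (k / 2) → Bool,
      Real.exp (⨆ t, ∑ p, sgn (ε p) * (2 * y p x t)) ≤
      2 * (Real.exp (y₀ ^ 2 * (k / 2 : ℕ)) * (∑ j, Real.exp (y₀ ^ 2 * itemCount x j)) *
        (((d₁ : ℝ) + d₂) * 2 ^ P)) := by
    intro x
    have hdiff : ∀ p t, |pairDiff x p (Δ t)| ≤ 4 * α := by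
      intro p t
      have := (hD _ (hΔD t)).1
      rw [pairDiff]
      split_ifs
      · refine (abs_sub _ _).trans ?_
        linarith [this p.1 (x (p.1, pairFst k p.2)).1, this p.1 (x (p.1, pairSnd k p.2)).1]
      · simp; linarith
    -- Differences are at most 4α, so 2s·x² is Lipschitz in x with constant 2s·8α = 16αs; multiplied
    -- by ρ this is exactly y₀.
    have hcontr := sum_exp_iSup_contraction (ι := Fin d₁ × Fin (k / 2))
      (a := fun p t => 16 * α * s * pairDiff x p (Δ t)) (b := fun p t => 2 * y p x t)
      (fun p t => by simp only [hydef]; positivity)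
      (fun p t => by
        simp only [hydef]
        rw [abs_mul, abs_of_nonneg (by positivity : 0 ≤ 16 * α * s), ← sq_abs]
        have := mul_le_mul_of_nonneg_left (hdiff p t)
          (mul_nonneg hs0.le (abs_nonneg (pairDiff x p (Δ t))))
        nlinarith [mul_nonneg hs0.le (mul_nonneg hα.le (abs_nonneg (pairDiff x p (Δ t))))])
      (fun p t t' => by
        simp only [hydef]
        rw [← mul_sub, ← mul_sub, ← mul_sub, abs_mul, abs_mul, abs_mul,
          abs_of_pos hs0, abs_of_nonneg (by positivity : 0 ≤ 16 * α * s), abs_of_pos two_pos,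
          sq_sub_sq, abs_mul]
        have h8 : |pairDiff x p (Δ t) + pairDiff x p (Δ t')| ≤ 8 * α :=
          (abs_add_le _ _).trans (by linarith [hdiff p t, hdiff p t'])
        calc _ = 2 * s * |pairDiff x p (Δ t) - pairDiff x p (Δ t')| *
              |pairDiff x p (Δ t) + pairDiff x p (Δ t')| := by ring
          _ ≤ 2 * s * |pairDiff x p (Δ t) - pairDiff x p (Δ t')| * (8 * α) := by gcongr
          _ = _ := by ring)
    refine hcontr.trans ?_
    obtain ⟨j₀, hj₀⟩ := Finite.exists_max (itemCount x)
    have hC0 : 0 ≤ itemCount x j₀ := Finset.sum_nonneg fun _ _ => by split_ifs <;> norm_num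
    have h1 := sum_exp_iSup_pairDiff x hj₀ hC0 (fun t => (hD _ (hΔD t)).2.2.2)
      (β := 16 * α * s) (by positivity) hy0 (by rw [hs]; field_simp; exact le_rfl)
    refine h1.trans ?_
    rw [mul_add, Real.exp_add]
    -- The maximal count is replaced by a sum over items, at the price of the prefactor `d₂`.
    have h2 : Real.exp (y₀ ^ 2 * itemCount x j₀) ≤ ∑ j, Real.exp (y₀ ^ 2 * itemCount x j) :=
      Finset.single_le_sum (f := fun j => Real.exp (y₀ ^ 2 * itemCount x j))
        (fun j _ => (Real.exp_pos _).le) (Finset.mem_univ j₀)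
    gcongr
  have hcount : ∑ x, prodWeight (slotWeight d₂ k q) x * ∑ j, Real.exp (y₀ ^ 2 * itemCount x j) ≤
      d₂ * Real.exp (2 * y₀ ^ 2 * (d₁ * k) / d₂) := by
    simp only [Finset.mul_sum]
    rw [Finset.sum_comm]
    refine (Finset.sum_le_sum fun j _ =>
      sum_exp_itemCount_le q (sq_nonneg y₀) (by nlinarith) j).trans ?_
    simp
  have hP2 : (0 : ℝ) < 2 ^ P := by positivity
  have hmid : 2 ^ P * ∑ x, prodWeight (slotWeight d₂ k q) x *
      Real.exp (⨆ t, ∑ p, ((∑ x', prodWeight (slotWeight d₂ k q) x' * y p x' t) - y p x t)) ≤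
      2 ^ P * (2 * (d₁ + d₂) * d₂ * (Real.exp (y₀ ^ 2 * (k / 2 : ℕ)) *
        Real.exp (2 * y₀ ^ 2 * (d₁ * k) / d₂))) := by
    refine hsymm.trans ((Finset.sum_le_sum fun x _ =>
      mul_le_mul_of_nonneg_left (hinner x) (hw0 x)).trans ?_)
    calc _ = 2 * (Real.exp (y₀ ^ 2 * (k / 2 : ℕ)) * (((d₁ : ℝ) + d₂) * 2 ^ P)) *
          ∑ x, prodWeight (slotWeight d₂ k q) x * ∑ j, Real.exp (y₀ ^ 2 * itemCount x j) := by
          rw [Finset.mul_sum]; exact Finset.sum_congr rfl fun x _ => by ring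
      _ ≤ 2 * (Real.exp (y₀ ^ 2 * (k / 2 : ℕ)) * (((d₁ : ℝ) + d₂) * 2 ^ P)) *
          (d₂ * Real.exp (2 * y₀ ^ 2 * (d₁ * k) / d₂)) :=
          mul_le_mul_of_nonneg_left hcount (by positivity)
      _ = _ := by ring
  have hmid' := le_of_mul_le_mul_left hmid hP2
  calc _ ≤ ∑ x, prodWeight (slotWeight d₂ k q) x * (Real.exp (-(s * u)) * Real.exp
        (⨆ t, ∑ p, ((∑ x', prodWeight (slotWeight d₂ k q) x' * y p x' t) - y p x t))) :=
        Finset.sum_le_sum fun x _ => mul_le_mul_of_nonneg_left (hpoint x) (hw0 x)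
    _ = Real.exp (-(s * u)) * ∑ x, prodWeight (slotWeight d₂ k q) x * Real.exp
        (⨆ t, ∑ p, ((∑ x', prodWeight (slotWeight d₂ k q) x' * y p x' t) - y p x t)) := by
        rw [Finset.mul_sum]; exact Finset.sum_congr rfl fun x _ => by ring
    _ ≤ Real.exp (-(s * u)) * (2 * (d₁ + d₂) * d₂ * (Real.exp (y₀ ^ 2 * (k / 2 : ℕ)) *
        Real.exp (2 * y₀ ^ 2 * (d₁ * k) / d₂))) :=
        mul_le_mul_of_nonneg_left hmid' (Real.exp_pos _).le
    _ = 2 * (d₁ + d₂) * d₂ * (Real.exp (-(s * u)) * (Real.exp (y₀ ^ 2 * (k / 2 : ℕ)) *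
        Real.exp (2 * y₀ ^ 2 * (d₁ * k) / d₂))) := by ring
    _ = _ := by
        rw [← Real.exp_add, ← Real.exp_add]
        congr 2
        rw [hs]; ring

end Pairs
end KWise

namespace KWise
open Matrix

/-! ### Tail bound for the operator norm of the score. -/

section UserWeight
variable {d₁ d₂ k : ℕ}

/-- The probability of the data `x` of a user with utilities `θ`. -/
noncomputable def userWeight (θ : Fin d₂ → ℝ) (x : UserData d₂ k) : ℝ :=
  (1 / d₂ : ℝ) ^ k * mnlWeight (fun m => θ (x.1 m)) x.2

theorem userWeight_nonneg (θ : Fin d₂ → ℝ) (x : UserData d₂ k) : 0 ≤ userWeight θ x :=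
  mul_nonneg (by positivity) (mnlWeight_nonneg _ _)

theorem sum_userWeight_mul_le {θ : Fin d₂ → ℝ} {f : UserData d₂ k → ℝ}
    {F : (Fin k → Fin d₂) → ℝ}
    (h : ∀ items, ∑ σ, mnlWeight (fun m => θ (items m)) σ * f (items, σ) ≤ F items) :
    ∑ x, userWeight θ x * f x ≤
      ∑ items, prodWeight (fun (_ : Fin k) (_ : Fin d₂) => (1 / d₂ : ℝ)) items * F items := by
  rw [Fintype.sum_prod_type]
  refine Finset.sum_le_sum fun items _ => ?_
  have e : prodWeight (fun (_ : Fin k) (_ : Fin d₂) => (1 / d₂ : ℝ)) items = (1 / d₂ : ℝ) ^ k := by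
    simp [prodWeight]
  rw [e]
  refine le_trans (le_of_eq ?_) (mul_le_mul_of_nonneg_left (h items) (by positivity))
  rw [Finset.mul_sum]
  exact Finset.sum_congr rfl fun σ _ => by rw [userWeight]; ring

theorem sum_uniform [NeZero d₂] : ∑ _ : Fin d₂, (1 / d₂ : ℝ) = 1 := by
  have h : (d₂ : ℝ) ≠ 0 := by exact_mod_cast NeZero.ne d₂
  simp [h]

theorem sum_userWeight [NeZero d₂] (θ : Fin d₂ → ℝ) :
    ∑ x : UserData d₂ k, userWeight θ x = 1 := by
  rw [Fintype.sum_prod_type]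
  simp only [userWeight, ← Finset.mul_sum, sum_mnlWeight, mul_one]
  have := sum_prodWeight (v := fun (_ : Fin k) (_ : Fin d₂) => (1 / d₂ : ℝ)) fun _ => sum_uniform
  simp [prodWeight] at this ⊢

/-- Given the items, the variance is at most the sum of the squared values of z at the presented
items; each of the k items is uniform. -/
theorem sum_userWeight_mul_scoreRow_sq [NeZero d₂] (θ z : Fin d₂ → ℝ) :
    ∑ x : UserData d₂ k, userWeight θ x * (scoreRow θ x ⬝ᵥ z) ^ 2 ≤ k / d₂ * (z ⬝ᵥ z) := by
  have h := sum_userWeight_mul_le (k := k) (θ := θ) (f := fun x => (scoreRow θ x ⬝ᵥ z) ^ 2)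
    (F := fun items => ∑ m, z (items m) ^ 2) (fun items => by
      simp only [scoreRow_dotProduct]
      exact sum_mnlWeight_mul_residual_sq _ _)
  refine h.trans (le_of_eq ?_)
  simp only [Finset.mul_sum]
  rw [Finset.sum_comm]
  have e : ∀ m : Fin k, ∑ items, prodWeight (fun (_ : Fin k) (_ : Fin d₂) => (1 / d₂ : ℝ)) items *
      z (items m) ^ 2 = 1 / d₂ * (z ⬝ᵥ z) := by
    intro m
    rw [sum_prodWeight_single (v := fun (_ : Fin k) (_ : Fin d₂) => (1 / d₂ : ℝ))
      (fun _ => sum_uniform) m fun j => z j ^ 2, ← Finset.mul_sum, dotProduct]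
    simp only [sq]
  simp only [e, Finset.sum_const, Finset.card_univ, Fintype.card_fin, nsmul_eq_mul]
  ring

theorem norm_mnlResidual_single (u : Fin k → ℝ) (items : Fin k → Fin d₂)
    (σ : Equiv.Perm (Fin k)) :
    ‖mnlResidual u (fun m => EuclideanSpace.single (items m) (1 : ℝ)) σ‖ ^ 2 =
      mnlResidual u (fun m => (Pi.single (items m) 1 : Fin d₂ → ℝ)) σ ⬝ᵥ
        mnlResidual u (fun m => (Pi.single (items m) 1 : Fin d₂ → ℝ)) σ := by
  have e : WithLp.ofLp (mnlResidual u (fun m => EuclideanSpace.single (items m) (1 : ℝ)) σ) =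
      mnlResidual u (fun m => (Pi.single (items m) 1 : Fin d₂ → ℝ)) σ := by
    simp [mnlResidual, WithLp.ofLp_sum]
  rw [EuclideanSpace.real_norm_sq_eq, ← e, dotProduct]
  exact Finset.sum_congr rfl fun j _ => sq _

/-- The parameter 1/(2k) gives kλ = 1/2, hence the coefficient λ/(1 - kλ) = 1/k and the total
exponent 2k/k = 2. Coordinate vectors are at distance at most √2. -/
theorem sum_userWeight_mul_exp_scoreRow [NeZero d₂] (hk : 0 < k) (θ : Fin d₂ → ℝ) :
    ∑ x : UserData d₂ k, userWeight θ x *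
      Real.exp (1 / (2 * k) * (scoreRow θ x ⬝ᵥ scoreRow θ x)) ≤ Real.exp 2 := by
  have hk' : (0 : ℝ) < k := by exact_mod_cast hk
  have hkl : (k : ℝ) * (1 / (2 * k)) = 1 / 2 := by field_simp
  have h := sum_userWeight_mul_le (k := k) (θ := θ)
    (f := fun x => Real.exp (1 / (2 * k) * (scoreRow θ x ⬝ᵥ scoreRow θ x)))
    (F := fun _ => Real.exp 2) (fun items => by
      have h1 := sum_mnlWeight_mul_exp_le (lam := 1 / (2 * (k : ℝ))) (by positivity)
        (by rw [hkl]; norm_num) (fun m => θ (items m))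
        (fun m => EuclideanSpace.single (items m) (1 : ℝ)) (fun m m' => by
          by_cases h : items m = items m'
          · rw [h, sub_self, norm_zero]; positivity
          · refine Real.le_sqrt_of_sq_le ?_
            have h2 : inner ℝ (EuclideanSpace.single (items m) (1 : ℝ))
                (EuclideanSpace.single (items m') (1 : ℝ)) = 0 := by
              simp [EuclideanSpace.inner_single_left, h]
            rw [norm_sub_sq_real, h2]
            simp
            norm_num) 0
      simp only [zero_add, norm_mnlResidual_single] at h1
      refine h1.trans (Real.exp_le_exp.2 (le_of_eq ?_))
      rw [hkl]; norm_num; field_simp)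
  refine h.trans (le_of_eq ?_)
  rw [← Finset.sum_mul, sum_prodWeight fun _ => sum_uniform, one_mul]

theorem dotProduct_vecMulVec_self {n : Type*} [Fintype n] (g y : n → ℝ) :
    y ⬝ᵥ vecMulVec g g *ᵥ y = (g ⬝ᵥ y) ^ 2 := by
  rw [vecMulVec_mulVec, op_smul_eq_smul, dotProduct_smul, smul_eq_mul, dotProduct_comm y g, sq]

/-- Either some row has squared norm above R, which the sub-Gaussian moment excludes user by user,
or all rows survive truncation. In the second case the Gram matrix divided by R is a sum of
independent rank-one matrices of norm at most 1, with second moment at most k/(d₂R), and its top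
eigenvalue is controlled by the exponential trace. -/
theorem score_tail [NeZero d₁] [NeZero d₂] (hk : 0 < k) (Θ : Matrix (Fin d₁) (Fin d₂) ℝ)
    {R τ : ℝ} (hR : 0 < R) (hτ : 0 ≤ τ) :
    ∑ x : Fin d₁ → UserData d₂ k, prodWeight (fun i => userWeight (Θ i)) x *
        {x | ¬ OpBound (scoreMat Θ x) √(R * τ)}.indicator 1 x ≤
      d₁ * Real.exp (2 - R / (2 * k)) + d₂ * Real.exp (2 * (d₁ * k / (d₂ * R)) - τ) := by
  classical
  have hd : (0 : ℝ) < d₂ := by exact_mod_cast Nat.pos_of_ne_zero (NeZero.ne d₂)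
  set g : Fin d₁ → UserData d₂ k → Fin d₂ → ℝ := fun i x => if scoreRow (Θ i) x ⬝ᵥ scoreRow (Θ i) x
    ≤ R then (√R)⁻¹ • scoreRow (Θ i) x else 0 with hgdef
  have hsR : (√R)⁻¹ * (√R)⁻¹ = R⁻¹ := by rw [← mul_inv, Real.mul_self_sqrt hR.le]
  have hg : ∀ i x, g i x ⬝ᵥ g i x ≤ 1 := by
    intro i x
    simp only [hgdef]
    split_ifs with h
    · rw [smul_dotProduct, dotProduct_smul, smul_eq_mul, smul_eq_mul, ← mul_assoc, hsR,
        inv_mul_le_iff₀ hR, mul_one]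
      exact h
    · simp
  have hgz : ∀ i x z, (g i x ⬝ᵥ z) ^ 2 ≤ R⁻¹ * (scoreRow (Θ i) x ⬝ᵥ z) ^ 2 := by
    intro i x z
    simp only [hgdef]
    split_ifs with h
    · rw [smul_dotProduct, smul_eq_mul, mul_pow, sq (√R)⁻¹, hsR]
    · simp; positivity
  have hσ : ∀ i z, ∑ x, userWeight (Θ i) x * (g i x ⬝ᵥ z) ^ 2 ≤ k / (d₂ * R) * (z ⬝ᵥ z) := by
    intro i z
    calc _ ≤ ∑ x, R⁻¹ * (userWeight (Θ i) x * (scoreRow (Θ i) x ⬝ᵥ z) ^ 2) := by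
          refine Finset.sum_le_sum fun x _ => ?_
          have := mul_le_mul_of_nonneg_left (hgz i x z) (userWeight_nonneg (Θ i) x)
          linarith
      _ ≤ R⁻¹ * (k / d₂ * (z ⬝ᵥ z)) := by
          rw [← Finset.mul_sum]
          exact mul_le_mul_of_nonneg_left (sum_userWeight_mul_scoreRow_sq _ _) (by positivity)
      _ = _ := by field_simp
  have htrace := sum_expTrace_sum_rank_one (by positivity) (w := fun i => userWeight (Θ i))
    (fun i => userWeight_nonneg (Θ i)) (fun i => sum_userWeight (Θ i)) hg hσ
    (A := 0) (by simp) (by simp)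
  simp only [zero_add, expTrace_zero, Fintype.card_fin] at htrace
  have hexp : (1 + k / (d₂ * R) * (Real.exp 1 - 1)) ^ d₁ ≤
      Real.exp (2 * (d₁ * k / (d₂ * R))) := by
    have h1 : 1 + k / (d₂ * R) * (Real.exp 1 - 1) ≤ Real.exp (2 * (k / (d₂ * R))) := by
      have h2 := Real.add_one_le_exp (2 * (k / (d₂ * R)))
      have h3 := Real.exp_one_lt_d9
      have h4 : (0 : ℝ) ≤ k / (d₂ * R) := by positivity
      nlinarith
    have h0 : 0 ≤ 1 + k / (d₂ * R) * (Real.exp 1 - 1) := by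
      have := Real.add_one_le_exp (1 : ℝ)
      have : (0 : ℝ) ≤ k / (d₂ * R) * (Real.exp 1 - 1) :=
        mul_nonneg (by positivity) (by linarith)
      linarith
    calc _ ≤ Real.exp (2 * (k / (d₂ * R))) ^ d₁ := pow_le_pow_left₀ h0 h1 _
      _ = _ := by rw [← Real.exp_nat_mul]; congr 1; ring
  have hpoint : ∀ x : Fin d₁ → UserData d₂ k,
      {x | ¬ OpBound (scoreMat Θ x) √(R * τ)}.indicator (1 : (Fin d₁ → UserData d₂ k) → ℝ) x ≤
      (∑ i, Real.exp (-(R / (2 * k))) *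
        Real.exp (1 / (2 * k) * (scoreRow (Θ i) (x i) ⬝ᵥ scoreRow (Θ i) (x i)))) +
      Real.exp (-τ) * expTrace (∑ i, vecMulVec (g i (x i)) (g i (x i))) := by
    intro x
    obtain ⟨μ, hμ1, hμ2, -⟩ := exists_top_eigenvalue
      (X := ∑ i, vecMulVec (g i (x i)) (g i (x i))) (by
        rw [transpose_sum]; exact Finset.sum_congr rfl fun i _ => transpose_vecMulVec _ _)
    have hnn1 : 0 ≤ ∑ i, Real.exp (-(R / (2 * k))) *
        Real.exp (1 / (2 * k) * (scoreRow (Θ i) (x i) ⬝ᵥ scoreRow (Θ i) (x i))) :=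
      Finset.sum_nonneg fun i _ => by positivity
    have hnn2 : 0 ≤ Real.exp (-τ) * expTrace (∑ i, vecMulVec (g i (x i)) (g i (x i))) :=
      mul_nonneg (Real.exp_pos _).le ((Real.exp_pos _).le.trans hμ2)
    by_cases hx : OpBound (scoreMat Θ x) √(R * τ)
    · rw [Set.indicator_of_notMem (by simpa using hx)]; positivity
    rw [Set.indicator_of_mem (by simpa using hx), Pi.one_apply]
    by_cases hall : ∀ i, scoreRow (Θ i) (x i) ⬝ᵥ scoreRow (Θ i) (x i) ≤ R
    · have hμτ : τ ≤ μ := by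
        by_contra hlt
        push Not at hlt
        refine hx fun a y => ?_
        have h1 : (scoreMat Θ x *ᵥ y) ⬝ᵥ (scoreMat Θ x *ᵥ y) ≤ (R * τ) * (y ⬝ᵥ y) := by
          have h2 := hμ1 y
          rw [sum_mulVec, dotProduct_sum] at h2
          simp only [dotProduct_vecMulVec_self] at h2
          have h3 : ∀ i, (g i (x i) ⬝ᵥ y) ^ 2 = R⁻¹ * (scoreRow (Θ i) (x i) ⬝ᵥ y) ^ 2 := by
            intro i
            simp only [hgdef]
            rw [if_pos (hall i), smul_dotProduct, smul_eq_mul, mul_pow, sq (√R)⁻¹, hsR]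
          simp only [h3, ← Finset.mul_sum] at h2
          rw [inv_mul_le_iff₀ hR] at h2
          calc _ = ∑ i, (scoreRow (Θ i) (x i) ⬝ᵥ y) ^ 2 :=
                Finset.sum_congr rfl fun i _ => (sq _).symm
            _ ≤ R * (μ * (y ⬝ᵥ y)) := h2
            _ ≤ R * (τ * (y ⬝ᵥ y)) := by
                have := dotProduct_self_nonneg' y
                gcongr
            _ = _ := by ring
        refine (dotProduct_le_sqrt a _).trans ?_
        have h4 := Real.sqrt_le_sqrt h1
        rw [Real.sqrt_mul (by positivity)] at h4
        calc _ ≤ √(a ⬝ᵥ a) * (√(R * τ) * √(y ⬝ᵥ y)) :=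
              mul_le_mul_of_nonneg_left h4 (Real.sqrt_nonneg _)
          _ = _ := by ring
      have h5 : 1 ≤ Real.exp (-τ) * expTrace (∑ i, vecMulVec (g i (x i)) (g i (x i))) := by
        calc (1 : ℝ) ≤ Real.exp (-τ) * Real.exp μ := by
              rw [← Real.exp_add]; exact Real.one_le_exp (by linarith)
          _ ≤ _ := mul_le_mul_of_nonneg_left hμ2 (Real.exp_pos _).le
      linarith
    · push Not at hall
      obtain ⟨i, hi⟩ := hall
      have h6 := Finset.single_le_sum (f := fun i => Real.exp (-(R / (2 * k))) *
        Real.exp (1 / (2 * k) * (scoreRow (Θ i) (x i) ⬝ᵥ scoreRow (Θ i) (x i))))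
        (fun i _ => by positivity) (Finset.mem_univ i)
      have h7 : 1 ≤ Real.exp (-(R / (2 * k))) *
          Real.exp (1 / (2 * k) * (scoreRow (Θ i) (x i) ⬝ᵥ scoreRow (Θ i) (x i))) := by
        rw [← Real.exp_add]
        refine Real.one_le_exp ?_
        have := mul_le_mul_of_nonneg_left hi.le (by positivity : (0 : ℝ) ≤ 1 / (2 * k))
        have e : R / (2 * k) = 1 / (2 * k) * R := by ring
        linarith
      linarith
  have hw0 : ∀ x : Fin d₁ → UserData d₂ k, 0 ≤ prodWeight (fun i => userWeight (Θ i)) x :=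
    prodWeight_nonneg fun i => userWeight_nonneg (Θ i)
  refine (Finset.sum_le_sum fun x _ => mul_le_mul_of_nonneg_left (hpoint x) (hw0 x)).trans ?_
  simp only [mul_add, Finset.sum_add_distrib]
  refine add_le_add ?_ ?_
  · simp only [Finset.mul_sum]
    rw [Finset.sum_comm]
    have h8 : ∀ i, ∑ x : Fin d₁ → UserData d₂ k, prodWeight (fun i => userWeight (Θ i)) x *
        (Real.exp (-(R / (2 * k))) *
          Real.exp (1 / (2 * k) * (scoreRow (Θ i) (x i) ⬝ᵥ scoreRow (Θ i) (x i)))) ≤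
        Real.exp (2 - R / (2 * k)) := by
      intro i
      rw [sum_prodWeight_single (v := fun i => userWeight (k := k) (Θ i))
        (fun i => sum_userWeight (Θ i)) i
        fun z => Real.exp (-(R / (2 * k))) *
          Real.exp (1 / (2 * k) * (scoreRow (Θ i) z ⬝ᵥ scoreRow (Θ i) z))]
      calc _ = Real.exp (-(R / (2 * k))) * ∑ z : UserData d₂ k, userWeight (Θ i) z *
            Real.exp (1 / (2 * k) * (scoreRow (Θ i) z ⬝ᵥ scoreRow (Θ i) z)) := by
            rw [Finset.mul_sum]; exact Finset.sum_congr rfl fun z _ => by ring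
        _ ≤ Real.exp (-(R / (2 * k))) * Real.exp 2 :=
            mul_le_mul_of_nonneg_left (sum_userWeight_mul_exp_scoreRow hk (Θ i))
              (Real.exp_pos _).le
        _ = _ := by rw [← Real.exp_add]; congr 1; ring
    refine (Finset.sum_le_sum fun i _ => h8 i).trans (le_of_eq ?_)
    simp
  · calc _ = Real.exp (-τ) * ∑ x : Fin d₁ → UserData d₂ k, (∏ i, userWeight (Θ i) (x i)) *
          expTrace (∑ i, vecMulVec (g i (x i)) (g i (x i))) := by
          rw [Finset.mul_sum]
          exact Finset.sum_congr rfl fun x _ => by rw [prodWeight]; ring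
      _ ≤ Real.exp (-τ) * (Real.exp (2 * (d₁ * k / (d₂ * R))) * d₂) := by
          refine mul_le_mul_of_nonneg_left (htrace.trans ?_) (Real.exp_pos _).le
          exact mul_le_mul_of_nonneg_right hexp hd.le
      _ = _ := by rw [sub_eq_add_neg, Real.exp_add]; ring

end UserWeight
end KWise

namespace KWise

/-! ### Domination over all users simultaneously. -/

section Replacement

/-- Coordinates are replaced one at a time. When the first is exchanged, the others are already
averaged under the new law, and that average is still monotone because the new weights are
nonnegative. -/
theorem sum_prod_replacement {X₁ X₂ Y : Type*} [Fintype X₁] [Fintype X₂] {rel : Y → Y → Prop}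
    (hrefl : ∀ y, rel y y) {π₁ : X₁ → Y} {π₂ : X₂ → Y} {N : ℕ} {w₁ : Fin N → X₁ → ℝ}
    {w₂ : Fin N → X₂ → ℝ} (hw₁ : ∀ i x, 0 ≤ w₁ i x) (hw₂ : ∀ i x, 0 ≤ w₂ i x)
    (h : ∀ i (f : Y → ℝ), (∀ y y', rel y y' → f y' ≤ f y) →
      ∑ x, w₁ i x * f (π₁ x) ≤ ∑ x, w₂ i x * f (π₂ x))
    {H : (Fin N → Y) → ℝ} (hH : ∀ y y', (∀ i, rel (y i) (y' i)) → H y' ≤ H y) :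
    ∑ x : Fin N → X₁, (∏ i, w₁ i (x i)) * H (fun i => π₁ (x i)) ≤
      ∑ x : Fin N → X₂, (∏ i, w₂ i (x i)) * H (fun i => π₂ (x i)) := by
  induction N with
  | zero =>
    have e : ∀ y y' : Fin 0 → Y, y = y' := fun y y' => Subsingleton.elim _ _
    simp only [Finset.univ_unique, Finset.sum_singleton, Finset.univ_eq_empty, Finset.prod_empty]
    rw [e (fun i => π₁ _) (fun i => π₂ _)]
  | succ N ih =>
    rw [sum_fin_succ_pi, sum_fin_succ_pi]
    simp only [Fin.prod_univ_succ, Fin.cons_zero, Fin.cons_succ, mul_assoc, ← Finset.mul_sum]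
    have e₁ : ∀ a x, (fun i => π₁ ((Fin.cons a x : Fin (N + 1) → X₁) i)) =
          (Fin.cons (π₁ a) (fun i => π₁ (x i)) : Fin (N + 1) → Y) := fun a x => by
      funext i
      refine Fin.cases ?_ (fun j => ?_) i <;> simp
    have e₂ : ∀ a x, (fun i => π₂ ((Fin.cons a x : Fin (N + 1) → X₂) i)) =
          (Fin.cons (π₂ a) (fun i => π₂ (x i)) : Fin (N + 1) → Y) := fun a x => by
      funext i
      refine Fin.cases ?_ (fun j => ?_) i <;> simp
    simp only [e₁, e₂]
    have hcons : ∀ {a b : Y} {y y' : Fin N → Y}, rel a b → (∀ i, rel (y i) (y' i)) →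
        H (Fin.cons b y') ≤ H (Fin.cons a y) := by
      intro a b y y' hab hy
      refine hH _ _ fun i => ?_
      refine Fin.cases ?_ (fun j => ?_) i
      · simpa using hab
      · simpa using hy j
    have h1 : ∀ a, ∑ x : Fin N → X₁, (∏ i, w₁ i.succ (x i)) *
        H (Fin.cons (π₁ a) fun i => π₁ (x i)) ≤ ∑ x : Fin N → X₂, (∏ i, w₂ i.succ (x i)) *
        H (Fin.cons (π₁ a) fun i => π₂ (x i)) := fun a =>
      ih (w₁ := fun i => w₁ i.succ) (w₂ := fun i => w₂ i.succ) (fun i => hw₁ _) (fun i => hw₂ _)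
        (fun i => h i.succ) (H := fun y => H (Fin.cons (π₁ a) y))
        fun y y' hy => hcons (hrefl _) hy
    refine (Finset.sum_le_sum fun a _ => mul_le_mul_of_nonneg_left (h1 a) (hw₁ 0 a)).trans ?_
    refine h 0 (fun y => ∑ x : Fin N → X₂, (∏ i, w₂ i.succ (x i)) *
      H (Fin.cons y fun i => π₂ (x i))) fun y y' hy => ?_
    exact Finset.sum_le_sum fun x _ => mul_le_mul_of_nonneg_left (hcons hy fun i => hrefl _)
      (Finset.prod_nonneg fun i _ => hw₂ _ _)

end Replacement

/-! ### From survivors of the rankings to independent retention. -/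

section Thinning
variable {d₁ d₂ k : ℕ}

/-- The set of retained slots, discarded altogether when fewer than `L` slots are removed. -/
def truncated (L : ℕ) (B : Finset (Fin k)) : Finset (Fin k) :=
  if L ≤ (Finset.univ \ B).card then B else ∅

/-- Subsets of `Fin k` as Boolean vectors. -/
def finsetEquivBool (k : ℕ) : Finset (Fin k) ≃ (Fin k → Bool) where
  toFun B m := decide (m ∈ B)
  invFun b := Finset.univ.filter fun m => b m = true
  left_inv B := by ext; simp
  right_inv b := by funext m; simp

theorem sum_userWeight_survivors_le (θ : Fin d₂ → ℝ) {L : ℕ} (hL : L ≤ k) (c : ℝ) {t : ℝ}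
    (ht : 0 ≤ t) {f : (Fin k → Fin d₂) × Finset (Fin k) → ℝ}
    (hf : ∀ items S S', S ⊆ S' → f (items, S') ≤ f (items, S)) :
    ∑ x : UserData d₂ k, userWeight θ x * f (x.1, survivors x.2 L) ≤
      ∑ y : Fin k → Fin d₂ × Bool, (∏ m, 1 / (d₂ : ℝ) *
        if (y m).2 then Real.exp (-(Real.exp (θ (y m).1 - c) * t))
          else 1 - Real.exp (-(Real.exp (θ (y m).1 - c) * t))) *
        f (fun m => (y m).1, truncated L (Finset.univ.filter fun m => (y m).2 = true)) := by
  have h := sum_userWeight_mul_le (k := k) (θ := θ) (f := fun x => f (x.1, survivors x.2 L))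
    (F := fun items => ∑ B, thinWeight (fun m => Real.exp (-(Real.exp (θ (items m) - c) * t)))
      Finset.univ B * f (items, truncated L B)) (fun items => by
      have h1 := sum_mnlWeight_survivors_le (fun m => θ (items m)) (f := fun S => f (items, S))
        (fun S S' hS => hf items S S' hS) hL c ht
      refine h1.trans (le_of_eq (Finset.sum_congr rfl fun B _ => ?_))
      rw [stopped, truncated]
      split_ifs <;> rfl)
  refine h.trans (le_of_eq ?_)
  rw [← Equiv.sum_comp (Equiv.arrowProdEquivProdArrow (Fin k) (fun _ => Fin d₂) fun _ => Bool).symm,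
    Fintype.sum_prod_type]
  refine Finset.sum_congr rfl fun items _ => ?_
  rw [← Equiv.sum_comp (finsetEquivBool k), Finset.mul_sum]
  refine Finset.sum_congr rfl fun B _ => ?_
  have e : (Finset.univ.filter fun m => finsetEquivBool k B m = true) = B :=
    (finsetEquivBool k).left_inv B
  change _ = (∏ m, 1 / (d₂ : ℝ) * if finsetEquivBool k B m = true
    then Real.exp (-(Real.exp (θ (items m) - c) * t))
    else 1 - Real.exp (-(Real.exp (θ (items m) - c) * t))) *
    f (items, truncated L (Finset.univ.filter fun m => finsetEquivBool k B m = true))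
  rw [e]
  rw [← mul_assoc, prodWeight, thinWeight, ← Finset.prod_mul_distrib]
  simp [finsetEquivBool]

/-- Chernoff's bound at exponent -1: a slot is removed with probability at least p₀, and e⁻¹ ≤ 1/2
bounds its factor by 1 - p₀/2 ≤ e^{-p₀/2}. -/
theorem card_removed_tail [NeZero d₂] {q : Fin d₁ → Fin d₂ → ℝ} (hq0 : ∀ i j, 0 ≤ q i j)
    {p₀ : ℝ} (hq : ∀ i j, q i j ≤ 1 - p₀) (hp₀ : 0 ≤ p₀) (L : ℕ) (i : Fin d₁) :
    ∑ x : Fin d₁ × Fin k → Fin d₂ × Bool, prodWeight (slotWeight d₂ k q) x *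
      {x | (Finset.univ \ retained x i).card < L}.indicator 1 x ≤
      Real.exp (L - p₀ * k / 2) := by
  classical
  have hd : (0 : ℝ) < d₂ := by exact_mod_cast Nat.pos_of_ne_zero (NeZero.ne d₂)
  have hq1 : ∀ i j, q i j ≤ 1 := fun i j => by linarith [hq i j]
  have hw0 : ∀ x, 0 ≤ prodWeight (slotWeight d₂ k q) x :=
    prodWeight_nonneg (slotWeight_nonneg hq0 hq1)
  set h : Fin d₁ × Fin k → Fin d₂ × Bool → ℝ := fun s z =>
    if s.1 = i then (if z.2 then 1 else Real.exp (-1)) else 1 with hh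
  have hprod : ∀ x : Fin d₁ × Fin k → Fin d₂ × Bool, ∏ s, h s (x s) =
      Real.exp (-((Finset.univ \ retained x i).card : ℝ)) := by
    intro x
    rw [Fintype.prod_prod_type, Finset.prod_eq_single i]
    · simp only [hh, if_true]
      have e : Finset.univ \ retained x i = Finset.univ.filter fun m => ¬ (x (i, m)).2 = true := by
        ext m; simp [retained]
      rw [e, ← mul_neg_one ((Finset.card _ : ℕ) : ℝ), Real.exp_nat_mul, ← Finset.prod_const,
        Finset.prod_filter]
      refine Finset.prod_congr rfl fun m _ => ?_
      by_cases hm : (x (i, m)).2 = true <;> simp [hm]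
    · intro i' _ hi'
      simp [hh, hi']
    · simp
  have hpoint : ∀ x : Fin d₁ × Fin k → Fin d₂ × Bool,
      {x | (Finset.univ \ retained x i).card < L}.indicator
        (1 : (Fin d₁ × Fin k → Fin d₂ × Bool) → ℝ) x ≤ Real.exp L * ∏ s, h s (x s) := by
    intro x
    rw [hprod, ← Real.exp_add]
    by_cases hx : (Finset.univ \ retained x i).card < L
    · rw [Set.indicator_of_mem (by exact hx), Pi.one_apply]
      refine Real.one_le_exp ?_
      have : ((Finset.univ \ retained x i).card : ℝ) ≤ L := by exact_mod_cast hx.le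
      linarith
    · rw [Set.indicator_of_notMem (by exact hx)]; positivity
  refine (Finset.sum_le_sum fun x _ => mul_le_mul_of_nonneg_left (hpoint x) (hw0 x)).trans ?_
  have e1 : ∑ x, prodWeight (slotWeight d₂ k q) x * (Real.exp L * ∏ s, h s (x s)) =
      Real.exp L * ∏ s, ∑ z, slotWeight d₂ k q s z * h s z := by
    rw [← sum_prodWeight_mul_prod, Finset.mul_sum]
    exact Finset.sum_congr rfl fun x _ => by ring
  rw [e1, Fintype.prod_prod_type, Finset.prod_eq_single i]
  · have e2 : ∀ m : Fin k, ∑ z, slotWeight d₂ k q (i, m) z * h (i, m) z ≤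
        Real.exp (-(p₀ / 2)) := by
      intro m
      have h1 : ∀ j, ∑ b, slotWeight d₂ k q (i, m) (j, b) * h (i, m) (j, b) ≤
          1 / d₂ * (1 - p₀ / 2) := by
        intro j
        rw [Fintype.sum_bool]
        simp only [slotWeight, hh, if_true, Bool.false_eq_true, if_false, mul_one]
        have h2 : Real.exp (-1) ≤ 1 / 2 := by
          have h3 := Real.add_one_le_exp (1 : ℝ)
          rw [Real.exp_neg, inv_le_comm₀ (Real.exp_pos _) (by norm_num)]
          linarith
        have h4 : 0 ≤ 1 - q i j := by linarith [hq1 i j]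
        rw [mul_assoc, ← mul_add]
        refine mul_le_mul_of_nonneg_left ?_ (by positivity)
        nlinarith [mul_le_mul_of_nonneg_left h2 h4, hq i j]
      rw [Fintype.sum_prod_type]
      refine (Finset.sum_le_sum fun j _ => h1 j).trans ?_
      rw [← Finset.sum_mul, sum_uniform, one_mul]
      linarith [Real.add_one_le_exp (-(p₀ / 2))]
    have hnn : ∀ m : Fin k, 0 ≤ ∑ z, slotWeight d₂ k q (i, m) z * h (i, m) z := fun m =>
      Finset.sum_nonneg fun z _ => mul_nonneg (slotWeight_nonneg hq0 hq1 _ _) (by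
        simp only [hh]; split_ifs <;> positivity)
    have h5 := Finset.prod_le_prod (s := Finset.univ) (fun m _ => hnn m) fun m _ => e2 m
    rw [Finset.prod_const, Finset.card_univ, Fintype.card_fin, ← Real.exp_nat_mul] at h5
    calc _ ≤ Real.exp L * Real.exp (k * -(p₀ / 2)) :=
          mul_le_mul_of_nonneg_left h5 (Real.exp_pos _).le
      _ = _ := by rw [← Real.exp_add]; congr 1; ring
  · intro i' _ hi'
    refine Finset.prod_eq_one fun m _ => ?_
    simp [hh, hi', sum_slotWeight]
  · simp

/-- The graph of 2^(-y) lies below its chord on [0, 1]. -/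
theorem one_sub_exp_ge {y : ℝ} (hy0 : 0 ≤ y) (hy1 : y ≤ 1) :
    Real.exp (-(y * Real.log 2)) ≤ 1 - y / 2 := by
  have h := convexOn_exp.2 (Set.mem_univ (0 : ℝ)) (Set.mem_univ (-Real.log 2))
    (by linarith : 0 ≤ 1 - y) hy0 (by ring)
  rw [Real.exp_neg, Real.exp_log (by norm_num : (0 : ℝ) < 2)] at h
  simp only [smul_eq_mul, mul_zero, zero_add, Real.exp_zero] at h
  rw [show -(y * Real.log 2) = y * -Real.log 2 by ring]
  linarith

/-- The event is decreasing in the surviving sets, so its probability grows when thinning replaces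
the rankings. Under thinning, either some user loses fewer than `L` slots, which gives the last
term, or the truncated sets are the retained ones. -/
theorem pairEnergy_tail [NeZero d₁] [NeZero d₂] {Θ : Matrix (Fin d₁) (Fin d₂) ℝ} {α : ℝ}
    (hΘ : ∀ i j, |Θ i j| ≤ α) {L : ℕ} (hL : L ≤ k) (hk : 2 ≤ k) {ρ y₀ u F₀ : ℝ}
    (hα : 0 < α) (hρ : 0 < ρ) (hy0 : 0 < y₀) (hy1 : y₀ ≤ 1)
    (hu : 4 * d₂ * u ≤ (k / 2 : ℕ) * F₀ ^ 2)
    (D : Set (Matrix (Fin d₁) (Fin d₂) ℝ))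
    (hD : ∀ Δ ∈ D, (∀ i j, |Δ i j| ≤ 2 * α) ∧ (∀ i, ∑ j, Δ i j = 0) ∧ frobNorm Δ = F₀ ∧
      nuclearNorm Δ ≤ ρ) :
    ∑ x : Fin d₁ → UserData d₂ k, prodWeight (fun i => userWeight (Θ i)) x *
        {x | ∃ Δ ∈ D, ∑ i, pairEnergy (survivors (x i).2 L)
          (fun m => Δ i ((x i).1 m)) < u}.indicator 1 x ≤
      2 * (d₁ + d₂) * d₂ *
        Real.exp (y₀ ^ 2 * ((k / 2 : ℕ) + 2 * (d₁ * k) / d₂) - y₀ * u / (16 * α * ρ)) +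
      d₁ * Real.exp (L - Real.exp (-(2 * α)) * k / 4) := by
  classical
  -- The race is stopped at time log 2 with rates in [e^{-2α}, 1]: a slot is kept with probability
  -- at least 1/2 and lost with probability at least e^{-2α}/2.
  set q : Fin d₁ → Fin d₂ → ℝ :=
    fun i j => Real.exp (-(Real.exp (Θ i j - α) * Real.log 2)) with hqdef
  have hlog2 : 0 < Real.log 2 := Real.log_pos (by norm_num)
  have hexp1 : ∀ i j, Real.exp (Θ i j - α) ≤ 1 := fun i j =>
    Real.exp_le_one_iff.2 (by linarith [(abs_le.1 (hΘ i j)).2])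
  have hqhi : ∀ i j, q i j ≤ 1 - Real.exp (-(2 * α)) / 2 := by
    intro i j
    have h1 := one_sub_exp_ge (Real.exp_pos (Θ i j - α)).le (hexp1 i j)
    have h2 : Real.exp (-(2 * α)) ≤ Real.exp (Θ i j - α) :=
      Real.exp_le_exp.2 (by linarith [(abs_le.1 (hΘ i j)).1])
    simp only [hqdef]
    linarith
  have hqlo : ∀ i j, 1 / 2 ≤ q i j := by
    intro i j
    have h1 : Real.exp (-Real.log 2) = 1 / 2 := by
      rw [Real.exp_neg, Real.exp_log (by norm_num)]; norm_num
    rw [← h1]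
    refine Real.exp_le_exp.2 ?_
    nlinarith [hexp1 i j]
  have hq1 : ∀ i j, q i j ≤ 1 := fun i j => by
    linarith [hqhi i j, Real.exp_pos (-(2 * α))]
  have hq0 : ∀ i j, 0 ≤ q i j := fun i j => (Real.exp_pos _).le
  set H : (Fin d₁ → (Fin k → Fin d₂) × Finset (Fin k)) → ℝ :=
    {y | ∃ Δ ∈ D, ∑ i, pairEnergy (y i).2 (fun m => Δ i ((y i).1 m)) < u}.indicator 1 with hHdef
  have hrep := sum_prod_replacement (N := d₁)
    (rel := fun y y' : (Fin k → Fin d₂) × Finset (Fin k) => y.1 = y'.1 ∧ y.2 ⊆ y'.2)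
    (fun y => ⟨rfl, subset_rfl⟩) (π₁ := fun x : UserData d₂ k => (x.1, survivors x.2 L))
    (π₂ := fun y : Fin k → Fin d₂ × Bool =>
      (fun m => (y m).1, truncated L (Finset.univ.filter fun m => (y m).2 = true)))
    (w₁ := fun i => userWeight (Θ i)) (w₂ := fun i y => ∏ m, slotWeight d₂ k q (i, m) (y m))
    (fun i => userWeight_nonneg (Θ i))
    (fun i y => Finset.prod_nonneg fun m _ => slotWeight_nonneg hq0 hq1 _ _)
    (fun i f hf => sum_userWeight_survivors_le (Θ i) hL α hlog2.le
      fun items S S' hS => hf (items, S) (items, S') ⟨rfl, hS⟩)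
    (H := H) (by
      intro y y' hy
      simp only [hHdef]
      by_cases h' : ∃ Δ ∈ D, ∑ i, pairEnergy (y' i).2 (fun m => Δ i ((y' i).1 m)) < u
      · have h : ∃ Δ ∈ D, ∑ i, pairEnergy (y i).2 (fun m => Δ i ((y i).1 m)) < u := by
          obtain ⟨Δ, hΔ, hlt⟩ := h'
          refine ⟨Δ, hΔ, lt_of_le_of_lt (Finset.sum_le_sum fun i _ => ?_) hlt⟩
          rw [(hy i).1]
          exact pairEnergy_mono (hy i).2 _
        rw [Set.indicator_of_mem (by exact h'), Set.indicator_of_mem (by exact h)]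
        exact le_rfl
      · rw [Set.indicator_of_notMem (by exact h')]
        exact Set.indicator_nonneg (fun _ _ => by simp) _)
  have hw0 : ∀ x, 0 ≤ prodWeight (slotWeight d₂ k q) x :=
    prodWeight_nonneg (slotWeight_nonneg hq0 hq1)
  have hrsc := restricted_strong_convexity_tail hqlo hq1 hk hα hρ hy0 hy1 hu D hD
  have hcard := fun i => card_removed_tail (k := k) hq0 hqhi
    (by positivity : (0 : ℝ) ≤ Real.exp (-(2 * α)) / 2) L i
  refine le_trans (le_of_eq ?_) (hrep.trans ?_)
  · rfl
  rw [← Equiv.sum_comp (Equiv.curry (Fin d₁) (Fin k) (Fin d₂ × Bool))]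
  have hpoint : ∀ x : Fin d₁ × Fin k → Fin d₂ × Bool,
      (∏ i, ∏ m, slotWeight d₂ k q (i, m) (Equiv.curry _ _ _ x i m)) *
        H (fun i => (fun m => (Equiv.curry _ _ _ x i m).1,
          truncated L (Finset.univ.filter fun m => (Equiv.curry _ _ _ x i m).2 = true))) ≤
      prodWeight (slotWeight d₂ k q) x * {x | ∃ Δ ∈ D, ∑ i, pairEnergy (retained x i)
        (fun m => Δ i (x (i, m)).1) < u}.indicator 1 x +
      ∑ i, prodWeight (slotWeight d₂ k q) x *
        {x | (Finset.univ \ retained x i).card < L}.indicator 1 x := by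
    intro x
    have e : ∏ i, ∏ m, slotWeight d₂ k q (i, m) (Equiv.curry _ _ _ x i m) =
        prodWeight (slotWeight d₂ k q) x := by
      rw [prodWeight, Fintype.prod_prod_type]; rfl
    rw [e, ← Finset.mul_sum, ← mul_add]
    refine mul_le_mul_of_nonneg_left ?_ (hw0 x)
    have hn1 : 0 ≤ {x | ∃ Δ ∈ D, ∑ i, pairEnergy (retained x i)
        (fun m => Δ i (x (i, m)).1) < u}.indicator
        (1 : (Fin d₁ × Fin k → Fin d₂ × Bool) → ℝ) x :=
      Set.indicator_nonneg (fun _ _ => by simp) _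
    have hn2 : ∀ i, 0 ≤ {x | (Finset.univ \ retained x i).card < L}.indicator
        (1 : (Fin d₁ × Fin k → Fin d₂ × Bool) → ℝ) x := fun i =>
      Set.indicator_nonneg (fun _ _ => by simp) _
    have hn3 := Finset.sum_nonneg fun i (_ : i ∈ Finset.univ) => hn2 i
    have hH1 : ∀ y, H y ≤ 1 := fun y =>
      Set.indicator_le_self' (fun _ _ => by simp) y
    by_cases hall : ∀ i, L ≤ (Finset.univ \ retained x i).card
    · have e2 : ∀ i, truncated L (retained x i) = retained x i := fun i => if_pos (hall i)
      refine le_trans (le_of_eq ?_) (le_add_of_nonneg_right hn3)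
      simp only [hHdef, Set.indicator_apply, Set.mem_ofPred_eq]
      have e3 : ∀ i, truncated L (Finset.univ.filter fun m =>
          (Equiv.curry _ _ _ x i m).2 = true) = retained x i := e2
      simp only [e3]
      rfl
    · push Not at hall
      obtain ⟨i, hi⟩ := hall
      have h1 := Finset.single_le_sum (fun i _ => hn2 i) (Finset.mem_univ i)
      rw [Set.indicator_of_mem (by exact hi), Pi.one_apply] at h1
      linarith [hH1 (fun i => (fun m => (Equiv.curry _ _ _ x i m).1,
          truncated L (Finset.univ.filter fun m => (Equiv.curry _ _ _ x i m).2 = true)))]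
  refine (Finset.sum_le_sum fun x _ => hpoint x).trans ?_
  rw [Finset.sum_add_distrib]
  refine add_le_add hrsc ?_
  rw [Finset.sum_comm]
  refine (Finset.sum_le_sum fun i _ => hcard i).trans (le_of_eq ?_)
  rw [Finset.sum_const, Finset.card_univ, Fintype.card_fin, nsmul_eq_mul]
  congr 2
  ring

end Thinning
end KWise

namespace KWise

/-! ### The sampling measure as a finite weighted sum. -/

section Law
variable {d₁ d₂ k : ℕ}

theorem userLaw_apply [NeZero d₂] (θ : Fin d₂ → ℝ) (x : UserData d₂ k) :
    userLaw k θ x = ENNReal.ofReal (userWeight θ x) := by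
  obtain ⟨items, σ⟩ := x
  have h1 : ∀ items' : Fin k → Fin d₂,
      ((mnlLaw fun ℓ => θ (items' ℓ)).map fun σ => (items', σ)) (items, σ) =
      if items' = items then ENNReal.ofReal (mnlWeight (fun m => θ (items m)) σ) else 0 := by
    intro items'
    rw [PMF.map_apply, tsum_fintype]
    by_cases h : items' = items
    · subst h
      rw [if_pos rfl, Finset.sum_eq_single σ]
      · simp [mnlLaw]
      · intro σ' _ hσ'
        rw [if_neg]
        intro h
        exact hσ' (Prod.ext_iff.1 h).2.symm
      · simp
    · rw [if_neg h]
      refine Finset.sum_eq_zero fun σ' _ => ?_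
      rw [if_neg]
      intro h'
      exact h (Prod.ext_iff.1 h').1.symm
  have hd : (0 : ℝ) < d₂ := by exact_mod_cast Nat.pos_of_ne_zero (NeZero.ne d₂)
  rw [userLaw, PMF.bind_apply, tsum_fintype]
  simp only [h1, mul_ite, mul_zero, Finset.sum_ite_eq', Finset.mem_univ, if_true]
  rw [PMF.uniformOfFintype_apply, userWeight, ENNReal.ofReal_mul (by positivity)]
  congr 1
  rw [Fintype.card_fun, Fintype.card_fin, Fintype.card_fin, one_div, inv_pow,
    ENNReal.ofReal_inv_of_pos (by positivity), ENNReal.ofReal_pow hd.le]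
  simp

instance : DiscreteMeasurableSpace (Equiv.Perm (Fin k)) := ⟨fun _ => trivial⟩

theorem sampleLaw_real_eq_sum [NeZero d₂] (Θ : Matrix (Fin d₁) (Fin d₂) ℝ)
    (A : Set (Fin d₁ → UserData d₂ k)) :
    (sampleLaw k Θ).real A =
      ∑ x, prodWeight (fun i => userWeight (Θ i)) x * A.indicator 1 x := by
  classical
  have h1 : ∀ x : Fin d₁ → UserData d₂ k,
      (sampleLaw k Θ).real {x} = prodWeight (fun i => userWeight (Θ i)) x := by
    intro x
    rw [Measure.real, sampleLaw, Measure.pi_singleton, ENNReal.toReal_prod, prodWeight]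
    refine Finset.prod_congr rfl fun i _ => ?_
    rw [PMF.toMeasure_apply_singleton _ _ (MeasurableSet.singleton _), userLaw_apply,
      ENNReal.toReal_ofReal (userWeight_nonneg _ _)]
  have : IsFiniteMeasure (sampleLaw k Θ) := by rw [sampleLaw]; infer_instance
  have h2 := sum_measureReal_singleton (μ := sampleLaw k Θ) A.toFinite.toFinset
  rw [Set.Finite.coe_toFinset] at h2
  rw [← h2]
  simp only [h1, Set.indicator_apply, Pi.one_apply, mul_ite, mul_one, mul_zero]
  rw [← Finset.sum_filter]
  refine Finset.sum_congr ?_ fun _ _ => rfl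
  ext; simp

theorem le_sampleLaw_real [NeZero d₂] {Θ : Matrix (Fin d₁) (Fin d₂) ℝ}
    {A B C : Set (Fin d₁ → UserData d₂ k)} {b c : ℝ} (h : ∀ x, x ∉ B → x ∉ C → x ∈ A)
    (hB : ∑ x, prodWeight (fun i => userWeight (Θ i)) x * B.indicator 1 x ≤ b)
    (hC : ∑ x, prodWeight (fun i => userWeight (Θ i)) x * C.indicator 1 x ≤ c) :
    1 - (b + c) ≤ (sampleLaw k Θ).real A := by
  rw [sampleLaw_real_eq_sum]
  have h1 := sum_prodWeight (v := fun i => userWeight (k := k) (Θ i)) fun i => sum_userWeight (Θ i)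
  have h2 : ∑ x : Fin d₁ → UserData d₂ k, prodWeight (fun i => userWeight (Θ i)) x ≤
      ∑ x, prodWeight (fun i => userWeight (Θ i)) x * B.indicator 1 x +
      ∑ x, prodWeight (fun i => userWeight (Θ i)) x * C.indicator 1 x +
      ∑ x, prodWeight (fun i => userWeight (Θ i)) x * A.indicator 1 x := by
    rw [← Finset.sum_add_distrib, ← Finset.sum_add_distrib]
    refine Finset.sum_le_sum fun x _ => ?_
    rw [← mul_add, ← mul_add]
    refine le_mul_of_one_le_right (prodWeight_nonneg (fun i => userWeight_nonneg (Θ i)) x) ?_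
    have hn : ∀ S : Set (Fin d₁ → UserData d₂ k),
        0 ≤ S.indicator (1 : (Fin d₁ → UserData d₂ k) → ℝ) x :=
      fun S => Set.indicator_nonneg (fun _ _ => by simp) x
    by_cases hxB : x ∈ B
    · rw [Set.indicator_of_mem hxB, Pi.one_apply]; linarith [hn A, hn C]
    by_cases hxC : x ∈ C
    · rw [Set.indicator_of_mem hxC, Pi.one_apply]; linarith [hn A, hn B]
    rw [Set.indicator_of_mem (h x hxB hxC), Pi.one_apply]; linarith [hn B, hn C]
  linarith

theorem frobNorm_le_of_abs_le {A : Matrix (Fin d₁) (Fin d₂) ℝ} {c : ℝ} (hc : 0 ≤ c)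
    (hA : ∀ i j, |A i j| ≤ c) : frobNorm A ≤ c * √((d₁ : ℝ) * d₂) := by
  rw [frobNorm_eq, ← Real.sqrt_sq hc, ← Real.sqrt_mul (sq_nonneg c)]
  refine Real.sqrt_le_sqrt ?_
  rw [matInner_eq_sum]
  calc _ ≤ ∑ _ : Fin d₁, ∑ _ : Fin d₂, c ^ 2 := by
        refine Finset.sum_le_sum fun i _ => Finset.sum_le_sum fun j _ => ?_
        rw [← sq, ← sq_abs]
        exact pow_le_pow_left₀ (abs_nonneg _) (hA i j) 2
    _ = _ := by simp; ring

end Law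

/-! ### Numerical inequalities. -/

section Numerics

/-- The regime in which the claimed error bound is not trivial. -/
theorem sample_size_of_nontrivial {α c₀ ld D₁ X r k : ℝ} (hα : 0 < α) (hc₀ : 32 < c₀)
    (hr : 1 ≤ r) (hk : 0 < k) (hD₁ : 0 < D₁) (hld : 0 < ld) (hX : D₁ * ld ≤ X)
    (h : 288 * √2 * Real.exp (6 * α) * c₀ * √(r * X / (k * D₁)) < 2 * α) :
    10 ^ 9 * (Real.exp (2 * α) * ld) ≤ k := by
  have hX0 : 0 < X := lt_of_lt_of_le (by positivity) hX
  have h1 := pow_lt_pow_left₀ h (by positivity) two_ne_zero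
  have e : (288 * √2 * Real.exp (6 * α) * c₀ * √(r * X / (k * D₁))) ^ 2 =
      165888 * c₀ ^ 2 * Real.exp (6 * α) ^ 2 * (r * X / (k * D₁)) := by
    rw [mul_pow, mul_pow, mul_pow, mul_pow, Real.sq_sqrt (by positivity),
      Real.sq_sqrt (by positivity)]
    ring
  rw [e] at h1
  have h2 : ld / k ≤ r * X / (k * D₁) := by
    rw [div_le_div_iff₀ hk (by positivity)]
    nlinarith [mul_le_mul_of_nonneg_right hr hX0.le]
  have h3 : (1024 : ℝ) ≤ c₀ ^ 2 := by nlinarith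
  -- Since e^{5α} ≥ 5α, the factor e^{12α} yields α²e^{2α}, and α² then cancels. The constants give
  -- 288²·2·1024·25/4 > 10⁹.
  have h4 : 25 * α ^ 2 * Real.exp (2 * α) ≤ Real.exp (6 * α) ^ 2 := by
    have h5 := Real.add_one_le_exp (5 * α)
    have e2 : Real.exp (6 * α) ^ 2 = Real.exp (5 * α) ^ 2 * Real.exp (2 * α) := by
      rw [← Real.exp_nat_mul, ← Real.exp_nat_mul, ← Real.exp_add]; congr 1; push_cast; ring
    rw [e2]
    refine mul_le_mul_of_nonneg_right ?_ (Real.exp_pos _).le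
    nlinarith
  have h6 : 165888 * 1024 * (25 * α ^ 2 * Real.exp (2 * α)) * (ld / k) < (2 * α) ^ 2 := by
    refine lt_of_le_of_lt ?_ h1
    gcongr
  rw [mul_div_assoc', div_lt_iff₀ hk] at h6
  have hα2 : 0 < α ^ 2 := by positivity
  have h7 : α ^ 2 * (10 ^ 9 * (Real.exp (2 * α) * ld)) ≤ α ^ 2 * k := by
    have : 0 ≤ α ^ 2 * Real.exp (2 * α) * ld := by positivity
    nlinarith
  exact le_of_mul_le_mul_left h7 hα2

/-- The deviation term of the energy bound at the chosen radius. The value 12 log d leaves 10 log d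
once the variance term, at most 2 log d, is paid. The 55296 below is 288·6·32, from e^{6α} ≥ 6α and
c₀ > 32. -/
theorem slice_exponent {α c₀ ld D₁ D₂ X r k K s δ y₀ : ℝ} (hα : 0 < α) (hc₀ : 32 < c₀)
    (hr : 0 < r) (hk : 0 < k) (hK : k / 3 ≤ K) (hD₁ : 0 < D₁) (hD₂ : 0 < D₂) (hld : 0 < ld)
    (hX : ld * (D₁ + D₂) ≤ X) (hs : s = √(r * X / (k * D₁)))
    (hδ : δ = 288 * √2 * Real.exp (6 * α) * c₀ * s) (hy₀ : y₀ = √(ld * D₂ / (k * (D₁ + D₂)))) :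
    12 * ld ≤ y₀ * (K * δ ^ 2 * D₁ / 4) / (16 * α * (6 * (√r * (δ * √(D₁ * D₂))))) := by
  have hX0 : 0 < X := lt_of_lt_of_le (by positivity) hX
  have hs0 : 0 < s := by rw [hs]; positivity
  have hy0 : 0 < y₀ := by rw [hy₀]; positivity
  have hδ0 : 0 < δ := by rw [hδ]; positivity
  have hK0 : 0 < K := lt_of_lt_of_le (by positivity) hK
  have h1 : 55296 * α * s ≤ δ := by
    rw [hδ]
    have h2 : 1 ≤ √2 := Real.one_le_sqrt.2 (by norm_num)
    have h3 : 6 * α ≤ Real.exp (6 * α) := by linarith [Real.add_one_le_exp (6 * α)]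
    refine mul_le_mul_of_nonneg_right ?_ hs0.le
    calc 55296 * α = 288 * 1 * (6 * α) * 32 := by ring
      _ ≤ _ := by gcongr
  have h2 : ld * (√r * √(D₁ * D₂)) ≤ y₀ * s * k * D₁ := by
    refine (pow_le_pow_iff_left₀ (by positivity) (by positivity) two_ne_zero).1 ?_
    rw [mul_pow, mul_pow, mul_pow, mul_pow, mul_pow, hs, hy₀, Real.sq_sqrt hr.le,
      Real.sq_sqrt (by positivity), Real.sq_sqrt (by positivity), Real.sq_sqrt (by positivity)]
    have e : ld * D₂ / (k * (D₁ + D₂)) * (r * X / (k * D₁)) * k ^ 2 * D₁ ^ 2 =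
        (ld * D₂ * r * D₁) * X / (D₁ + D₂) := by field_simp
    rw [e, le_div_iff₀ (by positivity)]
    calc _ = (ld * D₂ * r * D₁) * (ld * (D₁ + D₂)) := by ring
      _ ≤ _ := mul_le_mul_of_nonneg_left hX (by positivity)
  rw [le_div_iff₀ (by positivity)]
  have h3 : 18432 * α * k * s ≤ K * δ := by
    calc 18432 * α * k * s = k / 3 * (55296 * α * s) := by ring
      _ ≤ _ := by gcongr
  have h4 : 4608 * α * (ld * (√r * √(D₁ * D₂))) ≤ 18432 / 4 * α * (y₀ * s * k * D₁) := by
    nlinarith [mul_le_mul_of_nonneg_left h2 hα.le]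
  have h5 : 18432 * α * k * s * (y₀ * D₁) ≤ K * δ * (y₀ * D₁) :=
    mul_le_mul_of_nonneg_right h3 (by positivity)
  have h7 : 0 ≤ α * k * s * (y₀ * D₁) := by positivity
  have h6 : 1152 * 4 * α * (ld * (√r * √(D₁ * D₂))) ≤ K * δ * (y₀ * D₁) := by nlinarith
  have h8 := mul_le_mul_of_nonneg_right h6 (by positivity : 0 ≤ δ / 4)
  calc _ = 1152 * 4 * α * (ld * (√r * √(D₁ * D₂))) * (δ / 4) := by ring
    _ ≤ _ := h8
    _ = _ := by ring

/-- This inequality fixes the radius. The factor e^{6α} pays for e^{2α} in λ, e^{-2α} in the number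
L of usable choices and e^{-2α} in the curvature; the constant 288√2 leaves a margin above 1. -/
theorem curvature_dominates {α c₀ lam D₁ D₂ X r k K L s δ : ℝ} (hc₀ : 32 < c₀)
    (hr : 0 < r) (hk : 0 < k) (hK : 49 / 100 * k ≤ K)
    (hL : 19 / 100 * (k * Real.exp (-(2 * α))) ≤ L)
    (hD₁ : 0 < D₁) (hD₂ : 0 < D₂) (hX : 0 < X) (hs : s = √(r * X / (k * D₁)))
    (hδ : δ = 288 * √2 * Real.exp (6 * α) * c₀ * s)
    (hlam : lam ≤ c₀ * (Real.exp (2 * α) * √(X / (k * D₁ ^ 2 * D₂)))) :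
    2 * lam * √r * (δ * √(D₁ * D₂)) <
      1 / (k * D₁) * (L * (Real.exp (-(2 * α)) / (4 * k))) * (K * δ ^ 2 * D₁ / 4) := by
  have hs0 : 0 < s := by rw [hs]; positivity
  have hδ0 : 0 < δ := by rw [hδ]; positivity
  have e1 : √(X / (k * D₁ ^ 2 * D₂)) * √r * √(D₁ * D₂) = s := by
    rw [hs, ← Real.sqrt_mul (by positivity), ← Real.sqrt_mul (by positivity)]
    congr 1; field_simp
  have h1 : 2 * lam * √r * (δ * √(D₁ * D₂)) ≤ 2 * c₀ * Real.exp (2 * α) * s * δ := by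
    calc _ ≤ 2 * (c₀ * (Real.exp (2 * α) * √(X / (k * D₁ ^ 2 * D₂)))) * √r * (δ * √(D₁ * D₂)) := by
          gcongr
      _ = 2 * c₀ * Real.exp (2 * α) * (√(X / (k * D₁ ^ 2 * D₂)) * √r * √(D₁ * D₂)) * δ := by ring
      _ = _ := by rw [e1]
  refine lt_of_le_of_lt h1 ?_
  have hsq2 : 14 / 10 ≤ √2 := Real.le_sqrt_of_sq_le (by norm_num)
  have h2 : 288 * (14 / 10) * Real.exp (6 * α) * c₀ * s ≤ δ := by
    rw [hδ]; gcongr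
  set E := Real.exp (2 * α) with hE
  have hE0 : 0 < E := Real.exp_pos _
  have e2 : Real.exp (-(2 * α)) = E⁻¹ := Real.exp_neg _
  have e3 : Real.exp (6 * α) = E ^ 3 := by rw [hE, ← Real.exp_nat_mul]; congr 1; push_cast; ring
  rw [e2] at hL ⊢
  rw [e3] at h2
  have hK0 : 0 < K := lt_of_lt_of_le (by positivity) hK
  have hL0 : 0 < L := lt_of_lt_of_le (by positivity) hL
  have e4 : 1 / (k * D₁) * (L * (E⁻¹ / (4 * k))) * (K * δ ^ 2 * D₁ / 4) =
      L * K * E⁻¹ / (16 * k ^ 2) * δ * δ := by field_simp; ring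
  rw [e4]
  refine mul_lt_mul_of_pos_right ?_ hδ0
  calc 2 * c₀ * E * s < 2 * c₀ * E * s * (144 * (14 / 10) * (19 / 100) * (49 / 100) / 16) := by
        refine lt_mul_of_one_lt_right (by positivity) (by norm_num)
    _ = 19 / 100 * (k * E⁻¹) * (49 / 100 * k) * E⁻¹ / (16 * k ^ 2) *
        (288 * (14 / 10) * E ^ 3 * c₀ * s) := by field_simp; ring
    _ ≤ _ := by gcongr

end Numerics
end KWise

namespace KWise

theorem gradient_threshold {α lam D₁ D₂ X k : ℝ} (hα : 0 ≤ α) (hk : 0 < k) (hD₁ : 0 < D₁)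
    (hD₂ : 0 < D₂) (hX : 0 < X) (hlam : 32 * (Real.exp (2 * α) * √(X / (k * D₁ ^ 2 * D₂))) ≤ lam) :
    1 / (k * D₁) * √(256 * k * X / D₂) ≤ lam / 2 := by
  have h1 : 1 / (k * D₁) * √(256 * k * X / D₂) = 16 * √(X / (k * D₁ ^ 2 * D₂)) := by
    refine (pow_left_inj₀ (by positivity) (by positivity) two_ne_zero).1 ?_
    rw [mul_pow, mul_pow, Real.sq_sqrt (by positivity), Real.sq_sqrt (by positivity)]
    field_simp; norm_num
  have h2 : 1 * √(X / (k * D₁ ^ 2 * D₂)) ≤ Real.exp (2 * α) * √(X / (k * D₁ ^ 2 * D₂)) :=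
    mul_le_mul_of_nonneg_right (Real.one_le_exp (by positivity)) (Real.sqrt_nonneg _)
  rw [h1]; linarith

/-- With R = 10k log d the rows exceed R with probability of order e^{-5 log d} each. The level
25.6(d₁/d₂ + log d) beats the mean of the Gram matrix and the dimension factor. -/
theorem gradient_failure {ld D₁ D₂ X k : ℝ} (hk : 0 < k) (hD₁ : 0 < D₁) (hD₂ : 0 < D₂)
    (hld : 4 ≤ ld) (hX : X = D₁ * ld + D₂ * ld ^ 2) (h1 : D₁ ≤ 2 * Real.exp ld)
    (h2 : D₂ ≤ 2 * Real.exp ld) :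
    D₁ * Real.exp (2 - 10 * k * ld / (2 * k)) +
      D₂ * Real.exp (2 * (D₁ * k / (D₂ * (10 * k * ld))) - 256 * k * X / D₂ / (10 * k * ld)) ≤
      Real.exp (-3 * ld) := by
  have hld0 : 0 < ld := by linarith
  have e1 : 2 - 10 * k * ld / (2 * k) = 2 - 5 * ld := by field_simp; ring
  have e2 : 2 * (D₁ * k / (D₂ * (10 * k * ld))) - 256 * k * X / D₂ / (10 * k * ld) ≤
      2 - 5 * ld := by
    have e3 : 256 * k * X / D₂ / (10 * k * ld) = 25.6 * (D₁ / D₂) + 25.6 * ld := by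
      rw [hX]; field_simp; norm_num
    have e4 : 2 * (D₁ * k / (D₂ * (10 * k * ld))) = D₁ / D₂ * (1 / (5 * ld)) := by
      field_simp; norm_num
    have e5 : 1 / (5 * ld) ≤ 1 := by rw [div_le_one (by positivity)]; linarith
    have e6 : 0 < D₁ / D₂ := by positivity
    rw [e3, e4]
    nlinarith
  rw [e1]
  have h4 : Real.exp (-2 : ℝ) ≤ 1 / 4 := by
    have h5 := Real.exp_one_gt_d9
    have h6 : Real.exp 2 = Real.exp 1 ^ 2 := by rw [← Real.exp_nat_mul]; norm_num
    rw [Real.exp_neg, inv_le_comm₀ (Real.exp_pos _) (by norm_num), h6]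
    nlinarith
  have h3 : ∀ D e, D ≤ 2 * Real.exp ld → e ≤ 2 - 5 * ld →
      D * Real.exp e ≤ 1 / 2 * Real.exp (-3 * ld) := by
    intro D e hD he
    calc D * Real.exp e ≤ 2 * Real.exp ld * Real.exp (-2 + -4 * ld) := by
          gcongr; linarith
      _ = 2 * Real.exp (-2) * Real.exp (-3 * ld) := by
          rw [mul_assoc, mul_assoc, ← Real.exp_add, ← Real.exp_add]; congr 2; ring
      _ ≤ 2 * (1 / 4) * Real.exp (-3 * ld) := by gcongr
      _ = _ := by ring
  have := h3 D₁ _ h1 le_rfl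
  have := h3 D₂ _ h2 e2
  linarith

theorem energy_failure {ld D₁ D₂ e e' : ℝ} (hD₂ : 0 < D₂)
    (hld : 4 ≤ ld) (h1 : D₁ ≤ 2 * Real.exp ld) (h2 : D₂ ≤ 2 * Real.exp ld)
    (he : e ≤ -10 * ld) (he' : e' ≤ -10 * ld) :
    2 * (D₁ + D₂) * D₂ * Real.exp e + D₁ * Real.exp e' ≤ Real.exp (-3 * ld) := by
  have h3 : 2 * (D₁ + D₂) * D₂ * Real.exp e ≤
      2 * (2 * Real.exp ld + 2 * Real.exp ld) * (2 * Real.exp ld) * Real.exp (-10 * ld) := by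
    gcongr
  have h4 : D₁ * Real.exp e' ≤ 2 * Real.exp ld * Real.exp (-10 * ld) := by gcongr
  have e1 : 2 * (2 * Real.exp ld + 2 * Real.exp ld) * (2 * Real.exp ld) * Real.exp (-10 * ld) =
      16 * (Real.exp (-5 * ld) * Real.exp (-3 * ld)) := by
    have : Real.exp ld * Real.exp ld * Real.exp (-10 * ld) =
        Real.exp (-5 * ld) * Real.exp (-3 * ld) := by
      rw [← Real.exp_add, ← Real.exp_add, ← Real.exp_add]; congr 1; ring
    linear_combination 16 * this
  have e2 : 2 * Real.exp ld * Real.exp (-10 * ld) =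
      2 * (Real.exp (-6 * ld) * Real.exp (-3 * ld)) := by
    rw [mul_assoc, ← Real.exp_add, ← Real.exp_add]; congr 2; ring
  have h5 : ∀ y : ℝ, y ≤ -20 → Real.exp y ≤ 1 / 21 := by
    intro y hy
    have h6 := Real.add_one_le_exp (-y)
    have h7 : Real.exp y = (Real.exp (-y))⁻¹ := by rw [Real.exp_neg, inv_inv]
    rw [h7, inv_le_comm₀ (Real.exp_pos _) (by norm_num)]
    linarith
  have h8 := h5 (-5 * ld) (by linarith)
  have h9 := h5 (-6 * ld) (by linarith)
  have h10 := Real.exp_pos (-3 * ld)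
  rw [e1] at h3
  rw [e2] at h4
  nlinarith

variable {d₁ d₂ : ℕ}

theorem dynamicRange_eq_zero_of_rank {Θ : Matrix (Fin d₁) (Fin d₂) ℝ} (h : Θ.rank = 0) :
    dynamicRange Θ = 0 := by
  have : Θ = 0 := by
    rw [Matrix.rank, Submodule.finrank_eq_zero, LinearMap.range_eq_bot] at h
    ext i j
    have h1 := congrFun (LinearMap.congr_fun h (Pi.single j 1)) i
    simpa using h1
  rw [this, dynamicRange]
  simp

end KWise

/-! ### The main theorem. -/

theorem corollary1 {d₁ d₂ : ℕ} [NeZero d₁] [NeZero d₂] (k r : ℕ)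
    (Θstar : Matrix (Fin d₁) (Fin d₂) ℝ)
    (hrow : ∀ i, ∑ j, Θstar i j = 0)
    (hrank : Θstar.rank ≤ r)
    (hk : 24 ≤ k)
    (hk' : (k : ℝ) ≤ min ((d₁ : ℝ) ^ 2) (((d₁ : ℝ) ^ 2 + (d₂ : ℝ) ^ 2) / (2 * d₁)) *
      Real.log (KWise.avgDim d₁ d₂))
    (c₀ lam : ℝ) (hc₀ : 32 < c₀)
    (hlam : lam ∈ Set.Icc (32 * KWise.lambda0 d₁ d₂ k (KWise.dynamicRange Θstar))
      (c₀ * KWise.lambda0 d₁ d₂ k (KWise.dynamicRange Θstar))) :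
    1 - 2 * KWise.avgDim d₁ d₂ ^ (-3 : ℤ) ≤
      (KWise.sampleLaw k Θstar).real
        {x | ∀ Θhat : Matrix (Fin d₁) (Fin d₂) ℝ,
          KWise.IsEstimate (KWise.dynamicRange Θstar) lam x Θhat →
          1 / √((d₁ : ℝ) * d₂) * KWise.frobNorm (Θhat - Θstar) ≤
            288 * √2 * Real.exp (6 * KWise.dynamicRange Θstar) * c₀ *
              √(r * (d₁ * Real.log (KWise.avgDim d₁ d₂) +
                d₂ * Real.log (KWise.avgDim d₁ d₂) ^ 2) / (k * d₁))} := by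
  set α := KWise.dynamicRange Θstar with hα
  set d := KWise.avgDim d₁ d₂ with hd
  set ld := Real.log d with hld
  set X : ℝ := d₁ * ld + d₂ * ld ^ 2 with hX
  set δ := 288 * √2 * Real.exp (6 * α) * c₀ * √(r * X / (k * d₁)) with hδ
  have hD₁ : (0 : ℝ) < d₁ := by exact_mod_cast Nat.pos_of_ne_zero (NeZero.ne d₁)
  have hD₂ : (0 : ℝ) < d₂ := by exact_mod_cast Nat.pos_of_ne_zero (NeZero.ne d₂)
  clear_value α δ X ld d
  have hd0 : 0 < d := by rw [hd, KWise.avgDim]; positivity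
  have hk0 : (0 : ℝ) < k := by exact_mod_cast (by omega : 0 < k)
  have hk24 : (24 : ℝ) ≤ k := by exact_mod_cast hk
  have hsq : 0 < √((d₁ : ℝ) * d₂) := by positivity
  have hmin : 0 ≤ min ((d₁ : ℝ) ^ 2) (((d₁ : ℝ) ^ 2 + (d₂ : ℝ) ^ 2) / (2 * d₁)) :=
    le_min (by positivity) (by positivity)
  have hld0 : 0 < ld := by
    by_contra hneg
    have := mul_nonpos_of_nonneg_of_nonpos hmin (not_lt.1 hneg)
    linarith
  have hkd : (k : ℝ) ≤ (d₁ : ℝ) ^ 2 * ld :=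
    hk'.trans (mul_le_mul_of_nonneg_right (min_le_left _ _) hld0.le)
  have hX0 : 0 < X := by rw [hX]; positivity
  have hα0 : 0 ≤ α := (abs_nonneg _).trans (by rw [hα]; exact KWise.abs_le_dynamicRange hrow 0 0)
  have habs : ∀ i j, |Θstar i j| ≤ α := by rw [hα]; exact KWise.abs_le_dynamicRange hrow
  have hfeas : Θstar ∈ KWise.feasible d₁ d₂ α := ⟨habs, hrow⟩
  -- All entries of Θhat - Θ* are at most 2α, so the claim holds on every sample when δ ≥ 2α.
  rcases le_or_gt (2 * α) δ with htriv | hnontriv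
  · have hpos : 0 ≤ d ^ (-3 : ℤ) := by positivity
    refine le_trans (by linarith : _ ≤ 1 - ((0 : ℝ) + 0)) (KWise.le_sampleLaw_real (B := ∅) (C := ∅)
      (fun x _ _ Θhat hx => ?_) (by simp) (by simp))
    have h1 := KWise.frobNorm_le_of_abs_le (A := Θhat - Θstar) (c := 2 * α) (by positivity)
      (fun i j => by
        rw [Matrix.sub_apply]
        exact (abs_sub _ _).trans (by linarith [hx.1.1 i j, habs i j]))
    rw [one_div, inv_mul_le_iff₀ hsq, mul_comm]
    exact h1.trans (mul_le_mul_of_nonneg_right htriv hsq.le)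
  have hδ0 : 0 ≤ δ := by rw [hδ]; positivity
  have hαpos : 0 < α := by linarith
  have hr1 : 1 ≤ r := by
    by_contra hr
    have h0 : Θstar.rank = 0 := by omega
    have := KWise.dynamicRange_eq_zero_of_rank h0
    rw [← hα] at this
    linarith
  have hr1' : (1 : ℝ) ≤ r := by exact_mod_cast hr1
  have hr0 : (0 : ℝ) < r := by linarith
  have hbigk := KWise.sample_size_of_nontrivial hαpos hc₀ hr1' hk0 hD₁ hld0
    (by rw [hX]; linarith [mul_pos hD₂ (pow_pos hld0 2)]) (hδ ▸ hnontriv)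
  have hexp1 : 1 ≤ Real.exp (2 * α) := Real.one_le_exp (by positivity)
  have hkld : 10 ^ 9 * ld ≤ k := by
    have := mul_le_mul_of_nonneg_right hexp1 hld0.le
    linarith
  -- Comparing 10⁹ log d ≤ k with k ≤ d₁² log d forces d₁ to be large, and then log d ≥ 4.
  have hd₁big : (30000 : ℝ) ≤ d₁ := by
    have h1 : (10 ^ 9 : ℝ) * ld ≤ (d₁ : ℝ) ^ 2 * ld := hkld.trans hkd
    have h2 := le_of_mul_le_mul_right h1 hld0
    by_contra hlt
    push Not at hlt
    have := pow_lt_pow_left₀ hlt hD₁.le two_ne_zero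
    linarith
  have hld4 : 4 ≤ ld := by
    rw [hld, Real.le_log_iff_exp_le hd0]
    have h1 : Real.exp 4 = Real.exp 1 ^ 4 := by rw [← Real.exp_nat_mul]; norm_num
    have h2 : Real.exp 1 ^ 4 ≤ 3 ^ 4 :=
      pow_le_pow_left₀ (Real.exp_pos _).le (by linarith [Real.exp_one_lt_d9]) 4
    rw [h1, hd, KWise.avgDim]
    linarith
  have hexpld : Real.exp ld = d := by rw [hld]; exact Real.exp_log hd0
  have hd₁d : (d₁ : ℝ) ≤ 2 * Real.exp ld := by rw [hexpld, hd, KWise.avgDim]; linarith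
  have hd₂d : (d₂ : ℝ) ≤ 2 * Real.exp ld := by rw [hexpld, hd, KWise.avgDim]; linarith
  have hd3 : d ^ (-3 : ℤ) = Real.exp (-3 * ld) := by
    rw [← hexpld, show (-3 : ℤ) = -((3 : ℕ) : ℤ) by norm_num, zpow_neg, zpow_natCast,
      ← Real.exp_nat_mul, ← Real.exp_neg]
    congr 1; push_cast; ring
  obtain ⟨E, hE⟩ : ∃ E, E = Real.exp (2 * α) := ⟨_, rfl⟩
  rw [← hE] at hbigk hexp1
  have hEneg : Real.exp (-(2 * α)) = E⁻¹ := by rw [hE]; exact Real.exp_neg _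
  have hE0 : 0 < E := by rw [hE]; exact Real.exp_pos _
  have hkE : 10 ^ 9 * ld ≤ k * E⁻¹ := by
    rw [le_mul_inv_iff₀ hE0]; linarith
  -- A user loses at least k e^{-2α}/2 slots on average and the Chernoff exponent is L - k
  -- e^{-2α}/4. The fraction 1/5 leaves -k e^{-2α}/20, far below -10 log d.
  obtain ⟨L, hL⟩ : ∃ L, L = ⌊k * E⁻¹ / 5⌋₊ := ⟨_, rfl⟩
  have hLle : (L : ℝ) ≤ k * E⁻¹ / 5 := by rw [hL]; exact Nat.floor_le (by positivity)
  have hLge : k * E⁻¹ / 5 < L + 1 := by rw [hL]; exact Nat.lt_floor_add_one _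
  have hEinv : E⁻¹ ≤ 1 := inv_le_one_of_one_le₀ hexp1
  have hLk : L ≤ k := by
    have h1 : k * E⁻¹ ≤ k * 1 := mul_le_mul_of_nonneg_left hEinv hk0.le
    exact_mod_cast (by linarith : (L : ℝ) ≤ k)
  set K : ℝ := ((k / 2 : ℕ) : ℝ) with hK
  have hKle : 2 * K ≤ k := by
    have : 2 * (k / 2) ≤ k := by omega
    rw [hK]; exact_mod_cast this
  have hKge : (k : ℝ) ≤ 2 * K + 1 := by
    have : k ≤ 2 * (k / 2) + 1 := by omega
    rw [hK]; exact_mod_cast this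
  obtain ⟨s, hs⟩ : ∃ s, s = √(r * X / (k * d₁)) := ⟨_, rfl⟩
  rw [← hs] at hδ
  have hs0 : 0 < s := by rw [hs]; positivity
  have hδpos : 0 < δ := by rw [hδ]; positivity
  obtain ⟨F₀, hF₀⟩ : ∃ F₀, F₀ = δ * √((d₁ : ℝ) * d₂) := ⟨_, rfl⟩
  have hF₀pos : 0 < F₀ := by rw [hF₀]; positivity
  obtain ⟨u, hu⟩ : ∃ u, u = K * δ ^ 2 * d₁ / 4 := ⟨_, rfl⟩
  -- Chosen so that the variance term y₀²(k/2 + 2d₁k/d₂) is at most 2 log d.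
  obtain ⟨y₀, hy₀⟩ : ∃ y₀, y₀ = √(ld * d₂ / (k * ((d₁ : ℝ) + d₂))) := ⟨_, rfl⟩
  have hy₀pos : 0 < y₀ := by rw [hy₀]; positivity
  have hy₀sq : y₀ ^ 2 = ld * d₂ / (k * ((d₁ : ℝ) + d₂)) := by
    rw [hy₀]; exact Real.sq_sqrt (by positivity)
  have hy₀1 : y₀ ≤ 1 := by
    rw [hy₀, Real.sqrt_le_one, div_le_one (by positivity)]
    have h1 : ld ≤ k := by linarith
    exact mul_le_mul h1 (by linarith) hD₂.le hk0.le
  obtain ⟨ρ, hρ⟩ : ∃ ρ, ρ = 6 * (√r * F₀) := ⟨_, rfl⟩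
  have hρpos : 0 < ρ := by rw [hρ]; positivity
  have hlam1 := hlam.1
  have hlam2 := hlam.2
  rw [KWise.lambda0, ← hd, ← hld, ← hX] at hlam1 hlam2
  have hlampos : 0 < lam := lt_of_lt_of_le (by positivity) hlam1
  set D : Set (Matrix (Fin d₁) (Fin d₂) ℝ) := {Δ | (∀ i j, |Δ i j| ≤ 2 * α) ∧
    (∀ i, ∑ j, Δ i j = 0) ∧ KWise.frobNorm Δ = F₀ ∧ KWise.nuclearNorm Δ ≤ ρ} with hDdef
  -- R is the truncation level 10k log d, and τ is chosen so that √(Rτ) is the threshold compared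
  -- with λ/2.
  have hgrad := KWise.score_tail (k := k) (by omega) Θstar (R := 10 * k * ld)
    (τ := 256 * k * X / d₂ / (10 * k * ld)) (by positivity) (by positivity)
  have hRτ : 10 * k * ld * (256 * k * X / d₂ / (10 * k * ld)) = 256 * k * X / d₂ :=
    mul_div_cancel₀ _ (by positivity)
  rw [hRτ] at hgrad
  have henergy := KWise.pairEnergy_tail habs hLk (by omega) hαpos hρpos hy₀pos hy₀1
    (u := u) (F₀ := F₀) (by
      rw [hu, hF₀, mul_pow δ, Real.sq_sqrt (by positivity)]
      exact le_of_eq (by ring)) D fun Δ hΔ => hΔ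
  have hfail1 := hgrad.trans (KWise.gradient_failure hk0 hD₁ hD₂ hld4 hX hd₁d hd₂d)
  have hslice := KWise.slice_exponent (K := K) hαpos hc₀ hr0 hk0 (by linarith) hD₁ hD₂ hld0
    (by
      have := mul_le_mul_of_nonneg_left (by linarith : 1 ≤ ld) (mul_pos hD₂ hld0).le
      rw [hX]; linarith) hs hδ hy₀
  have hy₀var : y₀ ^ 2 * (K + 2 * (d₁ * k) / d₂) ≤ 2 * ld := by
    rw [hy₀sq, div_mul_eq_mul_div, div_le_iff₀ (by positivity)]
    have h1 : ld * d₂ * (K + 2 * (d₁ * k) / d₂) = ld * (K * d₂ + 2 * (d₁ * k)) := by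
      field_simp
    rw [h1]
    have h2 : K * d₂ + 2 * (d₁ * k) ≤ 2 * (k * ((d₁ : ℝ) + d₂)) := by
      have := mul_le_mul_of_nonneg_right (by linarith : K ≤ 2 * k) hD₂.le
      linarith
    have h3 := mul_le_mul_of_nonneg_left h2 hld0.le
    linarith
  have hfail2 := henergy.trans (KWise.energy_failure hD₂ hld4 hd₁d hd₂d
    (by rw [← hF₀, ← hρ, ← hu] at hslice; linarith) (by rw [hEneg]; linarith))
  refine le_trans (by rw [hd3]; linarith) (KWise.le_sampleLaw_real ?_ hfail1 hfail2)
  intro x hxB hxC Θhat hx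
  have hop : KWise.OpBound (KWise.scoreMat Θstar x) √(256 * k * X / d₂) := by
    simpa using hxB
  have hxC' : ∀ Δ ∈ D, u ≤ ∑ i, KWise.pairEnergy (KWise.survivors (x i).2 L)
      (fun m => Δ i ((x i).1 m)) := by
    intro Δ hΔ
    by_contra hlt
    exact hxC ⟨Δ, hΔ, not_le.1 hlt⟩
  have hfrob := KWise.frobNorm_le_of_events hfeas hrank hx hLk hlampos hop
    (KWise.gradient_threshold hα0 hk0 hD₁ hD₂ hX0 hlam1) hF₀pos (u := u)
    (fun Δ h1 h2 h3 h4 => hxC' Δ ⟨h1, h2, h3, h4.trans_eq hρ.symm⟩) rfl (by positivity)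
    (by
      rw [hu, hF₀]
      exact KWise.curvature_dominates hc₀ hr0 hk0 (by linarith) (by rw [hEneg]; linarith) hD₁ hD₂ hX0 hs
        hδ hlam2)
  rw [one_div, inv_mul_le_iff₀ hsq, mul_comm, ← hF₀]
  exact hfrob
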